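/- Let $d\ge 0$, $1\le q<\infty$, $T>0$, let $(\Omega,\mathcal F,P)$ be a probability space, and write $L^q=L^q(\Omega;\mathbb R^d)$ (random variables identified when almost surely equal) and $m(X,Z)=E(|X|^q+|Z|^q+1)$. Let $L:\mathbb R^d\times\mathbb R^d\times L^q\times L^q\to\mathbb R$, $(x,v,X,Z)\mapsto L(x,v,X,Z)$, be continuous and depend on $(X,Z)$ only through its joint law, let $\psi:\mathbb R^d\times L^q\to\mathbb R$, $(x,X)\mapsto\psi(x,X)$, depend on $X$ only through its law, let $X_0\in L^q$, and put $$H(x,p,X,Z)=\sup_{v\in\mathbb R^d}\{-v\cdot p-L(x,v,X,Z)\}.$$ Assume that, for some real constants $c_0,c_1,c_2,c_3$: a) the law of $X_0$ is absolutely continuous with respect to Lebesgue measure; b) $\psi$ is bounded, and $\psi(\cdot,X)$ is Lipschitz for every $X$; c) $L$ is uniformly convex in $v$: for every $R$ there is $\theta>0$ such that $v\mapsto L(x,v,X,Z)-\frac\theta2|v|^2$ is convex for all $x$ and all $X,Z$ with $\|X\|_{L^q},\|Z\|_{L^q}\le R$; and for all $X,Z$, $L(x,v,X,Z)/|v|\to\infty$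 as $|v|\to\infty$, uniformly in $x$; d) $L(x,v,X,Z)\ge -c_0\,m(X,Z)$; e) there is a continuous $v_0:L^q\times L^q\to\mathbb R^d$ with $L(x,v_0(X,Z),X,Z)\le c_1$ for all $x,X,Z$; f) $L$ is $C^2$ in $(x,v)$, with $|D_vL|,|D^2_{xv}L|,|D^2_{xx}L|,|D^2_{vv}L|\le (c_2L+c_3)\,m(X,Z)$ and $|D_xL|\le c_2L+c_3$. Assume moreover that $$E\big(\psi(X,X)-\psi(X,\tilde X)+\psi(\tilde X,\tilde X)-\psi(\tilde X,X)\big)\ge 0\qquad\text{for all }X,\tilde X\in L^q,$$ and that, for all $X,Z,\tilde X,\tilde Z\in L^q$ such that the joint laws of $(X,Z)$ and $(\tilde X,\tilde Z)$ differ, $$E\big(L(X,Z,X,Z)-L(\tilde X,\tilde Z,X,Z)+L(\tilde X,\tilde Z,\tilde X,\tilde Z)-L(X,Z,\tilde X,\tilde Z)\big)>0$$ whenever the random variable in brackets is integrable. (Here the random variables in the first argument of $\psi$ and in the first two arguments of $L$ are evaluated at $\omega$, those in the remaining arguments enter as elements of $L^q$.) A solution of the extended mean-field game is a pair $(u,\mathbf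 X)$ such that: $u:[0,T]\times\mathbb R^d\to\mathbb R$ is continuous, and Lipschitz in $x$ uniformly in $t$; $\mathbf X\in C^1([0,T];L^q)$; $u$ is a viscosity solution of $$-u_t+H(x,D_xu,\mathbf X(t),\dot{\mathbf X}(t))=0\quad\text{in }(0,T)\times\mathbb R^d,\qquad u(x,T)=\psi(x,\mathbf X(T));$$ and $\mathbf X(0)=X_0$ while, for every $t\in(0,T)$, almost surely $u$ is differentiable at $(\mathbf X(t),t)$ and $$\dot{\mathbf X}(t)=-D_pH(\mathbf X(t),D_xu(\mathbf X(t),t),\mathbf X(t),\dot{\mathbf X}(t)).$$ Theorem. There is at most one solution: if $(u,\mathbf X)$ and $(\tilde u,\tilde{\mathbf X})$ are solutions, then $u=\tilde u$ on $[0,T]\times\mathbb R^d$, and $\mathbf X(t)=\tilde{\mathbf X}(t)$ almost surely for every $t\in[0,T]$. -/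

import Mathlib

open Set MeasureTheory Filter
open scoped ENNReal NNReal

namespace EMFG

/-- The state space `ℝᵈ` with its Euclidean norm. -/
abbrev Space (d : ℕ) : Type := EuclideanSpace ℝ (Fin d)

/-- `L^q(Ω; ℝᵈ)`, random variables being identified when they are almost surely equal. -/
abbrev RV (d : ℕ) (q : ℝ≥0∞) {Ω : Type*} [MeasurableSpace Ω] (P : Measure Ω) : Type _ :=
  Lp (Space d) q P

noncomputable section

variable {d : ℕ} {q : ℝ≥0∞} {Ω : Type*} [MeasurableSpace Ω] {P : Measure Ω}
  [Fact (1 ≤ q)]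

/-- The law of `X`. -/
def law (X : RV d q P) : Measure (Space d) :=
  P.map (fun ω => X ω)

/-- The joint law of `(X, Z)`. -/
def jointLaw (X Z : RV d q P) : Measure (Space d × Space d) :=
  P.map (fun ω => (X ω, Z ω))

/-- `E(|X|^q + |Z|^q + 1)`. -/
def moment (X Z : RV d q P) : ℝ :=
  ∫ ω, (‖X ω‖ ^ q.toReal + ‖Z ω‖ ^ q.toReal + 1) ∂P

/-- The Hamiltonian `H(x, p, X, Z) = sup_v (-v·p - L(x, v, X, Z))`. -/
def hamiltonian (L : Space d → Space d → RV d q P → RV d q P → ℝ)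
    (x p : Space d) (X Z : RV d q P) : ℝ :=
  ⨆ v : Space d, (-(inner ℝ v p) - L x v X Z)

/-! ### Assumptions on the data -/

/-- The running cost is continuous in all its variables and depends on the pair of random variables
only through its joint law. -/
structure IsLagrangian (L : Space d → Space d → RV d q P → RV d q P → ℝ) : Prop where
  continuous : Continuous
    (fun a : Space d × Space d × RV d q P × RV d q P => L a.1 a.2.1 a.2.2.1 a.2.2.2)
  law_only : ∀ (x v : Space d) (X Z X' Z' : RV d q P),
    jointLaw X Z = jointLaw X' Z' → L x v X Z = L x v X' Z'

/-- The terminal cost depends on the random variable only through its law. -/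
def TerminalLawOnly (ψ : Space d → RV d q P → ℝ) : Prop :=
  ∀ (x : Space d) (X X' : RV d q P), law X = law X' → ψ x X = ψ x X'

/-- The initial state has an absolutely continuous law. -/
def InitialAC (X₀ : RV d q P) : Prop :=
  law X₀ ≪ (volume : Measure (Space d))

/-- The terminal cost is bounded, and Lipschitz in the state. -/
structure TerminalRegular (ψ : Space d → RV d q P → ℝ) : Prop where
  lipschitz : ∀ X : RV d q P, ∃ K : ℝ≥0, LipschitzWith K (fun x => ψ x X)
  bounded : ∃ M : ℝ, ∀ (x : Space d) (X : RV d q P), |ψ x X| ≤ M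

/-- Uniform convexity in the velocity, with a constant that is uniform in the state
and over bounded sets of `(X, Z)`, and coercivity in the velocity, uniformly in the state. -/
structure ConvexCoercive (L : Space d → Space d → RV d q P → RV d q P → ℝ) : Prop where
  convex : ∀ R : ℝ, ∃ θ : ℝ, 0 < θ ∧ ∀ (x : Space d) (X Z : RV d q P), ‖X‖ ≤ R → ‖Z‖ ≤ R →
    StrongConvexOn univ θ (fun v => L x v X Z)
  coercive : ∀ (X Z : RV d q P) (M : ℝ), ∃ R : ℝ, 0 < R ∧ ∀ x v : Space d,
    R ≤ ‖v‖ → M ≤ L x v X Z / ‖v‖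

/-- `L(x, v, X, Z) ≥ -c₀ E(|X|^q + |Z|^q + 1)`. -/
def LowerBound (L : Space d → Space d → RV d q P → RV d q P → ℝ) (c₀ : ℝ) : Prop :=
  ∀ (x v : Space d) (X Z : RV d q P), -c₀ * moment X Z ≤ L x v X Z

/-- Some velocity, depending continuously on `(X, Z)`, has running cost at most `c₁`
from every state. -/
def CheapVelocity (L : Space d → Space d → RV d q P → RV d q P → ℝ) (c₁ : ℝ) : Prop :=
  ∃ v₀ : RV d q P × RV d q P → Space d, Continuous v₀ ∧
    ∀ (x : Space d) (X Z : RV d q P), L x (v₀ (X, Z)) X Z ≤ c₁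

/-- `L` is `C²` in `(x, v)`, with the bounds
`|D_v L|, |D²_xv L|, |D²_xx L|, |D²_vv L| ≤ (c₂ L + c₃) E(|X|^q + |Z|^q + 1)` and
`|D_x L| ≤ c₂ L + c₃`. -/
structure DerivativeBounds (L : Space d → Space d → RV d q P → RV d q P → ℝ) (c₂ c₃ : ℝ) :
    Prop where
  smooth : ∀ X Z : RV d q P, ContDiff ℝ 2 (fun a : Space d × Space d => L a.1 a.2 X Z)
  dv : ∀ (x v : Space d) (X Z : RV d q P),
    ‖fderiv ℝ (fun w => L x w X Z) v‖ ≤ (c₂ * L x v X Z + c₃) * moment X Z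
  dxv : ∀ (x v : Space d) (X Z : RV d q P),
    ‖fderiv ℝ (fun y => fderiv ℝ (fun w => L y w X Z) v) x‖ ≤ (c₂ * L x v X Z + c₃) * moment X Z
  dxx : ∀ (x v : Space d) (X Z : RV d q P),
    ‖fderiv ℝ (fun y => fderiv ℝ (fun z => L z v X Z) y) x‖ ≤ (c₂ * L x v X Z + c₃) * moment X Z
  dvv : ∀ (x v : Space d) (X Z : RV d q P),
    ‖fderiv ℝ (fun w => fderiv ℝ (fun r => L x r X Z) w) v‖ ≤ (c₂ * L x v X Z + c₃) * moment X Z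
  dx : ∀ (x v : Space d) (X Z : RV d q P),
    ‖fderiv ℝ (fun y => L y v X Z) x‖ ≤ c₂ * L x v X Z + c₃

/-- Monotonicity of the terminal cost. -/
def TerminalMonotone (ψ : Space d → RV d q P → ℝ) : Prop :=
  ∀ X X' : RV d q P,
    0 ≤ ∫ ω, (ψ (X ω) X - ψ (X ω) X' + ψ (X' ω) X' - ψ (X' ω) X) ∂P

/-- The random variable
`L(X, Z, X, Z) - L(X', Z', X, Z) + L(X', Z', X', Z') - L(X, Z, X', Z')`. -/
def lagrangianGap (L : Space d → Space d → RV d q P → RV d q P → ℝ) (X Z X' Z' : RV d q P) :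
    Ω → ℝ :=
  fun ω => L (X ω) (Z ω) X Z - L (X' ω) (Z' ω) X Z + L (X' ω) (Z' ω) X' Z' - L (X ω) (Z ω) X' Z'

/-- Lagrangian monotonicity. Two pairs count as different when their joint laws differ: the
expectation always vanishes for two pairs with the same joint law. -/
def LagrangianMonotone (L : Space d → Space d → RV d q P → RV d q P → ℝ) : Prop :=
  ∀ X Z X' Z' : RV d q P, jointLaw X Z ≠ jointLaw X' Z' →
    Integrable (lagrangianGap L X Z X' Z') P → 0 < ∫ ω, lagrangianGap L X Z X' Z' ω ∂P

/-! ### Solutions -/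

/-- `u` is a viscosity solution of `-u_t + F(t, x, D_x u) = 0` in `(0, T) × ℝᵈ`. -/
structure IsViscositySolution (T : ℝ) (F : ℝ → Space d → Space d → ℝ) (u : ℝ → Space d → ℝ) :
    Prop where
  sub : ∀ φ : ℝ × Space d → ℝ, ContDiff ℝ 1 φ → ∀ t ∈ Ioo 0 T, ∀ x : Space d,
    IsLocalMax (fun a : ℝ × Space d => u a.1 a.2 - φ a) (t, x) →
      -deriv (fun s => φ (s, x)) t + F t x (gradient (fun y => φ (t, y)) x) ≤ 0
  super : ∀ φ : ℝ × Space d → ℝ, ContDiff ℝ 1 φ → ∀ t ∈ Ioo 0 T, ∀ x : Space d,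
    IsLocalMin (fun a : ℝ × Space d => u a.1 a.2 - φ a) (t, x) →
      0 ≤ -deriv (fun s => φ (s, x)) t + F t x (gradient (fun y => φ (t, y)) x)

/-- The `L^q`-valued time derivative of `X` on `[0, T]` (one-sided at the end points). -/
def velocity (T : ℝ) (X : ℝ → RV d q P) (t : ℝ) : RV d q P :=
  derivWithin X (Icc 0 T) t

/-- `(u, X)` solves the extended mean-field game on `[0, T]`:
`-u_t + H(x, D_x u, X, Ẋ) = 0` in the viscosity sense, `u(x, T) = ψ(x, X(T))`,
`Ẋ = -D_p H(X, D_x u(X, t), X, Ẋ)`, `X(0) = X₀`. Here `u` is continuous on `[0, T] × ℝᵈ` and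
Lipschitz in `x`, `X` is `C¹` from `[0, T]` into `L^q`, and `u` is almost surely differentiable at
`(X(t), t)`. -/
structure IsSolution (T : ℝ) (L : Space d → Space d → RV d q P → RV d q P → ℝ)
    (ψ : Space d → RV d q P → ℝ) (X₀ : RV d q P)
    (u : ℝ → Space d → ℝ) (X : ℝ → RV d q P) : Prop where
  u_continuous : ContinuousOn (fun a : ℝ × Space d => u a.1 a.2) (Icc 0 T ×ˢ univ)
  u_lipschitz : ∃ K : ℝ≥0, ∀ t ∈ Icc 0 T, LipschitzWith K (u t)
  X_contDiff : ContDiffOn ℝ 1 X (Icc 0 T)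
  hamilton_jacobi :
    IsViscositySolution T (fun t x p => hamiltonian L x p (X t) (velocity T X t)) u
  terminal : ∀ x : Space d, u T x = ψ x (X T)
  u_differentiable : ∀ t ∈ Ioo 0 T, ∀ᵐ ω ∂P,
    DifferentiableAt ℝ (fun a : ℝ × Space d => u a.1 a.2) (t, X t ω)
  dynamics : ∀ t ∈ Ioo 0 T, ∀ᵐ ω ∂P,
    velocity T X t ω =
      -gradient (fun p => hamiltonian L (X t ω) p (X t) (velocity T X t))
        (gradient (u t) (X t ω))
  initial : X 0 = X₀

end

end EMFG

namespace EMFG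

open scoped Topology

/-! ### Lagrangians frozen along a flow of measures -/

/-! Freeze `L` along a solution, so that it becomes a time-dependent Lagrangian `ℓ` and `u` a
Lipschitz viscosity solution of its Hamilton-Jacobi equation. Two opposite inequalities describe the
optimal flow. The subsolution property says that along any random curve `Y` with bounded velocity
`Z` the expectation of `u(s, Y)` decreases at most at the rate `E ℓ(Y, Z)`
(`LipschitzSolution.lowerSlope_value`). The supersolution property, used only where `u` is
differentiable, says that along the optimal flow it decreases at least at that rate
(`LipschitzSolution.lowerSlope_neg_value`). Both are stated with lower right slopes, since the
curves are differentiable only in `L^q` and `u` need not be differentiable along arbitrary curves.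

Testing each value function on the flow of the other solution, `G = E(u(X') + u'(X) - u(X) -
u'(X'))` has slope at least the Lagrangian gap, which is nonnegative. Since `G(0) = 0`, and `G(T) ≤
0` by terminal monotonicity, `G` vanishes identically and the gap cannot be positive; strict
monotonicity makes the joint laws of state and velocity equal on `(0, T)`
(`IsSolution.jointLaw_eq`). Then both frozen Lagrangians agree there, the terminal data agree by
continuity of laws, and comparison gives `u = u'`.

Equal laws do not yet give equal random variables. Both flows are now optimal for the same `u`, and
they are compared without any regularity of the feedback `-D_pH(x, D_xu)`. Let `δ = X - X'`, with `δ
= 0` at time `τ`, and let `a = δ(b)`. Moving `X` and `X'` towards each other by `ε(δ - a)` changes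
nothing at time `b` and shifts the common initial state by `±εa`. By uniform convexity the running
cost falls by a multiple of `ε E|δ'|²`, up to an error of order `ε sup E|δ|²`, while the initial
value changes only by `o(ε)` because `u(τ, ·)` is differentiable at `X(τ)`. On a short interval the
error is absorbed, so `δ = 0` (`OptimalFlow.eq_short`); the length of the interval is uniform, hence
the argument can be iterated. Differentiability at time `0` comes from Rademacher's theorem and the
absolute continuity of the initial law. -/

/-- A time-dependent Lagrangian, continuous, uniformly convex in the velocity, bounded for bounded
velocities, with bounded double differences. -/
structure TameLagrangian {d : ℕ} (ℓ : ℝ → Space d → Space d → ℝ) : Prop where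
  cont : Continuous fun a : ℝ × Space d × Space d => ℓ a.1 a.2.1 a.2.2
  convex : ∃ θ : ℝ, 0 < θ ∧ ∀ t x, StrongConvexOn univ θ (ℓ t x)
  locBdd : ∀ R : ℝ, ∃ C : ℝ, ∀ t x v, ‖v‖ ≤ R → |ℓ t x v| ≤ C
  diffv : ∀ R : ℝ, ∃ C : ℝ, 0 ≤ C ∧ ∀ t x y v w, ‖v‖ ≤ R → ‖w‖ ≤ R →
    |ℓ t x v - ℓ t y v - ℓ t x w + ℓ t y w| ≤ C * ‖x - y‖ * ‖v - w‖
  diffx : ∀ R : ℝ, ∃ C : ℝ, 0 ≤ C ∧ ∀ t v x y z, ‖v‖ ≤ R →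
    |ℓ t (x + z) v - ℓ t x v - ℓ t (y + z) v + ℓ t y v| ≤ C * ‖z‖ * ‖x - y‖

/-- The Hamiltonian of a single Lagrangian `f`. -/
noncomputable def conj {d : ℕ} (f : Space d → ℝ) (p : Space d) : ℝ :=
  ⨆ v : Space d, (-(inner ℝ v p) - f v)

/-! ### Legendre transform of a strongly convex Lagrangian -/

section Hamiltonian

variable {d : ℕ}

/-- `v` attains the supremum that defines `conj f p`. -/
def IsArgmax (f : Space d → ℝ) (p v : Space d) : Prop :=
  ∀ w, -(inner ℝ w p) - f w ≤ -(inner ℝ v p) - f v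

lemma IsArgmax.conj_eq {f : Space d → ℝ} {p v : Space d} (h : IsArgmax f p v) :
    conj f p = -(inner ℝ v p) - f v :=
  le_antisymm (ciSup_le h) (le_ciSup (f := fun v : Space d => -(inner ℝ v p) - f v)
    ⟨_, by rintro _ ⟨w, rfl⟩; exact h w⟩ v)

lemma IsArgmax.le_conj {f : Space d → ℝ} {p v : Space d} (h : IsArgmax f p v) (w : Space d) :
    -(inner ℝ w p) - f w ≤ conj f p := by
  rw [h.conj_eq]; exact h w

lemma strongConvexOn_le {f : Space d → ℝ} {θ : ℝ} (hf : StrongConvexOn univ θ f) (v w : Space d)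
    {a b : ℝ} (ha : 0 ≤ a) (hb : 0 ≤ b) (hab : a + b = 1) :
    f (a • v + b • w) ≤ a * f v + b * f w - a * b * (θ / 2 * ‖v - w‖ ^ 2) := by
  have h : UniformConvexOn univ (fun r : ℝ => θ / (2 : ℝ) * r ^ 2) f := hf
  exact h.2 (mem_univ v) (mem_univ w) ha hb hab

/-- Strong convexity forces quadratic growth away from the maximizer. -/
lemma IsArgmax.quadratic {f : Space d → ℝ} {p v : Space d} (h : IsArgmax f p v) {θ : ℝ}
    (hf : StrongConvexOn univ θ f) (w : Space d) :
    -(inner ℝ w p) - f w ≤ conj f p - θ / 4 * ‖w - v‖ ^ 2 := by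
  have h1 := strongConvexOn_le hf v w (a := 1 / 2) (b := 1 / 2) (by norm_num) (by norm_num)
    (by norm_num)
  have h2 := h ((1 / 2 : ℝ) • v + (1 / 2 : ℝ) • w)
  rw [h.conj_eq]
  simp only [inner_add_left, real_inner_smul_left] at h1 h2
  rw [norm_sub_rev v w] at h1
  linarith

/-- Testing the supremum at `p'` with `v` bounds the first-order error below by zero; quadratic
growth at `p` and Young's inequality bound it above by `‖p' - p‖² / θ`. -/
lemma IsArgmax.hasGradientAt {f : Space d → ℝ} {p v : Space d} (h : IsArgmax f p v) {θ : ℝ}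
    (hθ : 0 < θ) (hf : StrongConvexOn univ θ f) (hmax : ∀ p', ∃ v', IsArgmax f p' v') :
    HasGradientAt (conj f) (-v) p := by
  rw [hasGradientAt_iff_isLittleO]
  have key : ∀ p', |conj f p' - conj f p - inner ℝ (-v) (p' - p)| ≤ 1 / θ * ‖p' - p‖ ^ 2 := by
    intro p'
    obtain ⟨v', h'⟩ := hmax p'
    have h1 := h'.le_conj v
    have h2 := h.quadratic hf v'
    have h3 := h'.conj_eq
    have h4 := h.conj_eq
    have h5 := abs_le.1 (abs_real_inner_le_norm (v' - v) (p' - p))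
    simp only [inner_sub_left, inner_sub_right, inner_neg_left] at *
    have h6 : ‖v' - v‖ * ‖p' - p‖ ≤ θ / 4 * ‖v' - v‖ ^ 2 + 1 / θ * ‖p' - p‖ ^ 2 := by
      have : θ / 4 * ‖v' - v‖ ^ 2 + 1 / θ * ‖p' - p‖ ^ 2 - ‖v' - v‖ * ‖p' - p‖
          = (θ / 2 * ‖v' - v‖ - ‖p' - p‖) ^ 2 / θ := by field_simp; ring
      have h7 : 0 ≤ (θ / 2 * ‖v' - v‖ - ‖p' - p‖) ^ 2 / θ := by positivity
      linarith
    rw [abs_le]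
    constructor
    · have : 0 ≤ 1 / θ * ‖p' - p‖ ^ 2 := by positivity
      linarith
    · linarith [h5.1]
  rw [Asymptotics.isLittleO_iff]
  intro c hc
  have : ∀ᶠ p' in 𝓝 p, ‖p' - p‖ < c * θ := by
    have := Metric.ball_mem_nhds p (mul_pos hc hθ)
    filter_upwards [this] with y hy using by simpa [dist_eq_norm] using hy
  filter_upwards [this] with p' hp'
  refine (key p').trans ?_
  rw [pow_two, ← mul_assoc]
  gcongr
  rw [one_div, inv_mul_le_iff₀ hθ]; linarith

namespace TameLagrangian

variable {ℓ : ℝ → Space d → Space d → ℝ}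

/-- For bounded momenta the supremum in the Hamiltonian is attained at bounded velocities. -/
lemma exists_argmax (hℓ : TameLagrangian ℓ) (K : ℝ) :
    ∃ R : ℝ, 0 ≤ R ∧ ∀ t x p, ‖p‖ ≤ K → ∃ v, ‖v‖ ≤ R ∧ IsArgmax (ℓ t x) p v := by
  obtain ⟨θ, hθ, hconv⟩ := hℓ.convex
  obtain ⟨C, hC⟩ := hℓ.locBdd 1
  have hC0 : 0 ≤ C := (abs_nonneg _).trans (hC 0 0 0 (by simp))
  -- Chosen so that `‖w‖ > R` forces `(‖w‖ - 1) θ / 2 ≥ |K| + 3C`, which makes `w` worse than the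
  -- zero velocity.
  set R : ℝ := 1 + 2 * (|K| + 3 * C) / θ with hR
  have hR1 : 1 ≤ R := by
    have : 0 ≤ 2 * (|K| + 3 * C) / θ := by positivity
    linarith
  refine ⟨R, by linarith, fun t x p hp => ?_⟩
  have hcont : Continuous fun v : Space d => -(inner ℝ v p) - ℓ t x v := by
    have := hℓ.cont.comp (f := fun v : Space d => (t, x, v)) (by fun_prop)
    exact ((continuous_id.inner continuous_const).neg).sub this
  obtain ⟨v, hv, hmax⟩ := (isCompact_closedBall (0 : Space d) R).exists_isMaxOn
    ⟨0, by simp; linarith⟩ hcont.continuousOn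
  refine ⟨v, by simpa using hv, fun w => ?_⟩
  by_cases hw : ‖w‖ ≤ R
  · exact hmax (by simpa using hw)
  push Not at hw
  have h0 : -(inner ℝ (0 : Space d) p) - ℓ t x 0 ≤ -(inner ℝ v p) - ℓ t x v :=
    hmax (by simp; linarith)
  refine le_trans ?_ h0
  set ρ := ‖w‖ with hρ
  have hρ1 : 1 < ρ := by linarith
  have hρ0 : 0 < ρ := by linarith
  -- Strong convexity on the segment from `0` to `w`, at its point of norm one where `ℓ` is bounded
  -- by `C`, forces quadratic growth of `ℓ` at `w`.
  have h1 := strongConvexOn_le (hconv t x) 0 w (a := 1 - 1 / ρ) (b := 1 / ρ)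
    (by rw [sub_nonneg, div_le_one hρ0]; exact hρ1.le) (by positivity) (by ring)
  have hn : ‖(1 / ρ) • w‖ ≤ 1 := by
    rw [norm_smul, Real.norm_of_nonneg (by positivity), ← hρ]; field_simp; rfl
  have h2 := abs_le.1 (hC t x _ hn)
  have h3 := abs_le.1 (hC t x 0 (by simp))
  simp only [smul_zero, zero_add, zero_sub, norm_neg] at h1
  rw [← hρ] at h1
  have h4 : (1 - 1 / ρ) * ℓ t x 0 ≤ C := by
    have h5 : 0 ≤ 1 - 1 / ρ := by rw [sub_nonneg, div_le_one hρ0]; exact hρ1.le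
    have h6 : 1 - 1 / ρ ≤ 1 := by have : 0 ≤ 1 / ρ := by positivity
                                  linarith
    nlinarith [h3.2]
  have h7 : (1 - 1 / ρ) * (1 / ρ) * (θ / 2 * ρ ^ 2) = (ρ - 1) * (θ / 2) := by field_simp
  rw [h7] at h1
  have h8 : ρ * ((ρ - 1) * (θ / 2) - 2 * C) ≤ ℓ t x w := by
    have : (ρ - 1) * (θ / 2) - 2 * C ≤ 1 / ρ * ℓ t x w := by linarith [h2.1]
    calc _ ≤ ρ * (1 / ρ * ℓ t x w) := by gcongr
      _ = _ := by field_simp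
  have h9 : |K| + 3 * C ≤ (ρ - 1) * (θ / 2) := by
    have : 2 * (|K| + 3 * C) / θ ≤ ρ - 1 := by linarith
    rw [div_le_iff₀ hθ] at this
    linarith
  have h10 := abs_le.1 (abs_real_inner_le_norm w p)
  have h11 : ‖w‖ * ‖p‖ ≤ ρ * |K| := by
    gcongr; exact hp.trans (le_abs_self K)
  have h12 : ρ * (|K| + C) ≤ ρ * ((ρ - 1) * (θ / 2) - 2 * C) := by gcongr; linarith
  simp only [inner_zero_left, neg_zero]
  have h13 : C ≤ ρ * C := by nlinarith
  nlinarith [h10.1, h3.2]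

lemma exists_argmax' (hℓ : TameLagrangian ℓ) (t : ℝ) (x p : Space d) :
    ∃ v, IsArgmax (ℓ t x) p v := by
  obtain ⟨R, -, h⟩ := hℓ.exists_argmax ‖p‖
  obtain ⟨v, -, hv⟩ := h t x p le_rfl
  exact ⟨v, hv⟩

lemma le_conj (hℓ : TameLagrangian ℓ) (t : ℝ) (x p w : Space d) :
    -(inner ℝ w p) - ℓ t x w ≤ conj (ℓ t x) p :=
  let ⟨_, hv⟩ := hℓ.exists_argmax' t x p
  hv.le_conj w

/-- The optimal velocity is the negative gradient of the Hamiltonian. -/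
lemma gradient_conj (hℓ : TameLagrangian ℓ) {t : ℝ} {x p v : Space d} (h : IsArgmax (ℓ t x) p v) :
    gradient (conj (ℓ t x)) p = -v := by
  obtain ⟨θ, hθ, hconv⟩ := hℓ.convex
  exact (h.hasGradientAt hθ (hconv t x) (hℓ.exists_argmax' t x)).gradient

lemma isArgmax_gradient (hℓ : TameLagrangian ℓ) (t : ℝ) (x p : Space d) :
    IsArgmax (ℓ t x) p (-gradient (conj (ℓ t x)) p) := by
  obtain ⟨v, hv⟩ := hℓ.exists_argmax' t x p
  rwa [hℓ.gradient_conj hv, neg_neg]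

lemma norm_gradient_conj_le (hℓ : TameLagrangian ℓ) (K : ℝ) :
    ∃ R : ℝ, 0 ≤ R ∧ ∀ t x p, ‖p‖ ≤ K → ‖gradient (conj (ℓ t x)) p‖ ≤ R := by
  obtain ⟨R, hR, h⟩ := hℓ.exists_argmax K
  refine ⟨R, hR, fun t x p hp => ?_⟩
  obtain ⟨v, hv, hm⟩ := h t x p hp
  rwa [hℓ.gradient_conj hm, norm_neg]

/-- For bounded momenta the maximizers stay in a ball of radius `R`, so the Hamiltonian behaves as a
supremum of affine functions of slope at most `R`. -/
lemma conj_lipschitz (hℓ : TameLagrangian ℓ) (K : ℝ) :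
    ∃ R : ℝ, 0 ≤ R ∧ ∀ t x p p', ‖p‖ ≤ K → ‖p'‖ ≤ K →
      conj (ℓ t x) p - conj (ℓ t x) p' ≤ R * ‖p - p'‖ := by
  obtain ⟨R, hR, h⟩ := hℓ.exists_argmax K
  refine ⟨R, hR, fun t x p p' hp hp' => ?_⟩
  obtain ⟨v, hv, hm⟩ := h t x p hp
  have h1 := hℓ.le_conj t x p' v
  rw [hm.conj_eq]
  have h2 := abs_le.1 (abs_real_inner_le_norm v (p - p'))
  rw [inner_sub_right] at h2
  have : ‖v‖ * ‖p - p'‖ ≤ R * ‖p - p'‖ := by gcongr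
  linarith [h2.1]

lemma conj_le (hℓ : TameLagrangian ℓ) (K : ℝ) :
    ∃ C : ℝ, ∀ t x p, ‖p‖ ≤ K → conj (ℓ t x) p ≤ C := by
  obtain ⟨R, hR, h⟩ := hℓ.exists_argmax K
  obtain ⟨C, hC⟩ := hℓ.locBdd R
  refine ⟨R * K + C, fun t x p hp => ?_⟩
  obtain ⟨v, hv, hm⟩ := h t x p hp
  rw [hm.conj_eq]
  have h2 := abs_le.1 (abs_real_inner_le_norm v p)
  have h3 : ‖v‖ * ‖p‖ ≤ R * K := by gcongr
  linarith [(abs_le.1 (hC t x v hv)).1, h2.1]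

/-- Near a given point the supremum may be taken over one fixed compact ball of velocities, and a
supremum over a compact set of a jointly continuous function is continuous. -/
lemma conj_continuous (hℓ : TameLagrangian ℓ) :
    Continuous fun a : ℝ × Space d × Space d => conj (ℓ a.1 a.2.1) a.2.2 := by
  rw [continuous_iff_continuousAt]
  intro a₀
  obtain ⟨R, hR, h⟩ := hℓ.exists_argmax (‖a₀.2.2‖ + 1)
  let f : ℝ × Space d × Space d → Space d → ℝ := fun a v => -(inner ℝ v a.2.2) - ℓ a.1 a.2.1 v
  have hf : Continuous ↿f := by
    have h1 : Continuous fun b : (ℝ × Space d × Space d) × Space d => ℓ b.1.1 b.1.2.1 b.2 :=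
      hℓ.cont.comp (f := fun b : (ℝ × Space d × Space d) × Space d => (b.1.1, b.1.2.1, b.2))
        (by fun_prop)
    have h2 : Continuous fun b : (ℝ × Space d × Space d) × Space d => (inner ℝ b.2 b.1.2.2 : ℝ) :=
      continuous_snd.inner (by fun_prop)
    exact h2.neg.sub h1
  have hc := (isCompact_closedBall (0 : Space d) R).continuous_sSup hf
  refine hc.continuousAt.congr ?_
  have hnb : ∀ᶠ a : ℝ × Space d × Space d in 𝓝 a₀, ‖a.2.2‖ < ‖a₀.2.2‖ + 1 := by
    have : Continuous fun a : ℝ × Space d × Space d => ‖a.2.2‖ := by fun_prop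
    exact this.continuousAt.eventually_lt continuousAt_const (by linarith)
  filter_upwards [hnb] with a ha
  obtain ⟨v, hv, hm⟩ := h a.1 a.2.1 a.2.2 ha.le
  have : IsGreatest (f a '' Metric.closedBall 0 R) (f a v) :=
    ⟨⟨v, by simpa using hv, rfl⟩, by rintro _ ⟨w, -, rfl⟩; exact hm w⟩
  rw [this.csSup_eq, hm.conj_eq]

end TameLagrangian

end Hamiltonian

/-! ### Touching along lines and dynamic programming inequalities -/

section Viscosity

variable {d : ℕ}

lemma exists_mul_exp_lt {B μ z : ℝ} (hB : 0 < B) (hμ : 0 < μ) (hz : 0 < z) :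
    ∃ l : ℝ, 0 < l ∧ B * Real.exp (-(l * z)) < μ := by
  refine ⟨B / μ / z, by positivity, ?_⟩
  have h1 : B / μ / z * z = B / μ := by field_simp
  rw [h1, Real.exp_neg, ← div_eq_mul_inv, div_lt_iff₀ (Real.exp_pos _)]
  have h2 := Real.add_one_lt_exp (x := B / μ) (by positivity)
  calc B = μ * (B / μ) := by field_simp
    _ < μ * Real.exp (B / μ) := by gcongr; linarith

/-- The gradient of `‖x - c‖² / ε`. -/
lemma hasGradientAt_norm_sub_sq_div (c x : Space d) (ε : ℝ) :
    HasGradientAt (fun x : Space d => ‖x - c‖ ^ 2 / ε) ((2 / ε) • (x - c)) x := by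
  have h0 : HasFDerivAt (fun x : Space d => x - c) (ContinuousLinearMap.id ℝ (Space d)) x :=
    (hasFDerivAt_id (𝕜 := ℝ) x).sub_const c
  have h := h0.norm_sq.mul_const (1 / ε)
  simp only [mul_one_div] at h
  rw [hasGradientAt_iff_hasFDerivAt]
  refine h.congr_fderiv ?_
  ext y
  simp
  ring

lemma hasDerivAt_norm_sub_smul_sq_div (c v : Space d) (a s ε : ℝ) :
    HasDerivAt (fun σ : ℝ => ‖c - (σ - a) • v‖ ^ 2 / ε)
      (-(2 / ε * inner ℝ (c - (s - a) • v) v)) s := by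
  have h1 : HasDerivAt (fun σ : ℝ => c - (σ - a) • v) (-v) s := by
    have := (((hasDerivAt_id s).sub_const a).smul_const v).const_sub c
    simpa using this
  have := h1.norm_sq.div_const ε
  refine this.congr_deriv ?_
  rw [inner_neg_right]; ring

/-- If `w` decreases fast along a line, then a smooth function touches it from above near the line,
at an interior time, and decreases along the line as fast. -/
lemma exists_touching {w : ℝ → Space d → ℝ} {a b K : ℝ} (hab : a < b)
    (hw : ContinuousOn (fun q : ℝ × Space d => w q.1 q.2) (Icc a b ×ˢ univ)) (hK : 0 ≤ K)
    (hlip : ∀ t ∈ Icc a b, ∀ x y, w t x - w t y ≤ K * ‖x - y‖) (x₀ v : Space d) {r m : ℝ}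
    (hr : 0 < r) (h : w b (x₀ + (b - a) • v) - w a x₀ < -m * (b - a)) :
    ∃ φ : ℝ × Space d → ℝ, ContDiff ℝ 1 φ ∧ ∃ s ∈ Ioo a b, ∃ x : Space d,
      ‖x - (x₀ + (s - a) • v)‖ < r ∧ IsLocalMax (fun q : ℝ × Space d => w q.1 q.2 - φ q) (s, x) ∧
      ‖gradient (fun y => φ (s, y)) x‖ ≤ 2 * K ∧
      deriv (fun σ => φ (σ, x)) s + inner ℝ v (gradient (fun y => φ (s, y)) x) < -m := by
  set γ : ℝ → Space d := fun s => x₀ + (s - a) • v with hγ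
  have hγc : Continuous γ := by fun_prop
  set k : ℝ → ℝ := fun s => w s (γ s) + m * s with hk
  have hkc : ContinuousOn k (Icc a b) := by
    refine ContinuousOn.add ?_ (by fun_prop)
    exact hw.comp (f := fun s => (s, γ s)) (by fun_prop) (fun s hs => ⟨hs, mem_univ _⟩)
  have hkab : k b < k a := by
    simp only [hk, hγ, sub_self, zero_smul, add_zero]; linarith
  -- By continuity `k` still exceeds `k b` shortly after `a`; `s₀` is the interior competitor that
  -- excludes a maximum at either end point.
  obtain ⟨s₀, hs₀, hks₀⟩ : ∃ s ∈ Ioo a b, k b < k s := by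
    have h1 : ∀ᶠ s in 𝓝[Icc a b] a, k b < k s :=
      (hkc a (left_mem_Icc.2 hab.le)).eventually_const_lt hkab
    have h2 : ∀ᶠ s in 𝓝[>] a, k b < k s := by
      have := nhdsWithin_mono a (Ioo_subset_Icc_self (a := a) (b := b)) h1
      rwa [nhdsWithin_Ioo_eq_nhdsGT hab] at this
    obtain ⟨s, h3, h4⟩ := (h2.and (Ioo_mem_nhdsGT hab)).exists
    exact ⟨s, h4, h3⟩
  set μ : ℝ := min (1 / 2) ((k s₀ - k b) / 2) with hμ
  have hμ0 : 0 < μ := by rw [hμ, lt_min_iff]; constructor <;> linarith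
  have hμ1 : μ ≤ 1 / 2 := min_le_left _ _
  have hμ2 : μ ≤ (k s₀ - k b) / 2 := min_le_right _ _
  -- Size of the barrier `e` at time `a`: large enough to beat any excess of `k a` over `k s₀`. The
  -- rate `l` then makes `e` smaller than `μ` at `s₀`.
  set B : ℝ := |k a - k s₀| + 1 with hB
  have hB0 : 0 < B := by positivity
  obtain ⟨l, hl, hlμ⟩ := exists_mul_exp_lt hB0 hμ0 (sub_pos.2 hs₀.1)
  obtain ⟨ε, hε, hε1, hε2⟩ : ∃ ε : ℝ, 0 < ε ∧ K ^ 2 * ε < μ ∧ K * ε < r := by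
    refine ⟨min (μ / (K ^ 2 + 1)) (r / (K + 1)), by positivity, ?_, ?_⟩
    · calc K ^ 2 * min (μ / (K ^ 2 + 1)) (r / (K + 1)) ≤ K ^ 2 * (μ / (K ^ 2 + 1)) := by
            gcongr; exact min_le_left _ _
        _ = K ^ 2 * μ / (K ^ 2 + 1) := by ring
        _ < μ := by rw [div_lt_iff₀ (by positivity)]; nlinarith
    · calc K * min (μ / (K ^ 2 + 1)) (r / (K + 1)) ≤ K * (r / (K + 1)) := by
            gcongr; exact min_le_right _ _
        _ = K * r / (K + 1) := by ring
        _ < r := by rw [div_lt_iff₀ (by positivity)]; nlinarith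
  set e : ℝ → ℝ := fun s => B * Real.exp (-(l * (s - a))) with he
  -- The variable `q.2` is the displacement from the line. Its quadratic penalty against the
  -- Lipschitz bound keeps the maximizer within `K * ε < r` of the line, at a gain of at most `K ^ 2
  -- * ε < μ`.
  set Ψ : ℝ × Space d → ℝ := fun q => w q.1 (γ q.1 + q.2) + m * q.1 - e q.1 - ‖q.2‖ ^ 2 / ε with hΨ
  have hΨc : ContinuousOn Ψ (Icc a b ×ˢ Metric.closedBall 0 r) := by
    refine ContinuousOn.sub (ContinuousOn.sub (ContinuousOn.add ?_ ?_) ?_) ?_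
    · exact hw.comp (f := fun q : ℝ × Space d => (q.1, γ q.1 + q.2)) (by fun_prop)
        (fun q hq => ⟨hq.1, mem_univ _⟩)
    all_goals fun_prop
  obtain ⟨⟨s, y⟩, hsy, hmax⟩ := (isCompact_Icc.prod (isCompact_closedBall (0 : Space d) r)).exists_isMaxOn
    ⟨(a, 0), ⟨left_mem_Icc.2 hab.le, by simpa using hr.le⟩⟩ hΨc
  have hs : s ∈ Icc a b := hsy.1
  have hyr : ‖y‖ ≤ r := by simpa using hsy.2
  have hpen : w s (γ s + y) - w s (γ s) ≤ K * ‖y‖ := by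
    simpa using hlip s hs (γ s + y) (γ s)
  have hyK : ‖y‖ ≤ K * ε := by
    have h1 : Ψ (s, 0) ≤ Ψ (s, y) := hmax (show (s, (0 : Space d)) ∈ _ from ⟨hs, by simpa using hr.le⟩)
    simp only [hΨ, add_zero, norm_zero] at h1
    have h2 : ‖y‖ ^ 2 / ε ≤ K * ‖y‖ := by
      have : (0 : ℝ) ^ 2 / ε = 0 := by simp
      linarith
    rw [div_le_iff₀ hε] at h2
    by_contra hcon
    push Not at hcon
    have : 0 < ‖y‖ := lt_of_le_of_lt (by positivity) hcon
    nlinarith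
  have hval : k s₀ - e s₀ ≤ k s - e s + K ^ 2 * ε := by
    have h1 : Ψ (s₀, 0) ≤ Ψ (s, y) :=
      hmax (show (s₀, (0 : Space d)) ∈ _ from ⟨Ioo_subset_Icc_self hs₀, by simpa using hr.le⟩)
    simp only [hΨ, add_zero, norm_zero] at h1
    have h2 : (0 : ℝ) ^ 2 / ε = 0 := by simp
    have h3 : K * ‖y‖ ≤ K ^ 2 * ε := by nlinarith
    have h4 : 0 ≤ ‖y‖ ^ 2 / ε := by positivity
    simp only [hk]
    linarith
  have hes₀ : e s₀ < μ := hlμ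
  have hsa : s ≠ a := by
    rintro rfl
    have h1 : e s = B := by simp [he]
    have := le_abs_self (k s - k s₀)
    linarith
  have hsb : s ≠ b := by
    rintro rfl
    have h1 : 0 ≤ e s := by positivity
    linarith
  have hsI : s ∈ Ioo a b := ⟨lt_of_le_of_ne hs.1 hsa.symm, lt_of_le_of_ne hs.2 hsb⟩
  -- The penalty moves with the line, so it drops out of the derivative of `φ` in the direction `(1,
  -- v)`; what remains is `-m - l * e s`, strictly below `-m`.
  set φ : ℝ × Space d → ℝ := fun q => e q.1 - m * q.1 + ‖q.2 - γ q.1‖ ^ 2 / ε with hφ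
  have hgrad : gradient (fun z => φ (s, z)) (γ s + y) = (2 / ε) • y := by
    have h1 := (hasGradientAt_norm_sub_sq_div (γ s) (γ s + y) ε)
    have h2 : HasGradientAt (fun z => φ (s, z)) ((2 / ε) • (γ s + y - γ s)) (γ s + y) := by
      rw [hasGradientAt_iff_hasFDerivAt] at h1 ⊢
      exact h1.const_add (e s - m * s)
    rw [h2.gradient]; simp
  have hder : deriv (fun σ => φ (σ, γ s + y)) s =
      -(l * e s) - m - 2 / ε * inner ℝ y v := by
    have h1 := hasDerivAt_norm_sub_smul_sq_div (γ s + y - x₀) v a s ε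
    have h2 : HasDerivAt e (-(l * e s)) s := by
      have h3 : HasDerivAt (fun σ : ℝ => -(l * (σ - a))) (-l) s := by
        have h4 : HasDerivAt (fun σ : ℝ => l * (σ - a)) l s := by
          simpa using ((hasDerivAt_id s).sub_const a).const_mul l
        exact h4.fun_neg
      refine (h3.exp.const_mul B).congr_deriv ?_
      simp only [he]; ring
    have h4 : HasDerivAt (fun σ : ℝ => m * σ) m s := by
      simpa using (hasDerivAt_id s).const_mul m
    have h5 := (h2.sub h4).add h1
    have h6 : γ s + y - x₀ - (s - a) • v = y := by simp only [hγ]; abel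
    rw [h6] at h5
    refine (h5.congr_of_eventuallyEq (Eventually.of_forall fun σ => ?_)).deriv.trans (by ring)
    simp only [hφ, hγ, Pi.add_apply, Pi.sub_apply, sub_sub]
  refine ⟨φ, ?_, s, hsI, γ s + y, ?_, ?_, ?_, ?_⟩
  · have : ContDiff ℝ 1 γ := by fun_prop
    simp only [hφ, he]
    have h1 : ContDiff ℝ 1 fun q : ℝ × Space d => ‖q.2 - γ q.1‖ ^ 2 :=
      (contDiff_snd.sub (this.comp contDiff_fst)).norm_sq ℝ
    fun_prop
  · simpa [hγ] using lt_of_le_of_lt hyK hε2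
  · have hopen : ∀ᶠ q : ℝ × Space d in 𝓝 (s, γ s + y), q.1 ∈ Ioo a b ∧ ‖q.2 - γ q.1‖ < r := by
      refine Filter.Eventually.and ?_ ?_
      · exact continuous_fst.continuousAt.preimage_mem_nhds (Ioo_mem_nhds hsI.1 hsI.2)
      · have : Continuous fun q : ℝ × Space d => ‖q.2 - γ q.1‖ := by fun_prop
        exact this.continuousAt.eventually_lt continuousAt_const
          (by simpa using lt_of_le_of_lt hyK hε2)
    filter_upwards [hopen] with q hq
    have h1 : Ψ (q.1, q.2 - γ q.1) ≤ Ψ (s, y) :=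
      hmax (show (q.1, q.2 - γ q.1) ∈ _ from
        ⟨Ioo_subset_Icc_self hq.1, by simpa using hq.2.le⟩)
    simp only [hΨ, add_sub_cancel] at h1
    simp only [hφ, add_sub_cancel_left]
    linarith
  · rw [hgrad, norm_smul, Real.norm_of_nonneg (by positivity)]
    calc 2 / ε * ‖y‖ ≤ 2 / ε * (K * ε) := by gcongr
      _ = 2 * K := by field_simp
  · rw [hgrad, hder, real_inner_smul_right, real_inner_comm]
    have : 0 < l * e s := by positivity
    linarith

variable {T : ℝ} {ℓ : ℝ → Space d → Space d → ℝ} {u : ℝ → Space d → ℝ}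

/-- A viscosity subsolution satisfies the dynamic programming inequality along short lines. -/
lemma IsViscositySolution.sub_along_line (hℓ : TameLagrangian ℓ)
    (hu : IsViscositySolution T (fun t x p => conj (ℓ t x) p) u)
    (hc : ContinuousOn (fun q : ℝ × Space d => u q.1 q.2) (Icc 0 T ×ˢ univ)) {K : ℝ} (hK : 0 ≤ K)
    (hlip : ∀ t ∈ Icc 0 T, ∀ x y, u t x - u t y ≤ K * ‖x - y‖) {a b : ℝ} (ha : 0 ≤ a) (hab : a < b)
    (hb : b ≤ T) (x v : Space d) {r m : ℝ} (hr : 0 < r)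
    (hm : ∀ s ∈ Ioo a b, ∀ y, ‖y - (x + (s - a) • v)‖ < r → ℓ s y v ≤ m) :
    -m * (b - a) ≤ u b (x + (b - a) • v) - u a x := by
  by_contra hcon
  push Not at hcon
  have hsub : Icc a b ⊆ Icc 0 T := Icc_subset_Icc ha hb
  obtain ⟨φ, hφ, s, hs, y, hy, hmax, -, hlt⟩ := exists_touching hab
    (hc.mono (prod_mono hsub le_rfl)) hK (fun t ht => hlip t (hsub ht)) x v hr hcon
  have h1 := hu.sub φ hφ s ⟨lt_of_le_of_lt ha hs.1, lt_of_lt_of_le hs.2 hb⟩ y hmax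
  -- Since `H ≥ -v·∇φ - ℓ`, the subsolution inequality bounds the derivative of `φ` along the line
  -- below by `-m`, which contradicts the touching.
  have h2 := hℓ.le_conj s y (gradient (fun y => φ (s, y)) y) v
  have h3 := hm s hs y hy
  linarith

/-- Solutions are Lipschitz in time from above. -/
lemma IsViscositySolution.time_upper (hℓ : TameLagrangian ℓ)
    (hu : IsViscositySolution T (fun t x p => conj (ℓ t x) p) u)
    (hc : ContinuousOn (fun q : ℝ × Space d => u q.1 q.2) (Icc 0 T ×ˢ univ)) {K : ℝ} (hK : 0 ≤ K)
    (hlip : ∀ t ∈ Icc 0 T, ∀ x y, u t x - u t y ≤ K * ‖x - y‖) :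
    ∃ C : ℝ, ∀ a b, 0 ≤ a → a ≤ b → b ≤ T → ∀ x, u b x - u a x ≤ C * (b - a) := by
  obtain ⟨C, hC⟩ := hℓ.conj_le (2 * K)
  refine ⟨C, fun a b ha hab hb x => ?_⟩
  rcases hab.eq_or_lt with rfl | hab
  · simp
  by_contra hcon
  push Not at hcon
  have hsub : Icc a b ⊆ Icc 0 T := Icc_subset_Icc ha hb
  -- Touching `-u` from above gives a test function below `u` with gradient at most `2K`, where the
  -- Hamiltonian is at most `C`; the supersolution inequality then limits its time derivative.
  obtain ⟨φ, hφ, s, hs, y, hy, hmax, hp, hlt⟩ := exists_touching (w := fun t x => -u t x) hab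
    (hc.mono (prod_mono hsub le_rfl)).neg hK
    (fun t ht x y => by have := hlip t (hsub ht) y x; rw [norm_sub_rev] at this; linarith) x 0
    (m := C) zero_lt_one (by simp; linarith)
  have h0 : IsLocalMin (fun q : ℝ × Space d => u q.1 q.2 - (fun q => -φ q) q) (s, y) := by
    filter_upwards [hmax] with q hq
    linarith
  have h1 := hu.super (fun q => -φ q) hφ.neg s
    ⟨lt_of_le_of_lt ha hs.1, lt_of_lt_of_le hs.2 hb⟩ y h0
  have hg : gradient (fun z => -φ (s, z)) y = -gradient (fun z => φ (s, z)) y := by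
    simp only [gradient]
    rw [show (fun z => -φ (s, z)) = -(fun z => φ (s, z)) from rfl, fderiv_neg, map_neg]
  rw [hg] at h1
  have h2 := hC s y (-gradient (fun z => φ (s, z)) y) (by rwa [norm_neg])
  have h3 : deriv (fun σ => -φ (σ, y)) s = -deriv (fun σ => φ (σ, y)) s := deriv.fun_neg
  simp only [inner_zero_left, add_zero] at h1 hlt
  rw [h3] at h1
  linarith

/-- Solutions are Lipschitz in time from below, also along lines. -/
lemma IsViscositySolution.line_lower (hℓ : TameLagrangian ℓ)
    (hu : IsViscositySolution T (fun t x p => conj (ℓ t x) p) u)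
    (hc : ContinuousOn (fun q : ℝ × Space d => u q.1 q.2) (Icc 0 T ×ˢ univ)) {K : ℝ} (hK : 0 ≤ K)
    (hlip : ∀ t ∈ Icc 0 T, ∀ x y, u t x - u t y ≤ K * ‖x - y‖) (R : ℝ) :
    ∃ C : ℝ, ∀ a b, 0 ≤ a → a ≤ b → b ≤ T → ∀ x v, ‖v‖ ≤ R →
      -C * (b - a) ≤ u b (x + (b - a) • v) - u a x := by
  obtain ⟨C, hC⟩ := hℓ.locBdd R
  refine ⟨C, fun a b ha hab hb x v hv => ?_⟩
  rcases hab.eq_or_lt with rfl | hab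
  · simp
  exact hu.sub_along_line hℓ hc hK hlip ha hab hb x v zero_lt_one
    (fun s _ y _ => (abs_le.1 (hC s y v hv)).2)

/-- The lower right derivative along a line is at least `-ℓ`. -/
lemma IsViscositySolution.line_liminf (hℓ : TameLagrangian ℓ)
    (hu : IsViscositySolution T (fun t x p => conj (ℓ t x) p) u)
    (hc : ContinuousOn (fun q : ℝ × Space d => u q.1 q.2) (Icc 0 T ×ˢ univ)) {K : ℝ} (hK : 0 ≤ K)
    (hlip : ∀ t ∈ Icc 0 T, ∀ x y, u t x - u t y ≤ K * ‖x - y‖) {t : ℝ} (ht : t ∈ Ioo 0 T)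
    (x v : Space d) {c : ℝ} (hlt : c < -ℓ t x v) :
    ∀ᶠ s in 𝓝[>] t, c * (s - t) ≤ u s (x + (s - t) • v) - u t x := by
  have hcont : Continuous fun q : ℝ × Space d => ℓ q.1 q.2 v :=
    hℓ.cont.comp (f := fun q : ℝ × Space d => (q.1, q.2, v)) (by fun_prop)
  have h1 : ∀ᶠ q : ℝ × Space d in 𝓝 (t, x), ℓ q.1 q.2 v < -c :=
    hcont.continuousAt.eventually_lt continuousAt_const (by simp only; linarith)
  obtain ⟨ρ, hρ, hball⟩ := Metric.eventually_nhds_iff.1 h1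
  have h2 : ∀ᶠ s in 𝓝[>] t, (s - t) * (‖v‖ + 1) < ρ / 2 ∧ s ≤ T := by
    have h3 : Continuous fun s : ℝ => (s - t) * (‖v‖ + 1) := by fun_prop
    have h4 : ∀ᶠ s in 𝓝 t, (s - t) * (‖v‖ + 1) < ρ / 2 :=
      h3.continuousAt.eventually_lt continuousAt_const (by simp; linarith)
    exact (h4.filter_mono nhdsWithin_le_nhds).and
      ((eventually_le_nhds ht.2).filter_mono nhdsWithin_le_nhds)
  filter_upwards [h2, self_mem_nhdsWithin] with s hs hts
  have hts : t < s := hts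
  have := hu.sub_along_line hℓ hc hK hlip ht.1.le hts hs.2 x v (r := ρ / 2) (m := -c) (by positivity)
    (fun σ hσ y hy => by
      have h5 : 0 ≤ ‖v‖ := norm_nonneg v
      have h6 : (σ - t) * ‖v‖ ≤ (s - t) * (‖v‖ + 1) := by nlinarith [hσ.1, hσ.2]
      have h7 : σ - t ≤ (s - t) * (‖v‖ + 1) := by nlinarith [hσ.1, hσ.2]
      refine (hball (y := (σ, y)) ?_).le
      rw [Prod.dist_eq, max_lt_iff]
      constructor
      · simp only [Real.dist_eq, abs_of_pos (sub_pos.2 hσ.1)]; linarith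
      · simp only [dist_eq_norm]
        calc ‖y - x‖ = ‖(y - (x + (σ - t) • v)) + (σ - t) • v‖ := by congr 1; abel
          _ ≤ ‖y - (x + (σ - t) • v)‖ + ‖(σ - t) • v‖ := norm_add_le _ _
          _ = ‖y - (x + (σ - t) • v)‖ + (σ - t) * ‖v‖ := by
            rw [norm_smul, Real.norm_of_nonneg (sub_pos.2 hσ.1).le]
          _ < ρ := by linarith)
  linarith

end Viscosity

/-! ### Differentiability points, and comparison by doubling of variables -/

section Comparison

variable {d : ℕ} {T : ℝ} {F : ℝ → Space d → Space d → ℝ} {u w : ℝ → Space d → ℝ}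

/-- At a point of differentiability a viscosity supersolution satisfies the equation as a
classical supersolution. -/
lemma IsViscositySolution.fderiv_le (hF : Continuous fun a : ℝ × Space d × Space d => F a.1 a.2.1 a.2.2)
    (hu : IsViscositySolution T F u)
    (hc : ContinuousOn (fun q : ℝ × Space d => u q.1 q.2) (Icc 0 T ×ˢ univ))
    {t : ℝ} (ht : t ∈ Ioo 0 T) {x : Space d} {D : ℝ × Space d →L[ℝ] ℝ}
    (hD : HasFDerivAt (fun q : ℝ × Space d => u q.1 q.2) D (t, x)) {p : Space d}
    (hp : HasGradientAt (fun y => D (0, y)) p x) : D (1, 0) ≤ F t x p := by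
  by_contra hcon
  push Not at hcon
  -- The extra real slot carries the perturbation of the time derivative, so that one neighbourhood
  -- controls both perturbations.
  have hcont : Continuous fun a : (ℝ × Space d) × (Space d × ℝ) => F a.1.1 a.1.2 a.2.1 + a.2.2 := by
    have h1 : Continuous fun a : (ℝ × Space d) × (Space d × ℝ) => F a.1.1 a.1.2 a.2.1 :=
      hF.comp (f := fun a : (ℝ × Space d) × (Space d × ℝ) => (a.1.1, a.1.2, a.2.1)) (by fun_prop)
    fun_prop
  have hev : ∀ᶠ a in 𝓝 (((t, x), (p, 0)) : (ℝ × Space d) × (Space d × ℝ)),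
      F a.1.1 a.1.2 a.2.1 + a.2.2 < D (1, 0) :=
    hcont.continuousAt.eventually_lt continuousAt_const (by simpa using hcon)
  obtain ⟨ρ, hρ, hball⟩ := Metric.eventually_nhds_iff.1 hev
  set e : ℝ := ρ / 8 with he
  have he0 : 0 < e := by positivity
  have hlo := (Asymptotics.isLittleO_iff.1 hD.isLittleO) he0
  obtain ⟨r₁, hr₁, hlo⟩ := Metric.eventually_nhds_iff.1 hlo
  obtain ⟨r₂, hr₂, hI⟩ := Metric.eventually_nhds_iff.1 (Ioo_mem_nhds ht.1 ht.2)
  obtain ⟨r, hr, hrρ, hrr₁, hrr₂⟩ : ∃ r : ℝ, 0 < r ∧ r < ρ ∧ r < r₁ ∧ r < r₂ := by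
    refine ⟨min ρ (min r₁ r₂) / 2, by positivity, ?_, ?_, ?_⟩
    · linarith [min_le_left ρ (min r₁ r₂), lt_min hρ (lt_min hr₁ hr₂)]
    · linarith [(min_le_right ρ (min r₁ r₂)).trans (min_le_left _ _), lt_min hρ (lt_min hr₁ hr₂)]
    · linarith [(min_le_right ρ (min r₁ r₂)).trans (min_le_right _ _), lt_min hρ (lt_min hr₁ hr₂)]
  -- On the sphere of radius `r` the penalty is at least `2 e r`, while differentiability leaves an
  -- error of at most `e r`; hence the minimum is interior. The penalty changes the derivatives by
  -- at most `2 r / κ = 4 e < ρ`.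
  set κ : ℝ := r / (2 * e) with hκ
  have hκ0 : 0 < κ := by positivity
  set φ : ℝ × Space d → ℝ := fun q => D q - (‖q.2 - x‖ ^ 2 / κ + (q.1 - t) ^ 2 / κ) with hφ
  have hIcc : Metric.closedBall (t, x) r ⊆ Icc 0 T ×ˢ univ := by
    intro q hq
    have : dist q.1 t < r₂ := by
      refine lt_of_le_of_lt ?_ hrr₂
      exact (le_max_left _ _).trans (Metric.mem_closedBall.1 hq)
    exact ⟨Ioo_subset_Icc_self (hI this), mem_univ _⟩
  have hφc : Continuous φ := by fun_prop
  obtain ⟨⟨s, y⟩, hsy, hmin⟩ := (isCompact_closedBall (t, x) r).exists_isMinOn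
    ⟨(t, x), Metric.mem_closedBall_self hr.le⟩ ((hc.mono hIcc).sub hφc.continuousOn)
  have h0 : u s y - φ (s, y) ≤ u t x - φ (t, x) := hmin (Metric.mem_closedBall_self hr.le)
  have hdist : dist (s, y) (t, x) < r := by
    refine lt_of_le_of_ne (Metric.mem_closedBall.1 hsy) fun heq => ?_
    have h1 := hlo (y := (s, y)) (by rw [heq]; exact hrr₁)
    rw [← dist_eq_norm (s, y) (t, x), heq, Real.norm_eq_abs, map_sub] at h1
    simp only [hφ, sub_self, norm_zero] at h0
    have h2 : r ^ 2 ≤ ‖y - x‖ ^ 2 + (s - t) ^ 2 := by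
      rw [Prod.dist_eq, max_def] at heq
      split_ifs at heq with hle
      · simp only [dist_eq_norm] at heq
        rw [heq]; nlinarith [sq_nonneg (s - t)]
      · simp only [Real.dist_eq] at heq
        rw [← sq_abs (s - t), heq]; nlinarith [sq_nonneg ‖y - x‖]
    have h3 : 2 * e * r ≤ ‖y - x‖ ^ 2 / κ + (s - t) ^ 2 / κ := by
      rw [← add_div, le_div_iff₀ hκ0]
      refine le_trans (le_of_eq ?_) h2
      rw [hκ]; field_simp
    have h4 := (abs_le.1 h1).1
    have h5 : (0 : ℝ) ^ 2 / κ = 0 := by simp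
    have : 0 < e * r := by positivity
    linarith
  have hs : s ∈ Ioo 0 T :=
    hI (lt_of_le_of_lt ((le_max_left _ _).trans hdist.le) hrr₂)
  have hφd : ContDiff ℝ 1 φ := by
    have h1 : ContDiff ℝ 1 fun q : ℝ × Space d => ‖q.2 - x‖ ^ 2 :=
      (contDiff_snd.sub contDiff_const).norm_sq ℝ
    have h2 : ContDiff ℝ 1 D := D.contDiff
    simp only [hφ]
    fun_prop
  have hlm : IsLocalMin (fun q : ℝ × Space d => u q.1 q.2 - φ q) (s, y) := by
    have : Metric.closedBall (t, x) r ∈ 𝓝 (s, y) :=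
      mem_of_superset (Metric.isOpen_ball.mem_nhds (Metric.mem_ball.2 hdist))
        Metric.ball_subset_closedBall
    filter_upwards [this] with q hq
    exact hmin hq
  have hsup := hu.super φ hφd s hs y hlm
  have hder : deriv (fun σ => φ (σ, y)) s = D (1, 0) - 2 / κ * (s - t) := by
    have h1 : HasDerivAt (fun σ : ℝ => D (σ, y)) (D (1, 0)) s :=
      D.hasFDerivAt.comp_hasDerivAt (f := fun σ : ℝ => (σ, y)) s
        ((hasDerivAt_id s).prodMk (hasDerivAt_const s y))
    have h2 : HasDerivAt (fun σ : ℝ => (σ - t) ^ 2 / κ) (2 / κ * (s - t)) s := by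
      have := (((hasDerivAt_id s).sub_const t).pow 2).div_const κ
      refine (this.congr_deriv ?_)
      simp; ring
    exact (h1.sub (h2.const_add (‖y - x‖ ^ 2 / κ))).deriv
  have hgr : gradient (fun z => φ (s, z)) y = p - (2 / κ) • (y - x) := by
    have h1 := hasGradientAt_norm_sub_sq_div x y κ
    rw [hasGradientAt_iff_hasFDerivAt] at h1 hp
    have h2 : HasFDerivAt (fun z : Space d => D (0, z)) (InnerProductSpace.toDual ℝ (Space d) p) y := by
      have h3 : ∀ z, HasFDerivAt (fun z : Space d => D (0, z))
          (D.comp (ContinuousLinearMap.inr ℝ ℝ (Space d))) z := fun z =>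
        (D.comp (ContinuousLinearMap.inr ℝ ℝ (Space d))).hasFDerivAt
      rw [hp.unique (h3 x)]
      exact h3 y
    have h4 : HasFDerivAt (fun z : Space d => D (s, z))
        (InnerProductSpace.toDual ℝ (Space d) p) y := by
      refine (h2.const_add (D (s, 0))).congr_of_eventuallyEq (Eventually.of_forall fun z => ?_)
      have := (D.map_add (s, 0) (0, z)).symm
      simpa using this.symm
    have h5 : HasGradientAt (fun z => φ (s, z)) (p - (2 / κ) • (y - x)) y := by
      rw [hasGradientAt_iff_hasFDerivAt, map_sub]
      exact h4.sub (h1.add_const ((s - t) ^ 2 / κ))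
    exact h5.gradient
  rw [hder, hgr] at hsup
  have hκe : 2 / κ * r = 4 * e := by rw [hκ]; field_simp; ring
  have hyx : ‖y - x‖ ≤ r := by
    rw [← dist_eq_norm]; exact (le_max_right _ _).trans hdist.le
  have hst : |s - t| ≤ r := by
    rw [← Real.dist_eq]; exact (le_max_left _ _).trans hdist.le
  have hmem := hball (y := ((s, y), (p - (2 / κ) • (y - x), 2 / κ * (s - t)))) (by
    rw [Prod.dist_eq, max_lt_iff]
    refine ⟨hdist.trans hrρ, ?_⟩
    rw [Prod.dist_eq, max_lt_iff]
    constructor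
    · simp only [dist_eq_norm, sub_sub_cancel_left, norm_neg, norm_smul]
      rw [Real.norm_of_nonneg (by positivity)]
      calc 2 / κ * ‖y - x‖ ≤ 2 / κ * r := by gcongr
        _ < ρ := by rw [hκe]; linarith
    · simp only [Real.dist_eq, sub_zero, abs_mul]
      rw [abs_of_nonneg (by positivity)]
      calc 2 / κ * |s - t| ≤ 2 / κ * r := by gcongr
        _ < ρ := by rw [hκe]; linarith)
  simp only at hmem
  linarith

set_option maxHeartbeats 1000000 in
/-- Comparison principle for Lipschitz solutions. -/
lemma IsViscositySolution.comparison
    (hF : Continuous fun a : ℝ × Space d × Space d => F a.1 a.2.1 a.2.2)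
    (hFl : ∀ K : ℝ, ∃ R : ℝ, 0 ≤ R ∧ ∀ t x p p', ‖p‖ ≤ K → ‖p'‖ ≤ K →
      F t x p - F t x p' ≤ R * ‖p - p'‖)
    (hu : IsViscositySolution T F u) (hw : IsViscositySolution T F w)
    (huc : ContinuousOn (fun q : ℝ × Space d => u q.1 q.2) (Icc 0 T ×ˢ univ))
    (hwc : ContinuousOn (fun q : ℝ × Space d => w q.1 q.2) (Icc 0 T ×ˢ univ))
    {K C M : ℝ} (hK : 0 ≤ K) (hC : 0 ≤ C)
    (hwl : ∀ t ∈ Icc 0 T, ∀ x y, w t x - w t y ≤ K * ‖x - y‖)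
    (hut : ∀ t ∈ Icc 0 T, ∀ x, u t x - u T x ≤ C * (T - t))
    (hwt : ∀ t ∈ Icc 0 T, ∀ x, w T x - w t x ≤ C * (T - t))
    (hM : ∀ t ∈ Icc 0 T, ∀ s ∈ Icc 0 T, ∀ x y, u t x - w s y ≤ 2 * M)
    (hT : ∀ x, u T x ≤ w T x) {t : ℝ} (ht : t ∈ Ioo 0 T) (x : Space d) : u t x ≤ w t x := by
  by_contra hcon
  push Not at hcon
  obtain ⟨t₀, ht₀, x₀, hx₀⟩ : ∃ t₀ ∈ Ioo 0 T, ∃ x₀, w t₀ x₀ < u t₀ x₀ := ⟨t, ht, x, hcon⟩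
  clear hcon ht x t
  have hI0 := Ioo_subset_Icc_self ht₀
  set σ : ℝ := u t₀ x₀ - w t₀ x₀ with hσ
  have hσ0 : 0 < σ := sub_pos.2 hx₀
  have hσM : σ ≤ 2 * M := hM _ hI0 _ hI0 _ _
  have hM0 : 0 < M := by linarith
  set a : ℝ := t₀ / 2 with ha
  have ha0 : 0 < a := half_pos ht₀.1
  have hat : a < t₀ := half_lt_self ht₀.1
  have haT : a < T := hat.trans ht₀.2
  have hsub : Icc a T ⊆ Icc 0 T := Icc_subset_Icc_left ha0.le
  -- Larger than every value of `u - w`, so the barrier excludes maxima near time `a`.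
  set B : ℝ := 2 * M + 1 with hB
  have hB0 : 0 < B := by positivity
  obtain ⟨l, hl, hlσ⟩ := exists_mul_exp_lt hB0 (show 0 < σ / 4 by positivity) (sub_pos.2 hat)
  -- The least rate of decrease of the barrier on `[a, T]`: this is the strictness in the
  -- subsolution inequality. Half of it pays for the gradient `q` of the localization, half for the
  -- distance between the two points.
  set κ : ℝ := l * (B * Real.exp (-(l * (T - a)))) with hκ
  have hκ0 : 0 < κ := by positivity
  obtain ⟨RL, hRL, hFL⟩ := hFl (2 * K + 1)
  set ρ : ℝ := min 1 (κ / (2 * (RL + 1))) with hρ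
  have hρ0 : 0 < ρ := by positivity
  have hρ1 : ρ ≤ 1 := min_le_left _ _
  have hρ2 : RL * ρ ≤ κ / 2 := by
    calc RL * ρ ≤ (RL + 1) * (κ / (2 * (RL + 1))) := by
          gcongr
          · linarith
          · exact min_le_right _ _
      _ = κ / 2 := by field_simp
  -- Weight of the localizing term `δ ‖x‖²`: it costs less than `σ / 4` at `x₀`, and its gradient is
  -- at most `ρ` wherever `δ ‖x‖² ≤ 2M`.
  set δ : ℝ := min (σ / (8 * (‖x₀‖ ^ 2 + 1))) (ρ ^ 2 / (8 * M)) with hδ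
  have hδ0 : 0 < δ := by positivity
  have hδ1 : δ * ‖x₀‖ ^ 2 < σ / 4 := by
    calc δ * ‖x₀‖ ^ 2 ≤ σ / (8 * (‖x₀‖ ^ 2 + 1)) * (‖x₀‖ ^ 2 + 1) := by
          gcongr
          · exact min_le_left _ _
          · linarith
      _ = σ / 8 := by field_simp
      _ < σ / 4 := by linarith
  have hδ2 : 8 * M * δ ≤ ρ ^ 2 := by
    calc 8 * M * δ ≤ 8 * M * (ρ ^ 2 / (8 * M)) := by gcongr; exact min_le_right _ _
      _ = ρ ^ 2 := by field_simp
  set Rd : ℝ := 2 * M / δ + 1 + ‖x₀‖ with hRd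
  have hRd1 : 1 ≤ Rd := by
    have : 0 ≤ 2 * M / δ + ‖x₀‖ := by positivity
    linarith
  have hRd2 : 2 * M < δ * Rd ^ 2 := by
    have h1 : 2 * M / δ < Rd := by
      have := norm_nonneg x₀
      linarith
    rw [div_lt_iff₀ hδ0] at h1
    nlinarith
  have hRdx : ‖x₀‖ ≤ Rd := by
    have : 0 ≤ 2 * M / δ := by positivity
    linarith
  have hcomp : IsCompact (Icc a T ×ˢ Metric.closedBall (0 : Space d) (Rd + 1) ×ˢ
      Metric.closedBall (0 : Space d) (2 * K)) :=
    isCompact_Icc.prod ((isCompact_closedBall _ _).prod (isCompact_closedBall _ _))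
  obtain ⟨η, hη, hunif⟩ := Metric.uniformContinuousOn_iff.1
    (hcomp.uniformContinuousOn_of_continuous hF.continuousOn) (κ / 2) (by positivity)
  obtain ⟨ν, hν, hνη, hν1, hνσ, hνl⟩ : ∃ ν : ℝ, 0 < ν ∧ ν ≤ η ∧ ν ≤ 1 ∧
      (C + K) * ν < σ / 2 ∧ l * ν * B < 1 := by
    refine ⟨min (min η 1) (min (σ / (4 * (C + K + 1))) (1 / (2 * l * B))), by positivity,
      (min_le_left _ _).trans (min_le_left _ _), (min_le_left _ _).trans (min_le_right _ _), ?_, ?_⟩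
    · calc (C + K) * min (min η 1) (min (σ / (4 * (C + K + 1))) (1 / (2 * l * B)))
          _ ≤ (C + K + 1) * (σ / (4 * (C + K + 1))) := by
            exact mul_le_mul (by linarith)
              ((min_le_right (min η 1) _).trans (min_le_left _ _)) (by positivity) (by positivity)
          _ = σ / 4 := by field_simp
          _ < _ := by linarith
    · calc l * min (min η 1) (min (σ / (4 * (C + K + 1))) (1 / (2 * l * B))) * B
          _ ≤ l * (1 / (2 * l * B)) * B := by
            gcongr
            exact (min_le_right (min η 1) _).trans (min_le_right _ _)
          _ = 1 / 2 := by field_simp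
          _ < _ := by norm_num
  -- At a positive maximum the doubling penalties are at most `2M`, which now forces `‖x - y‖` and
  -- `|t - s|` below `ν`.
  set ε : ℝ := ν ^ 2 / (4 * M) with hε
  have hε0 : 0 < ε := by positivity
  have hεν : 2 * M * ε < ν ^ 2 := by
    have : 2 * M * ε = ν ^ 2 / 2 := by rw [hε]; field_simp; ring
    have : 0 < ν ^ 2 := by positivity
    linarith
  set e : ℝ → ℝ := fun s => B * Real.exp (-(l * (s - a))) with he
  set Φ : (ℝ × ℝ) × (Space d × Space d) → ℝ := fun q =>
    u q.1.1 q.2.1 - w q.1.2 q.2.2 - (‖q.2.1 - q.2.2‖ ^ 2 / ε + (q.1.1 - q.1.2) ^ 2 / ε)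
      - ‖q.2.1 - 0‖ ^ 2 / (1 / δ) - e q.1.1 with hΦ
  -- The second ball is larger by one, so that `y`, at distance less than `ν ≤ 1` from `x`, is an
  -- interior point.
  set S : Set ((ℝ × ℝ) × (Space d × Space d)) := (Icc a T ×ˢ Icc a T) ×ˢ
    (Metric.closedBall 0 Rd ×ˢ Metric.closedBall 0 (Rd + 1)) with hS
  have hSc : IsCompact S := (isCompact_Icc.prod isCompact_Icc).prod
    ((isCompact_closedBall _ _).prod (isCompact_closedBall _ _))
  have hΦc : ContinuousOn Φ S := by
    have h1 : ContinuousOn (fun q : (ℝ × ℝ) × (Space d × Space d) => u q.1.1 q.2.1) S :=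
      huc.comp (f := fun q : (ℝ × ℝ) × (Space d × Space d) => (q.1.1, q.2.1)) (by fun_prop)
        (fun q hq => ⟨hsub hq.1.1, mem_univ _⟩)
    have h2 : ContinuousOn (fun q : (ℝ × ℝ) × (Space d × Space d) => w q.1.2 q.2.2) S :=
      hwc.comp (f := fun q : (ℝ × ℝ) × (Space d × Space d) => (q.1.2, q.2.2)) (by fun_prop)
        (fun q hq => ⟨hsub hq.1.2, mem_univ _⟩)
    refine ContinuousOn.sub (ContinuousOn.sub ((h1.sub h2).sub ?_) ?_) ?_
    all_goals fun_prop
  have hz₀ : ((t₀, t₀), (x₀, x₀)) ∈ S :=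
    ⟨⟨⟨hat.le, ht₀.2.le⟩, ⟨hat.le, ht₀.2.le⟩⟩, by simpa using hRdx, by simp; linarith⟩
  obtain ⟨⟨⟨t, s⟩, ⟨x, y⟩⟩, hmem, hmax⟩ := hSc.exists_isMaxOn ⟨_, hz₀⟩ hΦc
  obtain ⟨⟨htI, hsI⟩, hx, hy⟩ := hmem
  simp only [Metric.mem_closedBall, dist_zero_right] at hx hy htI hsI
  have hval : σ / 2 < Φ ((t, s), (x, y)) := by
    refine lt_of_lt_of_le ?_ (hmax hz₀)
    simp only [hΦ, sub_self, norm_zero, sub_zero]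
    have h2 : (0 : ℝ) ^ 2 / ε = 0 := by simp
    have h3 : ‖x₀‖ ^ 2 / (1 / δ) = δ * ‖x₀‖ ^ 2 := by rw [div_div_eq_mul_div]; ring
    have h4 : e t₀ < σ / 4 := hlσ
    rw [h2, h3]; linarith
  simp only [hΦ, sub_zero] at hval
  have hdd : ‖x‖ ^ 2 / (1 / δ) = δ * ‖x‖ ^ 2 := by rw [div_div_eq_mul_div]; ring
  rw [hdd] at hval
  have huw := hM t (hsub htI) s (hsub hsI) x y
  have het : 0 < e t := by positivity
  have hp1 : 0 ≤ ‖x - y‖ ^ 2 / ε := by positivity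
  have hp2 : 0 ≤ (t - s) ^ 2 / ε := by positivity
  have hp3 : 0 ≤ δ * ‖x‖ ^ 2 := by positivity
  have hxy : ‖x - y‖ < ν := by
    have h1 : ‖x - y‖ ^ 2 / ε ≤ 2 * M := by linarith
    rw [div_le_iff₀ hε0] at h1
    exact lt_of_pow_lt_pow_left₀ 2 hν.le (by linarith)
  have hts : |t - s| < ν := by
    have h1 : (t - s) ^ 2 / ε ≤ 2 * M := by linarith
    rw [div_le_iff₀ hε0, ← sq_abs] at h1
    exact lt_of_pow_lt_pow_left₀ 2 hν.le (by linarith)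
  have hδx : δ * ‖x‖ ^ 2 ≤ 2 * M := by linarith
  have hxR : ‖x‖ < Rd := by
    have : δ * ‖x‖ ^ 2 < δ * Rd ^ 2 := by linarith
    exact lt_of_pow_lt_pow_left₀ 2 (by linarith) (lt_of_mul_lt_mul_left this hδ0.le)
  have hyR : ‖y‖ < Rd + 1 := by
    have : ‖y‖ ≤ ‖x‖ + ‖x - y‖ := by
      have := norm_sub_le x (x - y); simpa using this
    linarith
  have htsl := abs_lt.1 hts
  -- If one time is `T`, the other is within `ν` of it; the terminal order and the Lipschitz bounds
  -- then give `u - w ≤ (C + K) ν < σ / 2`, below the maximum.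
  have htT : t ≠ T ∧ s ≠ T := by
    have key : t = T ∨ s = T → False := by
      intro hor
      have h1 := hut t (hsub htI) x
      have h2 := hwt s (hsub hsI) y
      have h3 := hwl T ⟨(ha0.trans haT).le, le_rfl⟩ x y
      have h4 := hT x
      have h5 : (T - t) + (T - s) ≤ ν := by
        rcases hor with rfl | rfl <;> linarith
      have h6 : C * (T - t) + C * (T - s) ≤ C * ν := by rw [← mul_add]; gcongr
      have h7 : K * ‖x - y‖ ≤ K * ν := by gcongr
      linarith
    exact ⟨fun h => key (Or.inl h), fun h => key (Or.inr h)⟩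
  have hta : t - a < ν → False := by
    intro hlt
    have h1 : B * (1 - l * ν) ≤ e t := by
      simp only [he]
      gcongr
      have h2 := Real.add_one_le_exp (-(l * (t - a)))
      have h3 : l * (t - a) ≤ l * ν := by gcongr
      linarith
    have h4 : B * (1 - l * ν) = 2 * M + 1 - l * ν * B := by rw [hB]; ring
    linarith
  have hta' : t ≠ a := by
    rintro rfl
    exact hta (by simpa using hν)
  have hsa' : s ≠ a := by
    rintro rfl
    exact hta htsl.2
  have htI' : t ∈ Ioo a T := ⟨lt_of_le_of_ne htI.1 hta'.symm, lt_of_le_of_ne htI.2 htT.1⟩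
  have hsI' : s ∈ Ioo a T := ⟨lt_of_le_of_ne hsI.1 hsa'.symm, lt_of_le_of_ne hsI.2 htT.2⟩
  set p : Space d := (2 / ε) • (x - y) with hp
  -- Moving `y` onto `x` cannot increase `Φ`, so the Lipschitz bound of `w` controls the penalty
  -- gradient independently of `ε`.
  have hpK : ‖p‖ ≤ 2 * K := by
    have h1 : Φ ((t, s), (x, x)) ≤ Φ ((t, s), (x, y)) :=
      hmax (show ((t, s), (x, x)) ∈ S from ⟨⟨htI, hsI⟩, by simpa using hx, by simp; linarith⟩)
    simp only [hΦ, sub_self, norm_zero] at h1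
    have h2 : (0 : ℝ) ^ 2 / ε = 0 := by simp
    have h3 := hwl s (hsub hsI) x y
    have h4 : ‖x - y‖ ^ 2 / ε ≤ K * ‖x - y‖ := by linarith
    rw [hp, norm_smul, Real.norm_of_nonneg (by positivity)]
    rw [div_le_iff₀ hε0] at h4
    rw [div_mul_eq_mul_div, div_le_iff₀ hε0]
    by_contra hcon
    push Not at hcon
    have : 0 < ‖x - y‖ := by
      have : 0 ≤ 2 * K * ε := by positivity
      linarith
    nlinarith
  set q : Space d := (2 / (1 / δ)) • (x - 0) with hq
  have hqρ : ‖q‖ ≤ ρ := by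
    rw [hq, norm_smul, Real.norm_of_nonneg (by positivity), sub_zero]
    refine le_of_sq_le_sq ?_ hρ0.le
    calc (2 / (1 / δ) * ‖x‖) ^ 2 = 4 * δ * (δ * ‖x‖ ^ 2) := by field_simp; ring
      _ ≤ 4 * δ * (2 * M) := by gcongr
      _ = 8 * M * δ := by ring
      _ ≤ ρ ^ 2 := hδ2
  have hsubineq : -(2 / ε * (t - s) - l * e t) + F t x (p + q) ≤ 0 := by
    set φ : ℝ × Space d → ℝ := fun z =>
      ‖z.2 - y‖ ^ 2 / ε + (z.1 - s) ^ 2 / ε + ‖z.2 - 0‖ ^ 2 / (1 / δ) + e z.1 with hφ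
    have hφd : ContDiff ℝ 1 φ := by
      have h1 : ∀ c : Space d, ContDiff ℝ 1 fun q : ℝ × Space d => ‖q.2 - c‖ ^ 2 := fun c =>
        (contDiff_snd.sub contDiff_const).norm_sq ℝ
      have h2 := h1 y
      have h3 := h1 0
      simp only [hφ, he]
      fun_prop
    have hlm : IsLocalMax (fun z : ℝ × Space d => u z.1 z.2 - φ z) (t, x) := by
      have hnb : Ioo a T ×ˢ Metric.ball (0 : Space d) Rd ∈ 𝓝 (t, x) :=
        (isOpen_Ioo.prod Metric.isOpen_ball).mem_nhds ⟨htI', by simpa using hxR⟩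
      filter_upwards [hnb] with z hz
      have h1 : Φ ((z.1, s), (z.2, y)) ≤ Φ ((t, s), (x, y)) :=
        hmax (show ((z.1, s), (z.2, y)) ∈ S from ⟨⟨Ioo_subset_Icc_self hz.1, hsI⟩,
          Metric.ball_subset_closedBall hz.2, by simpa using hy⟩)
      simp only [hΦ] at h1
      simp only [hφ]
      linarith
    have h := hu.sub φ hφd t ⟨ha0.trans htI'.1, htI'.2⟩ x hlm
    have hder : HasDerivAt (fun σ => φ (σ, x)) (2 / ε * (t - s) - l * e t) t := by
      have h1 : HasDerivAt (fun σ : ℝ => (σ - s) ^ 2 / ε) (2 / ε * (t - s)) t := by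
        refine ((((hasDerivAt_id t).sub_const s).pow 2).div_const ε).congr_deriv ?_
        simp; ring
      have h2 : HasDerivAt e (-(l * e t)) t := by
        have h3 : HasDerivAt (fun σ : ℝ => -(l * (σ - a))) (-l) t := by
          have h4 : HasDerivAt (fun σ : ℝ => l * (σ - a)) l t := by
            simpa using ((hasDerivAt_id t).sub_const a).const_mul l
          exact h4.fun_neg
        refine (h3.exp.const_mul B).congr_deriv ?_
        simp only [he]; ring
      exact (((h1.const_add (‖x - y‖ ^ 2 / ε)).add_const (‖x - 0‖ ^ 2 / (1 / δ))).add h2)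
    have hgr : HasGradientAt (fun z => φ (t, z)) (p + q) x := by
      have h1 := hasGradientAt_norm_sub_sq_div y x ε
      have h2 := hasGradientAt_norm_sub_sq_div 0 x (1 / δ)
      rw [hasGradientAt_iff_hasFDerivAt] at h1 h2 ⊢
      rw [map_add]
      exact ((h1.add_const ((t - s) ^ 2 / ε)).add h2).add_const (e t)
    rwa [hder.deriv, hgr.gradient] at h
  have hsupineq : 0 ≤ -(2 / ε * (t - s)) + F s y p := by
    set φ : ℝ × Space d → ℝ := fun z => -(‖z.2 - x‖ ^ 2 / ε + (z.1 - t) ^ 2 / ε) with hφ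
    have hφd : ContDiff ℝ 1 φ := by
      have h1 : ContDiff ℝ 1 fun q : ℝ × Space d => ‖q.2 - x‖ ^ 2 :=
        (contDiff_snd.sub contDiff_const).norm_sq ℝ
      simp only [hφ]
      fun_prop
    have hlm : IsLocalMin (fun z : ℝ × Space d => w z.1 z.2 - φ z) (s, y) := by
      have hnb : Ioo a T ×ˢ Metric.ball (0 : Space d) (Rd + 1) ∈ 𝓝 (s, y) :=
        (isOpen_Ioo.prod Metric.isOpen_ball).mem_nhds ⟨hsI', by simpa using hyR⟩
      filter_upwards [hnb] with z hz
      have h1 : Φ ((t, z.1), (x, z.2)) ≤ Φ ((t, s), (x, y)) :=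
        hmax (show ((t, z.1), (x, z.2)) ∈ S from ⟨⟨htI, Ioo_subset_Icc_self hz.1⟩,
          by simpa using hx, Metric.ball_subset_closedBall hz.2⟩)
      simp only [hΦ] at h1
      simp only [hφ]
      rw [norm_sub_rev z.2 x, norm_sub_rev y x, sub_sq_comm z.1 t, sub_sq_comm s t]
      linarith
    have h := hw.super φ hφd s ⟨ha0.trans hsI'.1, hsI'.2⟩ y hlm
    have hder : HasDerivAt (fun σ => φ (σ, y)) (2 / ε * (t - s)) s := by
      have h1 : HasDerivAt (fun σ : ℝ => (σ - t) ^ 2 / ε) (2 / ε * (s - t)) s := by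
        refine ((((hasDerivAt_id s).sub_const t).pow 2).div_const ε).congr_deriv ?_
        simp; ring
      refine ((h1.const_add (‖y - x‖ ^ 2 / ε)).fun_neg).congr_deriv ?_
      ring
    have hgr : HasGradientAt (fun z => φ (s, z)) p y := by
      have h1 := hasGradientAt_norm_sub_sq_div x y ε
      rw [hasGradientAt_iff_hasFDerivAt] at h1 ⊢
      have h2 := (h1.add_const ((s - t) ^ 2 / ε)).fun_neg
      rw [← map_neg, ← smul_neg, neg_sub] at h2
      exact h2
    rwa [hder.deriv, hgr.gradient] at h
  have h1 := hFL t x p (p + q) (by linarith) ((norm_add_le _ _).trans (by linarith))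
  have h2 : ‖p - (p + q)‖ ≤ ρ := by simpa using hqρ
  have h3 : RL * ‖p - (p + q)‖ ≤ RL * ρ := by gcongr
  have h4 := hunif (t, x, p) ⟨htI, by simp; linarith, by simpa using hpK⟩ (s, y, p)
    ⟨hsI, by simpa using hy, by simpa using hpK⟩ (by
      rw [Prod.dist_eq, Prod.dist_eq, max_lt_iff, max_lt_iff]
      refine ⟨?_, ?_, by simpa using hη⟩
      · rw [Real.dist_eq]; exact hts.trans_le hνη
      · rw [dist_eq_norm]; exact hxy.trans_le hνη)
  rw [Real.dist_eq, abs_lt] at h4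
  simp only at h4
  have h5 : κ ≤ l * e t := by
    simp only [hκ, he]
    gcongr
    exact htI.2
  linarith [h4.1]

end Comparison

/-! ### Lower right slopes -/

/-- The lower right derivative of `g` at `t` is at least `D`. -/
def LowerSlope (g : ℝ → ℝ) (t D : ℝ) : Prop :=
  ∀ r < D, ∀ᶠ s in 𝓝[>] t, r * (s - t) ≤ g s - g t

lemma LowerSlope.add {f g : ℝ → ℝ} {t D E : ℝ} (hf : LowerSlope f t D) (hg : LowerSlope g t E) :
    LowerSlope (fun s => f s + g s) t (D + E) := by
  intro r hr
  have h1 := hf (D - (D + E - r) / 2) (by linarith)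
  have h2 := hg (E - (D + E - r) / 2) (by linarith)
  filter_upwards [h1, h2] with s h1 h2
  have : r * (s - t) = (D - (D + E - r) / 2) * (s - t) + (E - (D + E - r) / 2) * (s - t) := by ring
  linarith

lemma LowerSlope.const_mul {g : ℝ → ℝ} {t D c : ℝ} (hg : LowerSlope g t D) (hc : 0 < c) :
    LowerSlope (fun s => c * g s) t (c * D) := by
  intro r hr
  filter_upwards [hg (r / c) (by rw [div_lt_iff₀ hc]; linarith)] with s hs
  have : c * (r / c * (s - t)) = r * (s - t) := by field_simp
  rw [← mul_sub, ← this]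
  gcongr

lemma LowerSlope.mono {g : ℝ → ℝ} {t D E : ℝ} (hg : LowerSlope g t D) (h : E ≤ D) :
    LowerSlope g t E := fun r hr => hg r (hr.trans_le h)

/-- Mean value inequality for one-sided lower slopes. Slopes are required only in the open interval,
where the equation holds; continuity supplies the left end point. -/
lemma LowerSlope.le_sub {g : ℝ → ℝ} {a b m : ℝ} (hab : a ≤ b) (hg : ContinuousOn g (Icc a b))
    (h : ∀ t ∈ Ioo a b, LowerSlope g t m) : m * (b - a) ≤ g b - g a := by
  rcases hab.eq_or_lt with rfl | hab
  · simp
  have key : ∀ a' ∈ Ioo a b, m * (b - a') ≤ g b - g a' := by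
    intro a' ha'
    have h1 := image_le_of_liminf_slope_right_le_deriv_boundary (f := fun s => -g s) (a := a')
      (b := b) (B := fun s => -g a' - m * (s - a')) (B' := fun _ => -m)
      (hg.mono (Icc_subset_Icc_left ha'.1.le)).neg (by simp) (by fun_prop)
      (fun x _ => by
        have h2 : HasDerivAt (fun s : ℝ => m * (s - a')) m x := by
          simpa using ((hasDerivAt_id x).sub_const a').const_mul m
        exact (h2.const_sub (-g a')).hasDerivWithinAt)
      (fun x hx r hr => by
        have h2 := h x ⟨ha'.1.trans_le hx.1, hx.2⟩ ((m - r) / 2) (by linarith)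
        refine Eventually.frequently ?_
        filter_upwards [h2, self_mem_nhdsWithin] with s hs hxs
        have hxs : 0 < s - x := sub_pos.2 hxs
        rw [slope_def_field, div_lt_iff₀ hxs]
        nlinarith)
      (right_mem_Icc.2 ha'.2.le)
    linarith
  have hc : ContinuousWithinAt (fun s => g b - g s - m * (b - s)) (Ioo a b) a := by
    have h1 : ContinuousWithinAt g (Ioo a b) a :=
      (hg a (left_mem_Icc.2 hab.le)).mono Ioo_subset_Icc_self
    exact (continuousWithinAt_const.sub h1).sub (by fun_prop)
  have : (𝓝[Ioo a b] a).NeBot := by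
    rw [nhdsWithin_Ioo_eq_nhdsGT hab]; infer_instance
  have h2 : 0 ≤ g b - g a - m * (b - a) := by
    refine ge_of_tendsto hc.tendsto ?_
    filter_upwards [self_mem_nhdsWithin] with s hs
    linarith [key s hs]
  linarith

lemma LowerSlope.nonpos_of_eq {g : ℝ → ℝ} {t b D : ℝ} (hb : t < b) (hg : LowerSlope g t D)
    (h : ∀ s ∈ Ioo t b, g s = g t) : D ≤ 0 := by
  by_contra hD
  push Not at hD
  obtain ⟨s, h1, h2⟩ := ((hg (D / 2) (by linarith)).and (Ioo_mem_nhdsGT hb)).exists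
  rw [h s h2, sub_self] at h1
  have : 0 < s - t := sub_pos.2 h2.1
  nlinarith

/-! ### Expectations along curves in `L^q` -/

lemma coeFn_add_smul {d : ℕ} {q : ℝ≥0∞} {Ω : Type*} [MeasurableSpace Ω] {P : Measure Ω} (X Z : RV d q P) (c : ℝ) :
    (fun ω => (X + c • Z) ω) =ᵐ[P] fun ω => X ω + c • Z ω := by
  filter_upwards [Lp.coeFn_add X (c • Z), Lp.coeFn_smul c Z] with ω h1 h2
  rw [h1, Pi.add_apply, h2, Pi.smul_apply]

section Expectation

variable {d : ℕ} {q : ℝ≥0∞} {Ω : Type*} [MeasurableSpace Ω] {P : Measure Ω} [Fact (1 ≤ q)]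
  [IsProbabilityMeasure P]

lemma integrable_rv (X : RV d q P) : Integrable (fun ω => X ω) P :=
  (Lp.memLp X).integrable Fact.out

lemma integral_norm_le_norm (X : RV d q P) : ∫ ω, ‖X ω‖ ∂P ≤ ‖X‖ := by
  rw [integral_norm_eq_lintegral_enorm (Lp.aestronglyMeasurable X), Lp.norm_def,
    ← eLpNorm_one_eq_lintegral_enorm]
  exact ENNReal.toReal_mono (Lp.memLp X).eLpNorm_ne_top
    (eLpNorm_le_eLpNorm_of_exponent_le Fact.out (Lp.aestronglyMeasurable X))

lemma continuous_of_lip {f : Space d → ℝ} {K : ℝ} (hf : ∀ x y, |f x - f y| ≤ K * ‖x - y‖) :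
    Continuous f := by
  have : LipschitzWith K.toNNReal f := by
    refine LipschitzWith.of_dist_le_mul fun x y => ?_
    rw [Real.dist_eq, dist_eq_norm]
    refine (hf x y).trans ?_
    gcongr
    exact Real.le_coe_toNNReal K
  exact this.continuous

lemma integrable_comp_lip {f : Space d → ℝ} {K : ℝ} (hf : ∀ x y, |f x - f y| ≤ K * ‖x - y‖)
    (X : RV d q P) : Integrable (fun ω => f (X ω)) P := by
  have h1 := ((integrable_rv X).norm.const_mul K).add (integrable_const (μ := P) |f 0|)
  refine h1.mono' ((continuous_of_lip hf).comp_aestronglyMeasurable (Lp.aestronglyMeasurable X))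
    (Eventually.of_forall fun ω => ?_)
  have h2 := hf (X ω) 0
  rw [sub_zero] at h2
  calc ‖f (X ω)‖ = |(f (X ω) - f 0) + f 0| := by rw [sub_add_cancel, Real.norm_eq_abs]
    _ ≤ |f (X ω) - f 0| + |f 0| := abs_add_le _ _
    _ ≤ K * ‖X ω‖ + |f 0| := by linarith

lemma abs_integral_comp_sub_le {f : Space d → ℝ} {K : ℝ} (hK : 0 ≤ K)
    (hf : ∀ x y, |f x - f y| ≤ K * ‖x - y‖) (X Y : RV d q P) :
    |∫ ω, f (X ω) ∂P - ∫ ω, f (Y ω) ∂P| ≤ K * ‖X - Y‖ := by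
  rw [← integral_sub (integrable_comp_lip hf X) (integrable_comp_lip hf Y)]
  calc |∫ ω, (f (X ω) - f (Y ω)) ∂P| ≤ ∫ ω, |f (X ω) - f (Y ω)| ∂P := abs_integral_le_integral_abs
    _ ≤ ∫ ω, K * ‖(X - Y) ω‖ ∂P := by
      refine integral_mono_ae ((integrable_comp_lip hf X).sub (integrable_comp_lip hf Y)).abs
        ((integrable_rv (X - Y)).norm.const_mul K) ?_
      filter_upwards [Lp.coeFn_sub X Y] with ω hω
      rw [hω]
      exact hf _ _
    _ = K * ∫ ω, ‖(X - Y) ω‖ ∂P := integral_const_mul _ _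
    _ ≤ K * ‖X - Y‖ := by gcongr; exact integral_norm_le_norm _

/-- Split the increment into a change of random variable, controlled by the `L^q` norm, and a change
of time, controlled uniformly in the state. -/
lemma continuousOn_integral_comp {w : ℝ → Space d → ℝ} {Y : ℝ → RV d q P} {I : Set ℝ} {K C : ℝ}
    (hK : 0 ≤ K) (hx : ∀ s ∈ I, ∀ x y, |w s x - w s y| ≤ K * ‖x - y‖)
    (ht : ∀ s ∈ I, ∀ t ∈ I, ∀ x, |w s x - w t x| ≤ C * |s - t|) (hY : ContinuousOn Y I) :
    ContinuousOn (fun s => ∫ ω, w s (Y s ω) ∂P) I := by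
  intro t htI
  rw [ContinuousWithinAt, tendsto_iff_dist_tendsto_zero]
  have h1 : Tendsto (fun s => C * |s - t| + K * ‖Y s - Y t‖) (𝓝[I] t) (𝓝 0) := by
    have h2 : Tendsto (fun s : ℝ => C * |s - t|) (𝓝[I] t) (𝓝 0) := by
      have : Continuous fun s : ℝ => C * |s - t| := by fun_prop
      simpa using (this.tendsto t).mono_left nhdsWithin_le_nhds
    have h3 : Tendsto (fun s => K * ‖Y s - Y t‖) (𝓝[I] t) (𝓝 0) := by
      have := (((hY t htI).tendsto.sub_const (Y t)).norm).const_mul K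
      simpa using this
    simpa using h2.add h3
  refine squeeze_zero' (Eventually.of_forall fun s => dist_nonneg) ?_ h1
  filter_upwards [self_mem_nhdsWithin] with s hs
  rw [Real.dist_eq]
  have h4 : |∫ ω, w s (Y t ω) ∂P - ∫ ω, w t (Y t ω) ∂P| ≤ C * |s - t| := by
    rw [← integral_sub (integrable_comp_lip (hx s hs) _) (integrable_comp_lip (hx t htI) _)]
    calc |∫ ω, (w s (Y t ω) - w t (Y t ω)) ∂P| ≤ ∫ ω, |w s (Y t ω) - w t (Y t ω)| ∂P :=
          abs_integral_le_integral_abs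
      _ ≤ ∫ _, C * |s - t| ∂P := integral_mono
          ((integrable_comp_lip (hx s hs) _).sub (integrable_comp_lip (hx t htI) _)).abs
          (integrable_const _) (fun ω => ht s hs t htI _)
      _ = C * |s - t| := by simp
  have h5 := abs_integral_comp_sub_le hK (hx s hs) (Y s) (Y t)
  calc _ ≤ |∫ ω, w s (Y s ω) ∂P - ∫ ω, w s (Y t ω) ∂P|
        + |∫ ω, w s (Y t ω) ∂P - ∫ ω, w t (Y t ω) ∂P| := abs_sub_le _ _ _
    _ ≤ _ := by linarith

/-- The lower right derivative of an expectation along a differentiable curve in `L^q`. -/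
lemma lowerSlope_integral_comp {w : ℝ → Space d → ℝ} {Y : ℝ → RV d q P} {Z : RV d q P}
    {t b K C CA : ℝ} {A : Ω → ℝ} (hK : 0 ≤ K) (hb : t < b) (hY : HasDerivAt Y Z t)
    (hlip : ∀ s ∈ Ico t b, ∀ x y, |w s x - w s y| ≤ K * ‖x - y‖)
    (hlow : ∀ᵐ ω ∂P, ∀ s ∈ Ioo t b, -C * (s - t) ≤ w s (Y t ω + (s - t) • Z ω) - w t (Y t ω))
    (hAm : AEStronglyMeasurable A P) (hA : ∀ᵐ ω ∂P, |A ω| ≤ CA)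
    (hlim : ∀ᵐ ω ∂P, ∀ c < A ω, ∀ᶠ s in 𝓝[>] t,
      c * (s - t) ≤ w s (Y t ω + (s - t) • Z ω) - w t (Y t ω)) :
    LowerSlope (fun s => ∫ ω, w s (Y s ω) ∂P) t (∫ ω, A ω ∂P) := by
  have hnb : ∀ᶠ s in 𝓝[>] t, s ∈ Ioo t b := Ioo_mem_nhdsGT hb
  have hint : ∀ s ∈ Ioo t b,
      Integrable (fun ω => w s (Y t ω + (s - t) • Z ω) - w t (Y t ω)) P := by
    intro s hs
    refine Integrable.sub ?_ (integrable_comp_lip (hlip t ⟨le_rfl, hb⟩) _)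
    refine (integrable_comp_lip (hlip s (Ioo_subset_Ico_self hs)) (Y t + (s - t) • Z)).congr ?_
    filter_upwards [coeFn_add_smul (Y t) Z (s - t)] with ω hω
    rw [hω]
  set Q : ℝ → Ω → ℝ := fun s ω => (w s (Y t ω + (s - t) • Z ω) - w t (Y t ω)) / (s - t) with hQ
  have hQi : ∀ s ∈ Ioo t b, Integrable (Q s) P := fun s hs => (hint s hs).div_const _
  have hAi : Integrable A P := (integrable_const CA).mono' hAm hA
  -- The quotients `Q` are bounded only below and only their lower limit is known. Truncating them
  -- above by `A` yields a bounded family converging to `A`, to which dominated convergence applies.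
  have hmin : Tendsto (fun s => ∫ ω, min (Q s ω) (A ω) ∂P) (𝓝[>] t) (𝓝 (∫ ω, A ω ∂P)) := by
    refine tendsto_integral_filter_of_dominated_convergence (fun _ => |C| + CA) ?_ ?_
      (integrable_const _) ?_
    · filter_upwards [hnb] with s hs
      exact (hQi s hs).aestronglyMeasurable.inf hAm
    · filter_upwards [hnb] with s hs
      filter_upwards [hlow, hA] with ω h1 h2
      have h3 : 0 < s - t := sub_pos.2 hs.1
      have h4 : -C ≤ Q s ω := by rw [hQ, le_div_iff₀ h3]; exact h1 s hs
      have h5 := abs_le.1 h2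
      rw [Real.norm_eq_abs, abs_le]
      constructor
      · refine le_min ?_ ?_
        · linarith [le_abs_self C, h5.1.trans h5.2]
        · linarith [abs_nonneg C]
      · exact (min_le_right _ _).trans (by linarith [abs_nonneg C])
    · filter_upwards [hlim] with ω h1
      rw [tendsto_order]
      constructor
      · intro c hc
        obtain ⟨c', hc', hc''⟩ := exists_between hc
        filter_upwards [h1 c' hc'', self_mem_nhdsWithin] with s hs hts
        have h3 : 0 < s - t := sub_pos.2 hts
        refine lt_min (hc'.trans_le ?_) hc
        rw [hQ, le_div_iff₀ h3]; exact hs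
      · intro c hc
        exact Eventually.of_forall fun s => (min_le_right _ _).trans_lt hc
  intro r hr
  obtain ⟨r', hr', hr''⟩ := exists_between hr
  have hlo := (Asymptotics.isLittleO_iff.1 hY.isLittleO)
    (show 0 < (r' - r) / (K + 1) by have := sub_pos.2 hr'; positivity)
  filter_upwards [hnb, hmin.eventually_const_lt hr'', hlo.filter_mono nhdsWithin_le_nhds]
    with s hs h1 h2
  have h3 : 0 < s - t := sub_pos.2 hs.1
  have h4 : ∫ ω, min (Q s ω) (A ω) ∂P ≤ ∫ ω, Q s ω ∂P :=
    integral_mono ((hQi s hs).inf hAi) (hQi s hs) (fun ω => min_le_left _ _)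
  have h5 : r' * (s - t) ≤ ∫ ω, (w s (Y t ω + (s - t) • Z ω) - w t (Y t ω)) ∂P := by
    have : ∫ ω, Q s ω ∂P = (∫ ω, (w s (Y t ω + (s - t) • Z ω) - w t (Y t ω)) ∂P) / (s - t) :=
      integral_div _ _
    rw [this] at h4
    have := h1.le.trans h4
    rwa [le_div_iff₀ h3] at this
  -- Replacing `Y s` by its tangent at `t` costs `K` times an `L^q` norm that is `o(s - t)`, so no
  -- pathwise differentiability is needed.
  have h6 := abs_integral_comp_sub_le hK (hlip s (Ioo_subset_Ico_self hs)) (Y s)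
    (Y t + (s - t) • Z)
  have h7 : ∫ ω, w s ((Y t + (s - t) • Z) ω) ∂P = ∫ ω, w s (Y t ω + (s - t) • Z ω) ∂P := by
    refine integral_congr_ae ?_
    filter_upwards [coeFn_add_smul (Y t) Z (s - t)] with ω hω
    rw [hω]
  have h8 : Integrable (fun ω => w s (Y t ω + (s - t) • Z ω)) P := by
    have := (hint s hs).add (integrable_comp_lip (hlip t ⟨le_rfl, hb⟩) (Y t))
    refine this.congr (Eventually.of_forall fun ω => ?_)
    simp
  rw [integral_sub h8 (integrable_comp_lip (hlip t ⟨le_rfl, hb⟩) _), ← h7] at h5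
  rw [Real.norm_of_nonneg h3.le] at h2
  have h9 : K * ‖Y s - Y t - (s - t) • Z‖ ≤ (r' - r) * (s - t) := by
    calc K * ‖Y s - Y t - (s - t) • Z‖ ≤ (K + 1) * ((r' - r) / (K + 1) * (s - t)) := by
          gcongr
          linarith
      _ = (r' - r) * (s - t) := by field_simp
  rw [← sub_sub] at h6
  have h10 := (abs_le.1 h6).1
  have h11 : r' * (s - t) = r * (s - t) + (r' - r) * (s - t) := by ring
  linarith

end Expectation

/-! ### Solutions of the Hamilton-Jacobi equation along random curves -/

/-- A Lipschitz viscosity solution of the Hamilton-Jacobi equation of `ℓ`. -/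
structure LipschitzSolution {d : ℕ} (T : ℝ) (ℓ : ℝ → Space d → Space d → ℝ)
    (u : ℝ → Space d → ℝ) : Prop where
  visc : IsViscositySolution T (fun t x p => conj (ℓ t x) p) u
  cont : ContinuousOn (fun a : ℝ × Space d => u a.1 a.2) (Icc 0 T ×ˢ univ)
  lip : ∃ K : ℝ, 0 ≤ K ∧ ∀ t ∈ Icc 0 T, ∀ x y, |u t x - u t y| ≤ K * ‖x - y‖

namespace LipschitzSolution

variable {d : ℕ} {T : ℝ} {ℓ : ℝ → Space d → Space d → ℝ} {u : ℝ → Space d → ℝ}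

/-- The upper bound comes from the supersolution property, the lower one from the subsolution
property along lines of zero velocity. -/
lemma time_lip (hu : LipschitzSolution T ℓ u) (hℓ : TameLagrangian ℓ) :
    ∃ C : ℝ, 0 ≤ C ∧ ∀ s ∈ Icc 0 T, ∀ t ∈ Icc 0 T, ∀ x, |u s x - u t x| ≤ C * |s - t| := by
  obtain ⟨K, hK, hlip⟩ := hu.lip
  have hlip' : ∀ t ∈ Icc 0 T, ∀ x y, u t x - u t y ≤ K * ‖x - y‖ :=
    fun t ht x y => (le_abs_self _).trans (hlip t ht x y)
  obtain ⟨C₁, h₁⟩ := hu.visc.time_upper hℓ hu.cont hK hlip'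
  obtain ⟨C₂, h₂⟩ := hu.visc.line_lower hℓ hu.cont hK hlip' 0
  have key : ∀ s t, 0 ≤ s → s ≤ t → t ≤ T → ∀ x,
      |u t x - u s x| ≤ max 0 (max C₁ C₂) * |t - s| := by
    intro s t hs hst ht x
    have h3 := h₁ s t hs hst ht x
    have h4 := h₂ s t hs hst ht x 0 (by simp)
    rw [smul_zero, add_zero] at h4
    have h5 : 0 ≤ t - s := sub_nonneg.2 hst
    rw [abs_of_nonneg h5, abs_le]
    have h6 : C₁ * (t - s) ≤ max 0 (max C₁ C₂) * (t - s) := by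
      gcongr; exact (le_max_left _ _).trans (le_max_right _ _)
    have h7 : C₂ * (t - s) ≤ max 0 (max C₁ C₂) * (t - s) := by
      gcongr; exact (le_max_right _ _).trans (le_max_right _ _)
    constructor <;> linarith
  refine ⟨max 0 (max C₁ C₂), le_max_left _ _, fun s hs t ht x => ?_⟩
  rcases le_total s t with hst | hst
  · rw [abs_sub_comm, abs_sub_comm s]; exact key s t hs.1 hst ht.2 x
  · exact key t s ht.1 hst hs.2 x

lemma norm_gradient_le (hu : LipschitzSolution T ℓ u) :
    ∃ K : ℝ, 0 ≤ K ∧ ∀ t ∈ Icc 0 T, ∀ x, ‖gradient (u t) x‖ ≤ K := by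
  obtain ⟨K, hK, hlip⟩ := hu.lip
  refine ⟨K, hK, fun t ht x => ?_⟩
  have : LipschitzWith K.toNNReal (u t) := LipschitzWith.of_dist_le_mul fun x y => by
    rw [Real.dist_eq, dist_eq_norm, Real.coe_toNNReal K hK]; exact hlip t ht x y
  have h := norm_fderiv_le_of_lipschitz ℝ this (x₀ := x)
  rw [Real.coe_toNNReal K hK] at h
  rwa [gradient, LinearIsometryEquiv.norm_map]

/-- Two solutions with the same bounded terminal value coincide. -/
lemma eqOn (hℓ : TameLagrangian ℓ) {w : ℝ → Space d → ℝ} (hu : LipschitzSolution T ℓ u)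
    (hw : LipschitzSolution T ℓ w) (hT : ∀ x, u T x = w T x) (hb : ∃ M, ∀ x, |u T x| ≤ M) :
    ∀ t ∈ Icc 0 T, ∀ x, u t x = w t x := by
  obtain ⟨M, hM⟩ := hb
  have hM0 : 0 ≤ M := (abs_nonneg _).trans (hM 0)
  have key : ∀ u w : ℝ → Space d → ℝ, LipschitzSolution T ℓ u → LipschitzSolution T ℓ w →
      (∀ x, u T x = w T x) → (∀ x, |u T x| ≤ M) → ∀ t ∈ Ioo 0 T, ∀ x, u t x ≤ w t x := by
    intro u w hu hw hT hM t ht x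
    have hT0 : 0 ≤ T := (ht.1.trans ht.2).le
    have hTm : T ∈ Icc 0 T := ⟨hT0, le_rfl⟩
    obtain ⟨C₁, hC₁, h₁⟩ := hu.time_lip hℓ
    obtain ⟨C₂, hC₂, h₂⟩ := hw.time_lip hℓ
    obtain ⟨K, hK, hlip⟩ := hw.lip
    refine IsViscositySolution.comparison hℓ.conj_continuous hℓ.conj_lipschitz hu.visc hw.visc
      hu.cont hw.cont hK (C := C₁ + C₂) (M := M + (C₁ + C₂) * T) (by positivity)
      (fun t ht x y => (le_abs_self _).trans (hlip t ht x y)) ?_ ?_ ?_ (fun x => (hT x).le) ht x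
    · intro t ht x
      have h3 := (abs_le.1 (h₁ t ht T hTm x)).2
      rw [abs_sub_comm, abs_of_nonneg (sub_nonneg.2 ht.2)] at h3
      have h4 : 0 ≤ C₂ * (T - t) := mul_nonneg hC₂ (sub_nonneg.2 ht.2)
      linarith
    · intro t ht x
      have h3 := (abs_le.1 (h₂ T hTm t ht x)).2
      rw [abs_of_nonneg (sub_nonneg.2 ht.2)] at h3
      have h4 : 0 ≤ C₁ * (T - t) := mul_nonneg hC₁ (sub_nonneg.2 ht.2)
      linarith
    · intro t ht s hs x y
      have h3 := (abs_le.1 (h₁ t ht T hTm x)).2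
      have h4 := (abs_le.1 (h₂ T hTm s hs y)).2
      rw [abs_sub_comm, abs_of_nonneg (sub_nonneg.2 ht.2)] at h3
      rw [abs_of_nonneg (sub_nonneg.2 hs.2)] at h4
      have h5 := (abs_le.1 (hM x)).2
      have h6 := (abs_le.1 (hM y)).1
      rw [hT y] at h6
      have h7 : C₁ * (T - t) ≤ C₁ * T := by gcongr; linarith [ht.1]
      have h8 : C₂ * (T - s) ≤ C₂ * T := by gcongr; linarith [hs.1]
      have h9 : 0 ≤ C₁ * T := by positivity
      have h10 : 0 ≤ C₂ * T := by positivity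
      linarith
  have hIoo : ∀ t ∈ Ioo 0 T, ∀ x, u t x = w t x := fun t ht x =>
    le_antisymm (key u w hu hw hT hM t ht x)
      (key w u hw hu (fun x => (hT x).symm) (fun x => by rw [← hT]; exact hM x) t ht x)
  intro t ht x
  -- Comparison covers interior times only; time `0` is reached by continuity.
  rcases ht.1.eq_or_lt with h0 | h0
  · rcases ht.2.eq_or_lt with h1 | h1
    · rw [h1]; exact hT x
    have hsl : ∀ f : ℝ → Space d → ℝ, LipschitzSolution T ℓ f →
        Tendsto (fun s => f s x) (𝓝[>] t) (𝓝 (f t x)) := by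
      intro f hf
      have h2 : ContinuousOn (fun s => f s x) (Icc 0 T) :=
        hf.cont.comp (f := fun s => (s, x)) (by fun_prop) (fun s hs => ⟨hs, mem_univ _⟩)
      have h3 := (h2 t ht).mono (Ioo_subset_Icc_self)
      rw [← h0] at h3 ⊢
      rw [ContinuousWithinAt, nhdsWithin_Ioo_eq_nhdsGT (by linarith)] at h3
      exact h3
    refine tendsto_nhds_unique (hsl u hu) ((hsl w hw).congr' ?_)
    filter_upwards [Ioo_mem_nhdsGT h1] with s hs
    exact (hIoo s ⟨h0.trans_lt hs.1, hs.2⟩ x).symm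
  · rcases ht.2.eq_or_lt with h1 | h1
    · rw [h1]; exact hT x
    · exact hIoo t ⟨h0, h1⟩ x

end LipschitzSolution

lemma TameLagrangian.aestronglyMeasurable {d : ℕ} {Ω : Type*} [MeasurableSpace Ω]
    {P : Measure Ω} {ℓ : ℝ → Space d → Space d → ℝ} (hℓ : TameLagrangian ℓ) (t : ℝ) {Y Z : Ω → Space d}
    (hY : AEStronglyMeasurable Y P) (hZ : AEStronglyMeasurable Z P) :
    AEStronglyMeasurable (fun ω => ℓ t (Y ω) (Z ω)) P := by
  have h : Continuous fun a : Space d × Space d => ℓ t a.1 a.2 :=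
    hℓ.cont.comp (f := fun a : Space d × Space d => (t, a.1, a.2)) (by fun_prop)
  exact h.comp_aestronglyMeasurable (hY.prodMk hZ)

section Curves

variable {d : ℕ} {q : ℝ≥0∞} {Ω : Type*} [MeasurableSpace Ω] {P : Measure Ω} [Fact (1 ≤ q)]
  [IsProbabilityMeasure P] {T : ℝ} {ℓ : ℝ → Space d → Space d → ℝ} {u : ℝ → Space d → ℝ}

lemma LipschitzSolution.continuousOn_value (hu : LipschitzSolution T ℓ u) (hℓ : TameLagrangian ℓ)
    {Y : ℝ → RV d q P} (hY : ContinuousOn Y (Icc 0 T)) :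
    ContinuousOn (fun s => ∫ ω, u s (Y s ω) ∂P) (Icc 0 T) := by
  obtain ⟨K, hK, hlip⟩ := hu.lip
  obtain ⟨C, -, hC⟩ := hu.time_lip hℓ
  exact continuousOn_integral_comp hK hlip hC hY

lemma TameLagrangian.integrable (hℓ : TameLagrangian ℓ) (t : ℝ) {Y Z : Ω → Space d} {R : ℝ}
    (hY : AEStronglyMeasurable Y P) (hZ : AEStronglyMeasurable Z P) (hR : ∀ᵐ ω ∂P, ‖Z ω‖ ≤ R) :
    Integrable (fun ω => ℓ t (Y ω) (Z ω)) P := by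
  obtain ⟨C, hC⟩ := hℓ.locBdd R
  refine (integrable_const C).mono' (hℓ.aestronglyMeasurable t hY hZ) ?_
  filter_upwards [hR] with ω h
  exact hC t _ _ h

/-- The value decreases along a random curve at most as fast as the running cost. -/
lemma LipschitzSolution.lowerSlope_value (hu : LipschitzSolution T ℓ u) (hℓ : TameLagrangian ℓ)
    {Y : ℝ → RV d q P} {Z : RV d q P} {t R : ℝ} (ht : t ∈ Ioo 0 T) (hY : HasDerivAt Y Z t)
    (hR : ∀ᵐ ω ∂P, ‖Z ω‖ ≤ R) :
    LowerSlope (fun s => ∫ ω, u s (Y s ω) ∂P) t (-∫ ω, ℓ t (Y t ω) (Z ω) ∂P) := by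
  obtain ⟨K, hK, hlip⟩ := hu.lip
  have hlip' : ∀ t ∈ Icc 0 T, ∀ x y, u t x - u t y ≤ K * ‖x - y‖ :=
    fun t ht x y => (le_abs_self _).trans (hlip t ht x y)
  obtain ⟨C, hC⟩ := hu.visc.line_lower hℓ hu.cont hK hlip' R
  obtain ⟨CA, hCA⟩ := hℓ.locBdd R
  rw [← integral_neg]
  refine lowerSlope_integral_comp hK ht.2 hY (C := C) (CA := CA)
    (fun s hs => hlip s ⟨ht.1.le.trans hs.1, hs.2.le⟩) ?_
    (hℓ.aestronglyMeasurable t (Lp.aestronglyMeasurable _) (Lp.aestronglyMeasurable _)).neg ?_ ?_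
  · filter_upwards [hR] with ω h s hs
    exact hC t s ht.1.le hs.1.le hs.2.le _ _ h
  · filter_upwards [hR] with ω h
    rw [abs_neg]; exact hCA t _ _ h
  · exact Eventually.of_forall fun ω c hc => hu.visc.line_liminf hℓ hu.cont hK hlip' ht _ _ hc

/-- The value decreases along the optimal flow at least as fast as the running cost. -/
lemma LipschitzSolution.lowerSlope_neg_value (hu : LipschitzSolution T ℓ u)
    (hℓ : TameLagrangian ℓ) {X : ℝ → RV d q P} {V : RV d q P} {t R : ℝ} (ht : t ∈ Ioo 0 T)
    (hX : HasDerivAt X V t) (hR : ∀ᵐ ω ∂P, ‖V ω‖ ≤ R)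
    (hdiff : ∀ᵐ ω ∂P, DifferentiableAt ℝ (fun a : ℝ × Space d => u a.1 a.2) (t, X t ω))
    (hV : ∀ᵐ ω ∂P, V ω = -gradient (conj (ℓ t (X t ω))) (gradient (u t) (X t ω))) :
    LowerSlope (fun s => ∫ ω, -u s (X s ω) ∂P) t (∫ ω, ℓ t (X t ω) (V ω) ∂P) := by
  obtain ⟨K, hK, hlip⟩ := hu.lip
  obtain ⟨C, hC, htime⟩ := hu.time_lip hℓ
  obtain ⟨CA, hCA⟩ := hℓ.locBdd R
  have htI := Ioo_subset_Icc_self ht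
  refine lowerSlope_integral_comp (w := fun s x => -u s x) hK ht.2 hX (C := C + K * R) (CA := CA)
    (fun s hs x y => ?_) ?_
    (hℓ.aestronglyMeasurable t (Lp.aestronglyMeasurable _) (Lp.aestronglyMeasurable _)) ?_ ?_
  · rw [← neg_add', ← sub_eq_add_neg, abs_neg]
    exact hlip s ⟨ht.1.le.trans hs.1, hs.2.le⟩ x y
  · filter_upwards [hR] with ω h s hs
    have hsI : s ∈ Icc 0 T := ⟨ht.1.le.trans hs.1.le, hs.2.le⟩
    have h1 := (abs_le.1 (hlip s hsI (X t ω + (s - t) • V ω) (X t ω))).2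
    have h2 := (abs_le.1 (htime s hsI t htI (X t ω))).2
    have h3 : 0 < s - t := sub_pos.2 hs.1
    rw [add_sub_cancel_left, norm_smul, Real.norm_of_nonneg h3.le] at h1
    rw [abs_of_pos h3] at h2
    have h4 : K * ((s - t) * ‖V ω‖) ≤ K * ((s - t) * R) := by gcongr
    linarith
  · filter_upwards [hR] with ω h
    exact hCA t _ _ h
  · filter_upwards [hdiff, hV] with ω hd hv c hc
    set x := X t ω with hx
    set v := V ω with hvdef
    set p := gradient (u t) x with hp
    obtain ⟨D, hD⟩ := hd
    have hslice : HasFDerivAt (u t) (D.comp (ContinuousLinearMap.inr ℝ ℝ (Space d))) x := by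
      have h1 : HasFDerivAt (fun y : Space d => (t, y)) (ContinuousLinearMap.inr ℝ ℝ (Space d)) x :=
        hasFDerivAt_prodMk_right t x
      exact HasFDerivAt.comp (g := fun a : ℝ × Space d => u a.1 a.2) x hD h1
    have hpg : HasGradientAt (fun y => D (0, y)) p x := by
      have h1 : HasGradientAt (u t) p x := hslice.differentiableAt.hasGradientAt
      rw [hasGradientAt_iff_hasFDerivAt] at h1 ⊢
      rw [h1.unique hslice]
      exact (D.comp (ContinuousLinearMap.inr ℝ ℝ (Space d))).hasFDerivAt
    have hle := hu.visc.fderiv_le hℓ.conj_continuous hu.cont ht hD hpg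
    have hDv : D (0, v) = inner ℝ p v := by
      have h1 : HasGradientAt (u t) p x := hslice.differentiableAt.hasGradientAt
      rw [hasGradientAt_iff_hasFDerivAt] at h1
      have h2 := congrArg (fun A : Space d →L[ℝ] ℝ => A v) (h1.unique hslice)
      simpa using h2.symm
    have hmax : IsArgmax (ℓ t x) p v := by rw [hv]; exact hℓ.isArgmax_gradient t x p
    have hconj := hmax.conj_eq
    have hD1 : D (1, v) = D (1, 0) + D (0, v) := by rw [← map_add]; simp
    -- The supersolution inequality gives `D (1, 0) ≤ H(p) = -v·p - ℓ` for the optimal `v`, and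
    -- adding `D (0, v) = p·v` leaves `-ℓ`.
    have hub : D (1, v) ≤ -ℓ t x v := by
      rw [real_inner_comm] at hconj
      linarith
    have hcurve : HasDerivAt (fun s : ℝ => u s (x + (s - t) • v)) (D (1, v)) t := by
      have h1 : HasDerivAt (fun s : ℝ => x + (s - t) • v) v t := by
        simpa using (((hasDerivAt_id t).sub_const t).smul_const v).const_add x
      have h2 : HasDerivAt (fun s : ℝ => (s, x + (s - t) • v)) (1, v) t :=
        (hasDerivAt_id t).prodMk h1
      refine HasFDerivAt.comp_hasDerivAt (l := fun a : ℝ × Space d => u a.1 a.2)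
        (f := fun s : ℝ => (s, x + (s - t) • v)) t ?_ h2
      simpa using hD
    have hslope := hcurve.tendsto_slope.mono_left (nhdsWithin_mono t fun s hs => ne_of_gt hs)
    have hev := hslope.eventually_lt_const (show D (1, v) < -c by linarith)
    filter_upwards [hev, self_mem_nhdsWithin] with s hs hts
    have h3 : 0 < s - t := sub_pos.2 hts
    rw [slope_def_field, div_lt_iff₀ h3] at hs
    simp only [sub_self, zero_smul, add_zero] at hs
    linarith

end Curves

/-! ### Uniqueness of the optimal flow -/

/-- Young's inequality spends half of the convexity gain, which is at least `θ / 2 * N ^ 2` after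
division by `ε`, on the mixed terms. -/
lemma perturb_arith {θ C₁ C₂ N D A ε : ℝ} (hθ : 0 < θ) (hC₁ : 0 ≤ C₁) (hε : 0 ≤ ε)
    (hε2 : ε ≤ 1 / 2) :
    ε * (2 * C₁ * (D + A) ^ 2) + 2 * (ε * (C₂ * (D + A) * N))
      - 2 * (ε * ((1 - ε) * (θ / 2 * N ^ 2)))
      ≤ ε * (-(θ / 4) * N ^ 2 + 2 * (2 * C₁ + 4 * C₂ ^ 2 / θ) * (D ^ 2 + A ^ 2)) := by
  have f6 : θ / 4 * N ^ 2 ≤ (1 - ε) * (θ / 2 * N ^ 2) := by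
    have h1 : 0 ≤ θ / 2 * N ^ 2 := by positivity
    have h2 : 1 / 2 * (θ / 2 * N ^ 2) ≤ (1 - ε) * (θ / 2 * N ^ 2) := by gcongr; linarith
    linarith only [h2]
  have f7 : 2 * (C₂ * (D + A) * N) ≤ θ / 4 * N ^ 2 + 4 * C₂ ^ 2 / θ * (D + A) ^ 2 := by
    have h1 : θ / 4 * N ^ 2 + 4 * C₂ ^ 2 / θ * (D + A) ^ 2 - 2 * (C₂ * (D + A) * N)
        = (θ / 2 * N - 2 * C₂ * (D + A)) ^ 2 / θ := by field_simp; ring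
    have h2 : 0 ≤ (θ / 2 * N - 2 * C₂ * (D + A)) ^ 2 / θ := by positivity
    linarith only [h1, h2]
  have f8 : (2 * C₁ + 4 * C₂ ^ 2 / θ) * (D + A) ^ 2
      ≤ 2 * (2 * C₁ + 4 * C₂ ^ 2 / θ) * (D ^ 2 + A ^ 2) := by
    have h1 : (D + A) ^ 2 ≤ 2 * (D ^ 2 + A ^ 2) := by nlinarith [sq_nonneg (D - A)]
    calc _ ≤ (2 * C₁ + 4 * C₂ ^ 2 / θ) * (2 * (D ^ 2 + A ^ 2)) := by gcongr
      _ = _ := by ring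
  have f9 : 2 * C₁ * (D + A) ^ 2 + 2 * (C₂ * (D + A) * N) - 2 * ((1 - ε) * (θ / 2 * N ^ 2)) ≤
      -(θ / 4) * N ^ 2 + 2 * (2 * C₁ + 4 * C₂ ^ 2 / θ) * (D ^ 2 + A ^ 2) := by
    linarith only [f6, f7, f8]
  have f10 := mul_le_mul_of_nonneg_left f9 hε
  linarith only [f10]

/-- Moving two trajectories towards each other makes the first-order changes of the cost cancel.
What remains is the gain from convexity in the velocity and double differences of `ℓ`, which are `ε`
times quadratic in the distances. The shift `a` allows the perturbation to vanish at a prescribed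
time. -/
lemma TameLagrangian.perturb {d : ℕ} {ℓ : ℝ → Space d → Space d → ℝ} (hℓ : TameLagrangian ℓ)
    (R : ℝ) : ∃ c C : ℝ, 0 < c ∧ 0 ≤ C ∧ ∀ t x y v w a, ∀ ε : ℝ, ‖v‖ ≤ R → ‖w‖ ≤ R → 0 < ε →
      ε ≤ 1 / 2 →
      ℓ t (x + (-ε) • (x - y - a)) (v + (-ε) • (v - w)) + ℓ t (y + ε • (x - y - a)) (w + ε • (v - w))
        - ℓ t x v - ℓ t y w ≤ ε * (-c * ‖v - w‖ ^ 2 + C * (‖x - y‖ ^ 2 + ‖a‖ ^ 2)) := by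
  obtain ⟨θ, hθ, hconv⟩ := hℓ.convex
  obtain ⟨C₁, hC₁, h₁⟩ := hℓ.diffx R
  obtain ⟨C₂, hC₂, h₂⟩ := hℓ.diffv R
  refine ⟨θ / 4, 2 * (2 * C₁ + 4 * C₂ ^ 2 / θ), by positivity, by positivity,
    fun t x y v w a ε hv hw hε hε2 => ?_⟩
  set η := x - y - a with hη
  set V := v + (-ε) • (v - w) with hV
  set W := w + ε • (v - w) with hW
  have hVe : V = (1 - ε) • v + ε • w := by rw [hV]; module
  have hWe : W = ε • v + (1 - ε) • w := by rw [hW]; module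
  have hconvb : ∀ α β : ℝ, 0 ≤ α → 0 ≤ β → α + β = 1 → ‖α • v + β • w‖ ≤ R := by
    intro α β hα hβ hαβ
    calc ‖α • v + β • w‖ ≤ ‖α • v‖ + ‖β • w‖ := norm_add_le _ _
      _ = α * ‖v‖ + β * ‖w‖ := by
        rw [norm_smul, norm_smul, Real.norm_of_nonneg hα, Real.norm_of_nonneg hβ]
      _ ≤ α * R + β * R := by gcongr
      _ = R := by rw [← add_mul, hαβ, one_mul]
  have hVR : ‖V‖ ≤ R := by
    rw [hVe]; exact hconvb _ _ (by linarith) hε.le (by ring)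
  have hWR : ‖W‖ ≤ R := by
    rw [hWe]; exact hconvb _ _ hε.le (by linarith) (by ring)
  have e1 : ℓ t x V ≤ (1 - ε) * ℓ t x v + ε * ℓ t x w - (1 - ε) * ε * (θ / 2 * ‖v - w‖ ^ 2) := by
    rw [hVe]; exact strongConvexOn_le (hconv t x) v w (by linarith) hε.le (by ring)
  have e2 : ℓ t x W ≤ ε * ℓ t x v + (1 - ε) * ℓ t x w - ε * (1 - ε) * (θ / 2 * ‖v - w‖ ^ 2) := by
    rw [hWe]; exact strongConvexOn_le (hconv t x) v w hε.le (by linarith) (by ring)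
  -- `e3` returns the positions from `x - εη` and `y + εη` to `x` and `y` at the common velocity
  -- `V`; `e4` and `e5` then correct the velocity, so that `e1` and `e2` can be applied at the
  -- single state `x`.
  have e3 := (abs_le.1 (h₁ t V y (x + (-ε) • η) (ε • η) hVR)).2
  rw [show x + (-ε) • η + ε • η = x by module] at e3
  have e4 := (abs_le.1 (h₂ t (y + ε • η) y W V hWR hVR)).2
  have e5 := (abs_le.1 (h₂ t y x W w hWR hw)).2
  have n1 : ‖ε • η‖ = ε * ‖η‖ := by rw [norm_smul, Real.norm_of_nonneg hε.le]
  have n2 : ‖y - (x + (-ε) • η)‖ ≤ ‖x - y‖ + ‖η‖ := by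
    calc ‖y - (x + (-ε) • η)‖ = ‖-(x - y) + ε • η‖ := by congr 1; module
      _ ≤ ‖x - y‖ + ε * ‖η‖ := by
        refine (norm_add_le _ _).trans ?_
        rw [norm_neg, n1]
      _ ≤ ‖x - y‖ + ‖η‖ := by nlinarith [norm_nonneg η]
  have n3 : ‖y + ε • η - y‖ = ε * ‖η‖ := by rw [add_sub_cancel_left, n1]
  have n4 : ‖W - V‖ ≤ ‖v - w‖ := by
    have : W - V = (-(1 - 2 * ε)) • (v - w) := by rw [hV, hW]; module
    rw [this, norm_smul, norm_neg, Real.norm_of_nonneg (by linarith)]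
    nlinarith [norm_nonneg (v - w)]
  have n5 : ‖W - w‖ = ε * ‖v - w‖ := by
    rw [hW, add_sub_cancel_left, norm_smul, Real.norm_of_nonneg hε.le]
  have n6 : ‖η‖ ≤ ‖x - y‖ + ‖a‖ := norm_sub_le _ _
  rw [n1] at e3
  rw [n3] at e4
  rw [n5, norm_sub_rev y x] at e5
  set N := ‖v - w‖ with hN
  set D := ‖x - y‖ with hD
  set A := ‖a‖ with hA
  have hN0 : 0 ≤ N := norm_nonneg _
  have hD0 : 0 ≤ D := norm_nonneg _
  have hA0 : 0 ≤ A := norm_nonneg _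
  have f3 : C₁ * (ε * ‖η‖) * ‖y - (x + (-ε) • η)‖ ≤ ε * (2 * C₁ * (D + A) ^ 2) := by
    calc C₁ * (ε * ‖η‖) * ‖y - (x + (-ε) • η)‖ ≤ C₁ * (ε * (D + A)) * (D + (D + A)) := by
          gcongr; exact n2.trans (by linarith)
      _ ≤ C₁ * (ε * (D + A)) * (2 * (D + A)) := by gcongr; linarith
      _ = _ := by ring
  have f4 : C₂ * (ε * ‖η‖) * ‖W - V‖ ≤ ε * (C₂ * (D + A) * N) := by
    calc C₂ * (ε * ‖η‖) * ‖W - V‖ ≤ C₂ * (ε * (D + A)) * N := by gcongr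
      _ = _ := by ring
  have f5 : C₂ * D * (ε * N) ≤ ε * (C₂ * (D + A) * N) := by
    calc C₂ * D * (ε * N) ≤ C₂ * (D + A) * (ε * N) := by gcongr; linarith
      _ = _ := by ring
  have f6 := perturb_arith hθ hC₁ hε.le hε2 (C₂ := C₂) (N := N) (D := D) (A := A)
  linarith only [e1, e2, e3, e4, e5, f3, f4, f5, f6]

/-! ### Bounded increments, second moments and second differences -/

section Flow

variable {d : ℕ} {q : ℝ≥0∞} {Ω : Type*} [MeasurableSpace Ω] {P : Measure Ω} [Fact (1 ≤ q)]
  [IsProbabilityMeasure P]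

/-- A curve in `L^q` with bounded velocity has bounded increments. -/
lemma ae_norm_le_of_velocity {a b R : ℝ} (hR : 0 ≤ R) {Y Z : ℝ → RV d q P}
    (hc : ContinuousOn Y (Icc a b)) (hY : ∀ t ∈ Ioo a b, HasDerivAt Y (Z t) t)
    (hZ : ∀ t ∈ Ioo a b, ∀ᵐ ω ∂P, ‖Z t ω‖ ≤ R) (h0 : Y a = 0) {t : ℝ} (ht : t ∈ Icc a b) :
    ∀ᵐ ω ∂P, ‖Y t ω‖ ≤ R * (b - a) := by
  -- This function is nonpositive and does not decrease along lines of speed at most `R`. Its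
  -- expectation along the curve therefore starts at zero, does not decrease, and must vanish.
  set w : ℝ → Space d → ℝ := fun s x => -max (‖x‖ - R * (s - a)) 0 with hw
  have hx : ∀ s, ∀ x y, |w s x - w s y| ≤ 1 * ‖x - y‖ := by
    intro s x y
    simp only [hw]
    rw [neg_sub_neg, abs_sub_comm, one_mul]
    refine (abs_max_sub_max_le_abs _ _ _).trans ?_
    rw [sub_sub_sub_cancel_right]
    exact abs_norm_sub_norm_le x y
  have htl : ∀ s t, ∀ x, |w s x - w t x| ≤ R * |s - t| := by
    intro s t x
    simp only [hw]
    rw [neg_sub_neg, abs_sub_comm]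
    refine (abs_max_sub_max_le_abs _ _ _).trans (le_of_eq ?_)
    rw [sub_sub_sub_cancel_left, ← mul_sub, sub_sub_sub_cancel_right, abs_mul, abs_of_nonneg hR,
      abs_sub_comm]
  have hge : ∀ s t, t ≤ s → ∀ x z : Space d, ‖z‖ ≤ R → 0 ≤ w s (x + (s - t) • z) - w t x := by
    intro s t hts x z hz
    have h1 : ‖x + (s - t) • z‖ ≤ ‖x‖ + (s - t) * R := by
      refine (norm_add_le _ _).trans ?_
      rw [norm_smul, Real.norm_of_nonneg (sub_nonneg.2 hts)]
      have := sub_nonneg.2 hts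
      gcongr
    simp only [hw]
    have h2 : max (‖x + (s - t) • z‖ - R * (s - a)) 0 ≤ max (‖x‖ - R * (t - a)) 0 :=
      max_le_max_right _ (by linarith)
    linarith
  have hcont := continuousOn_integral_comp (I := Icc a t) zero_le_one (fun s _ => hx s)
    (fun s _ t _ => htl s t) (hc.mono (Icc_subset_Icc_right ht.2))
  have hsl : ∀ s ∈ Ioo a t, LowerSlope (fun s => ∫ ω, w s (Y s ω) ∂P) s 0 := by
    intro s hs
    have hsb : s ∈ Ioo a b := ⟨hs.1, hs.2.trans_le ht.2⟩
    have := lowerSlope_integral_comp (w := w) (A := fun _ => (0 : ℝ)) (b := b) (C := 0) (CA := 0)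
      zero_le_one hsb.2 (hY s hsb) (fun s _ => hx s)
      (by filter_upwards [hZ s hsb] with ω hω σ hσ
          simpa using hge σ s hσ.1.le _ _ hω)
      aestronglyMeasurable_const (by simp)
      (by filter_upwards [hZ s hsb] with ω hω c hcc
          filter_upwards [self_mem_nhdsWithin] with σ hσ
          have hσ : s < σ := hσ
          have h2 := hge σ s hσ.le (Y s ω) _ hω
          have h3 : 0 < σ - s := sub_pos.2 hσ
          nlinarith)
    simpa using this
  have hle := LowerSlope.le_sub ht.1 hcont hsl
  have hga : ∫ ω, w a (Y a ω) ∂P = 0 := by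
    rw [h0]
    refine integral_eq_zero_of_ae ?_
    filter_upwards [Lp.coeFn_zero (Space d) q P] with ω hω
    rw [hω]; simp [hw]
  rw [hga] at hle
  have hint := integrable_comp_lip (hx t) (Y t)
  have hz : ∫ ω, -w t (Y t ω) ∂P = 0 := by
    rw [integral_neg]
    have h1 : ∫ ω, w t (Y t ω) ∂P ≤ 0 := integral_nonpos fun ω => by simp [hw]
    linarith
  have hz' := (integral_eq_zero_iff_of_nonneg (f := fun ω => -w t (Y t ω))
    (fun ω => by simp [hw]) hint.neg).1 hz
  filter_upwards [hz'] with ω hω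
  simp only [hw, neg_neg, Pi.zero_apply] at hω
  have h1 := le_max_left (‖Y t ω‖ - R * (t - a)) 0
  rw [hω] at h1
  have h2 : R * (t - a) ≤ R * (b - a) := by gcongr; exact ht.2
  linarith

/-- Truncation makes the square Lipschitz, so that expectations along `L^q` curves can be handled
even for `q < 2`; it is inactive on curves bounded by `D`. -/
lemma abs_min_sq_sub_le {D : ℝ} (hD : 0 ≤ D) (x y : Space d) :
    |min ‖x‖ D ^ 2 - min ‖y‖ D ^ 2| ≤ 2 * D * ‖x - y‖ := by
  have h1 : |min ‖x‖ D - min ‖y‖ D| ≤ ‖x - y‖ :=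
    (abs_min_sub_min_le_max _ _ _ _).trans
      (by simpa using abs_norm_sub_norm_le x y)
  have h2 : 0 ≤ min ‖x‖ D := le_min (norm_nonneg _) hD
  have h3 : 0 ≤ min ‖y‖ D := le_min (norm_nonneg _) hD
  rw [sq_sub_sq, abs_mul, abs_of_nonneg (add_nonneg h2 h3)]
  have h4 := min_le_right ‖x‖ D
  have h5 := min_le_right ‖y‖ D
  calc _ ≤ (D + D) * ‖x - y‖ := by gcongr
    _ = _ := by ring

/-- The second moment grows at most as fast as its formal derivative. -/
lemma lowerSlope_neg_sq {Y : ℝ → RV d q P} {Z : RV d q P} {t D R : ℝ} (hD : 0 ≤ D)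
    (hY : HasDerivAt Y Z t) (hYD : ∀ᵐ ω ∂P, ‖Y t ω‖ ≤ D) (hZ : ∀ᵐ ω ∂P, ‖Z ω‖ ≤ R) :
    LowerSlope (fun s => ∫ ω, -min ‖Y s ω‖ D ^ 2 ∂P) t (∫ ω, -(2 * ‖Y t ω‖ * ‖Z ω‖) ∂P) := by
  have hx : ∀ x y : Space d, |-min ‖x‖ D ^ 2 - -min ‖y‖ D ^ 2| ≤ 2 * D * ‖x - y‖ := by
    intro x y
    rw [neg_sub_neg, abs_sub_comm]
    exact abs_min_sq_sub_le hD x y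
  refine lowerSlope_integral_comp (w := fun _ x => -min ‖x‖ D ^ 2) (K := 2 * D) (b := t + 1)
    (C := 2 * D * R) (CA := 2 * D * R) (by positivity) (by linarith) hY (fun _ _ => hx) ?_ ?_ ?_ ?_
  · filter_upwards [hZ] with ω hω s hs
    have h1 := (abs_le.1 (hx (Y t ω + (s - t) • Z ω) (Y t ω))).1
    have h3 : 0 < s - t := sub_pos.2 hs.1
    rw [add_sub_cancel_left, norm_smul, Real.norm_of_nonneg h3.le] at h1
    have h4 : 2 * D * ((s - t) * ‖Z ω‖) ≤ 2 * D * ((s - t) * R) := by gcongr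
    linarith
  · exact ((((Lp.aestronglyMeasurable (Y t)).norm).const_mul 2).mul
      (Lp.aestronglyMeasurable Z).norm).neg
  · filter_upwards [hYD, hZ] with ω h1 h2
    rw [abs_neg, abs_of_nonneg (by positivity)]
    gcongr
  · filter_upwards [hYD] with ω h1 c hc
    have hcont : Continuous fun s : ℝ => (s - t) * ‖Z ω‖ ^ 2 := by fun_prop
    have hev : ∀ᶠ s in 𝓝[>] t, (s - t) * ‖Z ω‖ ^ 2 < -(2 * ‖Y t ω‖ * ‖Z ω‖) - c :=
      (hcont.continuousAt.eventually_lt continuousAt_const (by simp; linarith)).filter_mono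
        nhdsWithin_le_nhds
    filter_upwards [hev, self_mem_nhdsWithin] with s hs hts
    have h3 : 0 < s - t := sub_pos.2 hts
    have h4 : ‖Y t ω + (s - t) • Z ω‖ ≤ ‖Y t ω‖ + (s - t) * ‖Z ω‖ := by
      refine (norm_add_le _ _).trans ?_
      rw [norm_smul, Real.norm_of_nonneg h3.le]
    have h5 : min ‖Y t ω + (s - t) • Z ω‖ D ^ 2 ≤ (‖Y t ω‖ + (s - t) * ‖Z ω‖) ^ 2 := by
      have : 0 ≤ min ‖Y t ω + (s - t) • Z ω‖ D := le_min (norm_nonneg _) hD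
      gcongr
      exact (min_le_left _ _).trans h4
    rw [min_eq_left h1]
    nlinarith

/-- At points of differentiability the first-order terms for `a` and `-a` cancel, and the Lipschitz
bound dominates the quotients by `2K‖a‖`. -/
lemma tendsto_second_difference {f : Space d → ℝ} {K : ℝ}
    (hf : ∀ x y, |f x - f y| ≤ K * ‖x - y‖) (X a : RV d q P)
    (hd : ∀ᵐ ω ∂P, DifferentiableAt ℝ f (X ω)) :
    Tendsto (fun ε : ℝ => (∫ ω, f ((X + ε • a) ω) ∂P + ∫ ω, f ((X + (-ε) • a) ω) ∂P
      - 2 * ∫ ω, f (X ω) ∂P) / ε) (𝓝[>] 0) (𝓝 0) := by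
  have hi : ∀ ε : ℝ, Integrable (fun ω => f (X ω + ε • a ω)) P := by
    intro ε
    refine (integrable_comp_lip hf (X + ε • a)).congr ?_
    filter_upwards [coeFn_add_smul X a ε] with ω hω
    rw [hω]
  have hX := integrable_comp_lip hf X
  have hlim : Tendsto (fun ε : ℝ => ∫ ω, (f (X ω + ε • a ω) + f (X ω + (-ε) • a ω)
      - 2 * f (X ω)) / ε ∂P) (𝓝[>] 0) (𝓝 (∫ _, (0 : ℝ) ∂P)) := by
    refine tendsto_integral_filter_of_dominated_convergence (fun ω => 2 * K * ‖a ω‖) ?_ ?_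
      ((integrable_rv a).norm.const_mul _) ?_
    · exact Eventually.of_forall fun ε =>
        ((((hi ε).add (hi (-ε))).sub (hX.const_mul 2)).div_const ε).aestronglyMeasurable
    · filter_upwards [self_mem_nhdsWithin] with ε hε
      have hε : 0 < ε := hε
      refine Eventually.of_forall fun ω => ?_
      have h1 := hf (X ω + ε • a ω) (X ω)
      have h2 := hf (X ω + (-ε) • a ω) (X ω)
      rw [add_sub_cancel_left, norm_smul, Real.norm_of_nonneg hε.le] at h1
      rw [add_sub_cancel_left, norm_smul, norm_neg, Real.norm_of_nonneg hε.le] at h2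
      rw [Real.norm_eq_abs, abs_div, abs_of_pos hε, div_le_iff₀ hε]
      rw [abs_le] at *
      constructor <;> linarith
    · filter_upwards [hd] with ω hω
      obtain ⟨D, hD⟩ := hω
      have key : ∀ b : Space d, HasDerivAt (fun ε : ℝ => f (X ω + ε • b)) (D b) 0 := by
        intro b
        have h1 : HasDerivAt (fun ε : ℝ => X ω + ε • b) b 0 := by
          simpa using ((hasDerivAt_id (0 : ℝ)).smul_const b).const_add (X ω)
        refine HasFDerivAt.comp_hasDerivAt (l := f) (f := fun ε : ℝ => X ω + ε • b) 0 ?_ h1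
        simpa using hD
      have h2 := (key (a ω)).add (key (-a ω))
      rw [← map_add, add_neg_cancel, map_zero] at h2
      have h3 := h2.tendsto_slope.mono_left
        (nhdsWithin_mono (0 : ℝ) fun s (hs : s ∈ Ioi (0 : ℝ)) => ne_of_gt hs)
      refine h3.congr fun ε => ?_
      rw [slope_def_field]
      simp only [Pi.add_apply, zero_smul, add_zero, sub_zero, smul_neg, neg_smul, neg_zero]
      ring
  rw [integral_zero] at hlim
  refine hlim.congr fun ε => ?_
  have h1 := integral_sub (f := fun ω => f (X ω + ε • a ω) + f (X ω + (-ε) • a ω))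
    ((hi ε).add (hi (-ε))) (hX.const_mul 2)
  rw [integral_div, h1, integral_const_mul, integral_add (hi ε) (hi (-ε))]
  have hc : ∀ ε : ℝ, ∫ ω, f ((X + ε • a) ω) ∂P = ∫ ω, f (X ω + ε • a ω) ∂P := fun ε => by
    refine integral_congr_ae ?_
    filter_upwards [coeFn_add_smul X a ε] with ω hω
    rw [hω]
  rw [hc, hc]

end Flow

lemma integrable_norm_sq {d : ℕ} {q : ℝ≥0∞} {Ω : Type*} [MeasurableSpace Ω] {P : Measure Ω}
    [IsProbabilityMeasure P] {U : RV d q P} {D : ℝ} (hU : ∀ᵐ ω ∂P, ‖U ω‖ ≤ D) :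
    Integrable (fun ω => ‖U ω‖ ^ 2) P := by
  refine (integrable_const (D ^ 2)).mono' ((Lp.aestronglyMeasurable U).norm.pow 2) ?_
  filter_upwards [hU] with ω h
  rw [Real.norm_of_nonneg (by positivity)]
  gcongr

lemma integral_add_sub_sub {Ω : Type*} [MeasurableSpace Ω] {P : Measure Ω} {f₁ f₂ f₃ f₄ : Ω → ℝ} (i₁ : Integrable f₁ P) (i₂ : Integrable f₂ P)
    (i₃ : Integrable f₃ P) (i₄ : Integrable f₄ P) :
    ∫ ω, (f₁ ω + f₂ ω - f₃ ω - f₄ ω) ∂P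
      = ∫ ω, f₁ ω ∂P + ∫ ω, f₂ ω ∂P - ∫ ω, f₃ ω ∂P - ∫ ω, f₄ ω ∂P := by
  rw [integral_sub (f := fun ω => f₁ ω + f₂ ω - f₃ ω) ((i₁.add i₂).sub i₃) i₄,
    integral_sub (f := fun ω => f₁ ω + f₂ ω) (i₁.add i₂) i₃, integral_add i₁ i₂]

/-- Running costs of the perturbed flows, compared with those of the flows themselves. -/
lemma TameLagrangian.integral_perturb_le {d : ℕ} {q : ℝ≥0∞} {Ω : Type*} [MeasurableSpace Ω]
    {P : Measure Ω} [IsProbabilityMeasure P] {ℓ : ℝ → Space d → Space d → ℝ} (hℓ : TameLagrangian ℓ)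
    {R c C D ε : ℝ} (h : ∀ t x y v w a, ‖v‖ ≤ R → ‖w‖ ≤ R →
      ℓ t (x + (-ε) • (x - y - a)) (v + (-ε) • (v - w)) + ℓ t (y + ε • (x - y - a)) (w + ε • (v - w))
        - ℓ t x v - ℓ t y w ≤ ε * (-c * ‖v - w‖ ^ 2 + C * (‖x - y‖ ^ 2 + ‖a‖ ^ 2)))
    (t : ℝ) {X Y V W a : RV d q P} (hV : ∀ᵐ ω ∂P, ‖V ω‖ ≤ R) (hW : ∀ᵐ ω ∂P, ‖W ω‖ ≤ R)
    (hVW : ∀ᵐ ω ∂P, ‖(V - W) ω‖ ≤ 2 * R)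
    (hXY : ∀ᵐ ω ∂P, ‖(X - Y) ω‖ ≤ D) (ha : ∀ᵐ ω ∂P, ‖a ω‖ ≤ D)
    (h1 : ∀ᵐ ω ∂P, ‖(V + (-ε) • (V - W)) ω‖ ≤ 2 * R)
    (h2 : ∀ᵐ ω ∂P, ‖(W + ε • (V - W)) ω‖ ≤ 2 * R) :
    ∫ ω, ℓ t ((X + (-ε) • (X - Y - a)) ω) ((V + (-ε) • (V - W)) ω) ∂P
      + ∫ ω, ℓ t ((Y + ε • (X - Y - a)) ω) ((W + ε • (V - W)) ω) ∂P
      - ∫ ω, ℓ t (X ω) (V ω) ∂P - ∫ ω, ℓ t (Y ω) (W ω) ∂P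
      ≤ ε * (-c * ∫ ω, ‖(V - W) ω‖ ^ 2 ∂P + C * (∫ ω, ‖(X - Y) ω‖ ^ 2 ∂P + ∫ ω, ‖a ω‖ ^ 2 ∂P)) := by
  have m : ∀ U : RV d q P, AEStronglyMeasurable (fun ω => U ω) P := fun U =>
    Lp.aestronglyMeasurable U
  have i1 := hℓ.integrable t (m (X + (-ε) • (X - Y - a))) (m (V + (-ε) • (V - W))) h1
  have i2 := hℓ.integrable t (m (Y + ε • (X - Y - a))) (m (W + ε • (V - W))) h2
  have i3 := hℓ.integrable t (m X) (m V) hV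
  have i4 := hℓ.integrable t (m Y) (m W) hW
  have j1 := integrable_norm_sq hVW
  have j2 := integrable_norm_sq hXY
  have j3 := integrable_norm_sq ha
  have k : ∫ ω, ε * (-c * ‖(V - W) ω‖ ^ 2 + C * (‖(X - Y) ω‖ ^ 2 + ‖a ω‖ ^ 2)) ∂P = ε * (-c *
      ∫ ω, ‖(V - W) ω‖ ^ 2 ∂P + C * (∫ ω, ‖(X - Y) ω‖ ^ 2 ∂P + ∫ ω, ‖a ω‖ ^ 2 ∂P)) := by
    have k1 := integral_add (j1.const_mul (-c)) ((j2.add j3).const_mul C)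
    simp only [Pi.add_apply] at k1
    rw [integral_const_mul, k1, integral_const_mul, integral_const_mul, integral_add j2 j3]
  rw [← integral_add_sub_sub i1 i2 i3 i4, ← k]
  refine integral_mono_ae (((i1.add i2).sub i3).sub i4)
    (((j1.const_mul _).add ((j2.add j3).const_mul _)).const_mul _) ?_
  filter_upwards [hV, hW, coeFn_add_smul X (X - Y - a) (-ε), coeFn_add_smul Y (X - Y - a) ε,
    coeFn_add_smul V (V - W) (-ε), coeFn_add_smul W (V - W) ε, Lp.coeFn_sub (X - Y) a,
    Lp.coeFn_sub X Y, Lp.coeFn_sub V W] with ω g1 g2 g3 g4 g5 g6 g7 g8 g9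
  have := h t (X ω) (Y ω) (V ω) (W ω) (a ω) g1 g2
  rw [g3, g4, g5, g6, g7, Pi.sub_apply, g8, Pi.sub_apply, g9, Pi.sub_apply]
  exact this

/-! ### Two optimal flows for one value function -/

section Flow

variable {d : ℕ} {q : ℝ≥0∞} {Ω : Type*} [MeasurableSpace Ω] {P : Measure Ω} [Fact (1 ≤ q)]

/-- A random flow along which the value `u` decreases at least as fast as the running cost. -/
structure OptimalFlow (P : Measure Ω) (T R : ℝ) (ℓ : ℝ → Space d → Space d → ℝ)
    (u : ℝ → Space d → ℝ) (X V : ℝ → RV d q P) : Prop where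
  cont : ContinuousOn X (Icc 0 T)
  deriv : ∀ t ∈ Ioo 0 T, HasDerivAt X (V t) t
  bdd : ∀ t ∈ Ioo 0 T, ∀ᵐ ω ∂P, ‖V t ω‖ ≤ R
  slope : ∀ t ∈ Ioo 0 T,
    LowerSlope (fun s => ∫ ω, -u s (X s ω) ∂P) t (∫ ω, ℓ t (X t ω) (V t ω) ∂P)

variable [IsProbabilityMeasure P]

/-- Two optimal flows that agree at a time at which the value is differentiable along them agree
for a short time. -/
lemma OptimalFlow.eq_short {T R : ℝ} {ℓ : ℝ → Space d → Space d → ℝ} {u : ℝ → Space d → ℝ}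
    {X V X' V' : ℝ → RV d q P} (hR : 0 ≤ R) (hℓ : TameLagrangian ℓ)
    (hu : LipschitzSolution T ℓ u) (hX : OptimalFlow P T R ℓ u X V)
    (hX' : OptimalFlow P T R ℓ u X' V') :
    ∃ h : ℝ, 0 < h ∧ ∀ τ b, 0 ≤ τ → τ ≤ b → b ≤ T → b - τ ≤ h → X τ = X' τ →
      (∀ᵐ ω ∂P, DifferentiableAt ℝ (u τ) (X τ ω)) → ∀ t ∈ Icc τ b, X t = X' t := by
  obtain ⟨c, C, hc, hC, hpert⟩ := hℓ.perturb R
  -- On an interval of this length the error `(c + 2C) M (b - τ)` uses at most half of the gain `c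
  -- M`.
  refine ⟨c / (2 * (c + 2 * C)), by positivity, fun τ b hτ hτb hbT hh heq hdiff => ?_⟩
  have hIcc : Icc τ b ⊆ Icc 0 T := Icc_subset_Icc hτ hbT
  have hIoo : Ioo τ b ⊆ Ioo 0 T := Ioo_subset_Ioo hτ hbT
  set δ : ℝ → RV d q P := fun s => X s - X' s with hδ
  set W : ℝ → RV d q P := fun s => V s - V' s with hW
  have hδc : ContinuousOn δ (Icc 0 T) := hX.cont.sub hX'.cont
  have hδd : ∀ t ∈ Ioo 0 T, HasDerivAt δ (W t) t := fun t ht => (hX.deriv t ht).sub (hX'.deriv t ht)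
  have hWb : ∀ t ∈ Ioo 0 T, ∀ᵐ ω ∂P, ‖W t ω‖ ≤ 2 * R := by
    intro t ht
    filter_upwards [hX.bdd t ht, hX'.bdd t ht, Lp.coeFn_sub (V t) (V' t)] with ω h1 h2 h3
    rw [h3, Pi.sub_apply]
    exact (norm_sub_le _ _).trans (by linarith)
  have hδτ : δ τ = 0 := sub_eq_zero.2 heq
  set D : ℝ := 2 * R * (b - τ) with hD
  have hD0 : 0 ≤ D := mul_nonneg (by positivity) (sub_nonneg.2 hτb)
  have hδD : ∀ t ∈ Icc τ b, ∀ᵐ ω ∂P, ‖δ t ω‖ ≤ D := fun t ht =>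
    ae_norm_le_of_velocity (by positivity) (hδc.mono hIcc) (fun t ht => hδd t (hIoo ht))
      (fun t ht => hWb t (hIoo ht)) hδτ ht
  set N : ℝ → ℝ := fun s => ∫ ω, min ‖δ s ω‖ D ^ 2 ∂P with hN
  have hNsq : ∀ t ∈ Icc τ b, N t = ∫ ω, ‖δ t ω‖ ^ 2 ∂P := fun t ht => by
    refine integral_congr_ae ?_
    filter_upwards [hδD t ht] with ω hω
    rw [min_eq_left hω]
  have hNc : ContinuousOn N (Icc τ b) :=
    continuousOn_integral_comp (w := fun _ x => min ‖x‖ D ^ 2) (K := 2 * D) (C := 0) (by positivity)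
      (fun _ _ => abs_min_sq_sub_le hD0) (by simp) (hδc.mono hIcc)
  obtain ⟨s₀, hs₀, hmax⟩ := isCompact_Icc.exists_isMaxOn ⟨τ, left_mem_Icc.2 hτb⟩ hNc
  set M := N s₀ with hM
  have hNM : ∀ t ∈ Icc τ b, N t ≤ M := fun t ht => hmax ht
  have hM0 : 0 ≤ M := integral_nonneg fun ω => by positivity
  have hbm : b ∈ Icc τ b := right_mem_Icc.2 hτb
  set a : RV d q P := δ b with ha
  have haM : ∫ ω, ‖a ω‖ ^ 2 ∂P ≤ M := by rw [← hNsq b hbm]; exact hNM b hbm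
  have hNτ : N τ = 0 := by
    simp only [hN]
    rw [hδτ]
    refine integral_eq_zero_of_ae ?_
    filter_upwards [Lp.coeFn_zero (Space d) q P] with ω hω
    rw [hω]; simp [hD0]
  -- The perturbed flows equal `X` and `X'` at time `b`, where `δ = a`, and are `X τ ± εa` at time
  -- `τ`, where `δ = 0`.
  set Y : ℝ → ℝ → RV d q P := fun ε s => X s + (-ε) • (δ s - a) with hY
  set Y' : ℝ → ℝ → RV d q P := fun ε s => X' s + ε • (δ s - a) with hY'
  have hηc : ContinuousOn (fun s => δ s - a) (Icc 0 T) := hδc.sub continuousOn_const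
  have hYc : ∀ ε, ContinuousOn (Y ε) (Icc 0 T) := fun ε => hX.cont.add (hηc.fun_const_smul (-ε))
  have hYc' : ∀ ε, ContinuousOn (Y' ε) (Icc 0 T) := fun ε => hX'.cont.add (hηc.fun_const_smul ε)
  have hYd : ∀ ε, ∀ t ∈ Ioo 0 T, HasDerivAt (Y ε) (V t + (-ε) • W t) t := fun ε t ht =>
    (hX.deriv t ht).add (((hδd t ht).sub_const a).const_smul (-ε))
  have hYd' : ∀ ε, ∀ t ∈ Ioo 0 T, HasDerivAt (Y' ε) (V' t + ε • W t) t := fun ε t ht =>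
    (hX'.deriv t ht).add (((hδd t ht).sub_const a).const_smul ε)
  set G : ℝ → ℝ → ℝ := fun ε s => ((∫ ω, u s (Y ε s ω) ∂P + ∫ ω, u s (Y' ε s ω) ∂P)
    + ∫ ω, -u s (X s ω) ∂P) + ∫ ω, -u s (X' s ω) ∂P with hG
  have hGc : ∀ ε, ContinuousOn (G ε) (Icc 0 T) := fun ε => by
    refine ((((hu.continuousOn_value hℓ (hYc ε))).add (hu.continuousOn_value hℓ (hYc' ε))).add
      ?_).add ?_
    · simp only [integral_neg]; exact (hu.continuousOn_value hℓ hX.cont).neg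
    · simp only [integral_neg]; exact (hu.continuousOn_value hℓ hX'.cont).neg
  have hGs : ∀ ε : ℝ, 0 < ε → ε ≤ 1 / 2 → ∀ t ∈ Ioo τ b,
      LowerSlope (G ε) t (ε * (c * ∫ ω, ‖W t ω‖ ^ 2 ∂P - 2 * C * M)) := by
    intro ε hε hε2 t ht
    have htT := hIoo ht
    have htI := Ioo_subset_Icc_self ht
    have b1 : ∀ᵐ ω ∂P, ‖(V t + (-ε) • W t) ω‖ ≤ 2 * R := by
      filter_upwards [hX.bdd t htT, hWb t htT, coeFn_add_smul (V t) (W t) (-ε)] with ω g1 g2 g3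
      rw [g3]
      refine (norm_add_le _ _).trans ?_
      rw [norm_smul, norm_neg, Real.norm_of_nonneg hε.le]
      have : ε * ‖W t ω‖ ≤ 1 / 2 * (2 * R) := by gcongr
      linarith
    have b2 : ∀ᵐ ω ∂P, ‖(V' t + ε • W t) ω‖ ≤ 2 * R := by
      filter_upwards [hX'.bdd t htT, hWb t htT, coeFn_add_smul (V' t) (W t) ε] with ω g1 g2 g3
      rw [g3]
      refine (norm_add_le _ _).trans ?_
      rw [norm_smul, Real.norm_of_nonneg hε.le]
      have : ε * ‖W t ω‖ ≤ 1 / 2 * (2 * R) := by gcongr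
      linarith
    have s1 := hu.lowerSlope_value hℓ htT (hYd ε t htT) b1
    have s2 := hu.lowerSlope_value hℓ htT (hYd' ε t htT) b2
    have s3 := ((s1.add s2).add (hX.slope t htT)).add (hX'.slope t htT)
    refine s3.mono ?_
    have key := hℓ.integral_perturb_le (D := D)
      (fun t x y v w a hv hw => hpert t x y v w a ε hv hw hε hε2) t (hX.bdd t htT) (hX'.bdd t htT)
      (hWb t htT) (hδD t htI) (hδD b hbm) b1 b2
    have e1 : ∫ ω, ‖δ t ω‖ ^ 2 ∂P ≤ M := by rw [← hNsq t htI]; exact hNM t htI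
    have e2 : ε * (C * (∫ ω, ‖δ t ω‖ ^ 2 ∂P + ∫ ω, ‖a ω‖ ^ 2 ∂P)) ≤ ε * (C * (M + M)) := by gcongr
    linarith only [key, e2]
  have hYb : ∀ ε, G ε b = 0 := by
    intro ε
    simp only [hG, hY, hY', ha, sub_self, smul_zero, add_zero, integral_neg]
    ring
  have hns : ∀ t ∈ Ioo τ b, LowerSlope (fun s => ∫ ω, -min ‖δ s ω‖ D ^ 2 ∂P) t
      (-(M + ∫ ω, ‖W t ω‖ ^ 2 ∂P)) := by
    intro t ht
    have htI := Ioo_subset_Icc_self ht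
    refine (lowerSlope_neg_sq hD0 (hδd t (hIoo ht)) (hδD t htI) (hWb t (hIoo ht))).mono ?_
    have i1 := integrable_norm_sq (hδD t htI)
    have i2 := integrable_norm_sq (hWb t (hIoo ht))
    have e1 : ∫ ω, ‖δ t ω‖ ^ 2 ∂P ≤ M := by rw [← hNsq t htI]; exact hNM t htI
    calc -(M + ∫ ω, ‖W t ω‖ ^ 2 ∂P) ≤ -(∫ ω, ‖δ t ω‖ ^ 2 ∂P + ∫ ω, ‖W t ω‖ ^ 2 ∂P) := by linarith
      _ = ∫ ω, -(‖δ t ω‖ ^ 2 + ‖W t ω‖ ^ 2) ∂P := by rw [integral_neg, integral_add i1 i2]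
      _ ≤ ∫ ω, -(2 * ‖δ t ω‖ * ‖W t ω‖) ∂P := by
        refine integral_mono_ae (i1.add i2).neg ?_ (Eventually.of_forall fun ω => ?_)
        · refine ((i1.add i2).mono' ((((Lp.aestronglyMeasurable (δ t)).norm.const_mul 2)).mul
            (Lp.aestronglyMeasurable (W t)).norm) (Eventually.of_forall fun ω => ?_)).neg
          simp only [Pi.add_apply, Pi.mul_apply]
          rw [Real.norm_of_nonneg (by positivity)]
          nlinarith [sq_nonneg (‖δ t ω‖ - ‖W t ω‖)]
        · simp only
          nlinarith [sq_nonneg (‖δ t ω‖ - ‖W t ω‖)]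
  -- Let `N` peak at `s₀` with value `M`. On `[τ, s₀]` the convexity gain pays for the growth of `N`
  -- from `0` to `M`; on `[s₀, b]` it is discarded. Since `G ε b = 0`, the sum of the two estimates
  -- bounds `-G ε τ` below.
  have hbal : ∀ ε : ℝ, 0 < ε → ε ≤ 1 / 2 → c / 2 * M ≤ -G ε τ / ε := by
    intro ε hε hε2
    have hεc : 0 < ε * c := by positivity
    have l1 := LowerSlope.le_sub (g := fun s => G ε s + ε * c * ∫ ω, -min ‖δ s ω‖ D ^ 2 ∂P)
      (m := -(ε * ((c + 2 * C) * M))) hs₀.1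
      (((hGc ε).mono ((Icc_subset_Icc_right hs₀.2).trans hIcc)).add
        ((continuousOn_const).mul (by
          simp only [integral_neg]; exact (hNc.mono (Icc_subset_Icc_right hs₀.2)).neg)))
      (fun t ht => by
        have ht' : t ∈ Ioo τ b := ⟨ht.1, ht.2.trans_le hs₀.2⟩
        refine ((hGs ε hε hε2 t ht').add ((hns t ht').const_mul hεc)).mono (le_of_eq ?_)
        ring)
    have l2 := LowerSlope.le_sub (g := G ε) (m := -(ε * (2 * C * M))) hs₀.2
      ((hGc ε).mono ((Icc_subset_Icc_left hs₀.1).trans hIcc))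
      (fun t ht => by
        refine (hGs ε hε hε2 t ⟨hs₀.1.trans_lt ht.1, ht.2⟩).mono ?_
        have : 0 ≤ c * ∫ ω, ‖W t ω‖ ^ 2 ∂P :=
          mul_nonneg hc.le (integral_nonneg fun ω => by positivity)
        nlinarith)
    simp only [integral_neg] at l1
    have n1 : ∫ ω, min ‖δ τ ω‖ D ^ 2 ∂P = 0 := hNτ
    have n2 : ∫ ω, min ‖δ s₀ ω‖ D ^ 2 ∂P = M := rfl
    rw [n1, n2] at l1
    rw [hYb ε] at l2
    have e1 : ε * (2 * C * M) * (b - s₀) ≤ ε * ((c + 2 * C) * M) * (b - s₀) := by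
      have := sub_nonneg.2 hs₀.2
      gcongr
      linarith
    have e2 : ε * ((c + 2 * C) * M) * (b - τ) ≤ ε * (c / 2 * M) := by
      calc ε * ((c + 2 * C) * M) * (b - τ)
          ≤ ε * ((c + 2 * C) * M) * (c / (2 * (c + 2 * C))) := by gcongr
        _ = ε * (c / 2 * M) := by field_simp
    rw [le_div_iff₀ hε]
    linarith only [l1, l2, e1, e2]
  obtain ⟨K, hK, hlip⟩ := hu.lip
  have hτI : τ ∈ Icc 0 T := hIcc (left_mem_Icc.2 hτb)
  -- `G ε τ` is exactly the second difference of `u τ` at `X τ` in the direction `a`, hence `o(ε)`.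
  have hlim := (tendsto_second_difference (hlip τ hτI) (X τ) a hdiff).neg
  have hlim' : Tendsto (fun ε => -G ε τ / ε) (𝓝[>] 0) (𝓝 0) := by
    rw [neg_zero] at hlim
    refine hlim.congr fun ε => ?_
    rw [← neg_div]
    congr 2
    simp only [hG, hY, hY', hδτ, zero_sub, ← heq, integral_neg, smul_neg, neg_smul, neg_neg]
    ring
  have hfin : c / 2 * M ≤ 0 := by
    refine ge_of_tendsto hlim' ?_
    filter_upwards [Ioo_mem_nhdsGT (show (0 : ℝ) < 1 / 2 by norm_num)] with ε hε
    exact hbal ε hε.1 hε.2.le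
  have hMz : M ≤ 0 := by
    by_contra hcon
    push Not at hcon
    have : 0 < c / 2 * M := by positivity
    linarith
  intro t ht
  have h1 : ∫ ω, ‖δ t ω‖ ^ 2 ∂P = 0 := by
    refine le_antisymm ?_ (integral_nonneg fun ω => by positivity)
    rw [← hNsq t ht]; exact (hNM t ht).trans hMz
  rw [integral_eq_zero_iff_of_nonneg (fun ω => by positivity) (integrable_norm_sq (hδD t ht))] at h1
  refine sub_eq_zero.1 (Lp.ext (f := δ t) ?_)
  filter_upwards [h1, Lp.coeFn_zero (Space d) q P] with ω g1 g2
  rw [g2]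
  simpa using g1

/-- Two optimal flows with the same initial state coincide, if the value is differentiable along
them at all times before `T`. -/
lemma OptimalFlow.eqOn {T R : ℝ} {ℓ : ℝ → Space d → Space d → ℝ} {u : ℝ → Space d → ℝ}
    {X V X' V' : ℝ → RV d q P} (hR : 0 ≤ R) (hℓ : TameLagrangian ℓ)
    (hu : LipschitzSolution T ℓ u) (hX : OptimalFlow P T R ℓ u X V)
    (hX' : OptimalFlow P T R ℓ u X' V') (h0 : X 0 = X' 0)
    (hdiff : ∀ t ∈ Ico 0 T, ∀ᵐ ω ∂P, DifferentiableAt ℝ (u t) (X t ω)) :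
    ∀ t ∈ Icc 0 T, X t = X' t := by
  obtain ⟨h, hh, H⟩ := hX.eq_short hR hℓ hu hX'
  have key : ∀ n : ℕ, ∀ t ∈ Icc 0 T, t ≤ n * h → X t = X' t := by
    intro n
    induction n with
    | zero =>
      intro t ht htn
      have : t = 0 := le_antisymm (by simpa using htn) ht.1
      rw [this, h0]
    | succ n ih =>
      intro t ht htn
      rcases le_or_gt t (n * h) with hle | hlt
      · exact ih t ht hle
      have hτ : (n : ℝ) * h ∈ Ico 0 T := ⟨by positivity, hlt.trans_le ht.2⟩
      push_cast at htn
      exact H (n * h) t hτ.1 hlt.le ht.2 (by linarith) (ih _ ⟨hτ.1, hτ.2.le⟩ le_rfl)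
        (hdiff _ hτ) t ⟨hlt.le, le_rfl⟩
  intro t ht
  obtain ⟨n, hn⟩ := exists_nat_ge (t / h)
  exact key n t ht (by rwa [div_le_iff₀ hh] at hn)

end Flow

/-! ### Lagrangians frozen along a curve of random variables are tame -/

lemma abs_second_difference_le {E : Type*} [NormedAddCommGroup E] [NormedSpace ℝ E] {f g : E → ℝ}
    {s : Set E} (hs : Convex ℝ s) (hf : Differentiable ℝ f) (hg : Differentiable ℝ g) {C : ℝ}
    (h : ∀ x ∈ s, ‖fderiv ℝ f x - fderiv ℝ g x‖ ≤ C) {x y : E} (hx : x ∈ s) (hy : y ∈ s) :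
    |f x - g x - f y + g y| ≤ C * ‖x - y‖ := by
  have h1 := hs.norm_image_sub_le_of_norm_fderiv_le (f := fun x => f x - g x) (𝕜 := ℝ) (C := C)
    (fun x _ => (hf x).sub (hg x))
    (fun x hx => by rw [fderiv_fun_sub (hf x) (hg x)]; exact h x hx) hy hx
  rw [Real.norm_eq_abs] at h1
  calc |f x - g x - f y + g y| = |f x - g x - (f y - g y)| := by congr 1; ring
    _ ≤ _ := h1

/-- Grönwall's inequality along the segment from `w` to `v`: a derivative bounded by the function
itself permits at most exponential growth. -/
lemma abs_affine_le_of_fderiv {E : Type*} [NormedAddCommGroup E] [NormedSpace ℝ E] {g : E → ℝ}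
    (hg : Differentiable ℝ g) {c₂ c₃ K : ℝ}
    (h : ∀ v, ‖fderiv ℝ g v‖ ≤ K * |c₂ * g v + c₃|) (w v : E) :
    |c₂ * g v + c₃| ≤ |c₂ * g w + c₃| * Real.exp (|c₂| * K * ‖v - w‖) := by
  have hγ : ∀ s : ℝ, HasDerivAt (fun s : ℝ => w + s • (v - w)) (v - w) s := fun s => by
    simpa using ((hasDerivAt_id s).smul_const (v - w)).const_add w
  have hd : ∀ s : ℝ, HasDerivAt (fun s : ℝ => c₂ * g (w + s • (v - w)) + c₃)
      (c₂ * fderiv ℝ g (w + s • (v - w)) (v - w)) s := fun s =>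
    (((hg _).hasFDerivAt.comp_hasDerivAt s (hγ s)).const_mul c₂).add_const c₃
  have h1 := norm_le_gronwallBound_of_norm_deriv_right_le (a := 0) (b := 1)
    (f := fun s : ℝ => c₂ * g (w + s • (v - w)) + c₃) (δ := |c₂ * g w + c₃|)
    (K := |c₂| * K * ‖v - w‖) (ε := 0)
    (fun s _ => (hd s).continuousAt.continuousWithinAt) (fun s _ => (hd s).hasDerivWithinAt)
    (by simp)
    (fun s _ => by
      rw [norm_mul, add_zero, Real.norm_eq_abs]
      calc |c₂| * ‖fderiv ℝ g (w + s • (v - w)) (v - w)‖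
          ≤ |c₂| * (K * |c₂ * g (w + s • (v - w)) + c₃| * ‖v - w‖) := by
            gcongr
            refine (ContinuousLinearMap.le_opNorm _ _).trans ?_
            gcongr
            exact h _
        _ = _ := by rw [Real.norm_eq_abs]; ring)
    1 (right_mem_Icc.2 zero_le_one)
  rw [gronwallBound_ε0] at h1
  simpa using h1

section Tame

variable {d : ℕ} {q : ℝ≥0∞} {Ω : Type*} [MeasurableSpace Ω] {P : Measure Ω} [Fact (1 ≤ q)]

lemma integral_norm_rpow (hq : q ≠ ∞) (X : RV d q P) :
    Integrable (fun ω => ‖X ω‖ ^ q.toReal) P ∧ ∫ ω, ‖X ω‖ ^ q.toReal ∂P = ‖X‖ ^ q.toReal := by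
  have hq0 : q ≠ 0 := (lt_of_lt_of_le zero_lt_one (Fact.out : 1 ≤ q)).ne'
  have hr : 0 < q.toReal := ENNReal.toReal_pos hq0 hq
  refine ⟨(Lp.memLp X).integrable_norm_rpow hq0 hq, ?_⟩
  have h0 : 0 ≤ ∫ ω, ‖X ω‖ ^ q.toReal ∂P := integral_nonneg fun ω => by positivity
  rw [Lp.norm_def, (Lp.memLp X).eLpNorm_eq_integral_rpow_norm hq0 hq,
    ENNReal.toReal_ofReal (by positivity), ← Real.rpow_mul h0, inv_mul_cancel₀ hr.ne',
    Real.rpow_one]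

variable [IsProbabilityMeasure P]

lemma moment_eq (hq : q ≠ ∞) (X Z : RV d q P) :
    moment X Z = ‖X‖ ^ q.toReal + ‖Z‖ ^ q.toReal + 1 := by
  obtain ⟨h1, h2⟩ := integral_norm_rpow hq X
  obtain ⟨h3, h4⟩ := integral_norm_rpow hq Z
  have h5 := integral_add (h1.add h3) (integrable_const (μ := P) (1 : ℝ))
  simp only [Pi.add_apply] at h5
  rw [moment, h5, integral_add h1 h3, h2, h4]
  simp

/-- Along a compact curve the moments are bounded, so the lower bound and the cheap velocity bound
`L` at `v₀` uniformly in the state. Grönwall's inequality extends this to bounded velocities, which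
turns the relative derivative bounds into absolute ones. -/
lemma tameLagrangian_of (hq : q ≠ ∞) {L : Space d → Space d → RV d q P → RV d q P → ℝ}
    {c₀ c₁ c₂ c₃ : ℝ} (hL : IsLagrangian L) (hc : ConvexCoercive L) (hd : LowerBound L c₀)
    (he : CheapVelocity L c₁) (hf : DerivativeBounds L c₂ c₃) {X V : ℝ → RV d q P}
    (hX : Continuous X) (hV : Continuous V) (hcpt : IsCompact (range fun t => (X t, V t))) :
    TameLagrangian fun t x v => L x v (X t) (V t) := by
  have hq0 : q ≠ 0 := (lt_of_lt_of_le zero_lt_one (Fact.out : 1 ≤ q)).ne'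
  have hr : 0 < q.toReal := ENNReal.toReal_pos hq0 hq
  obtain ⟨B, hB⟩ : ∃ B : ℝ, ∀ t, ‖X t‖ ≤ B ∧ ‖V t‖ ≤ B := by
    obtain ⟨B, hB⟩ := hcpt.isBounded.exists_norm_le
    refine ⟨B, fun t => ?_⟩
    have h1 := hB _ (mem_range_self t)
    exact ⟨(norm_fst_le _).trans h1, (norm_snd_le _).trans h1⟩
  obtain ⟨v₀, hv₀, hcheap⟩ := he
  obtain ⟨B₀, hB₀⟩ : ∃ B₀ : ℝ, ∀ t, ‖v₀ (X t, V t)‖ ≤ B₀ := by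
    obtain ⟨B₀, h⟩ := (hcpt.image hv₀).isBounded.exists_norm_le
    exact ⟨B₀, fun t => h _ ⟨_, mem_range_self t, rfl⟩⟩
  set M : ℝ := B ^ q.toReal + B ^ q.toReal + 1 with hMdef
  have hM : ∀ t, 0 ≤ moment (X t) (V t) ∧ moment (X t) (V t) ≤ M := by
    intro t
    rw [moment_eq hq]
    refine ⟨by positivity, ?_⟩
    rw [hMdef]
    gcongr
    exacts [(hB t).1, (hB t).2]
  have hM0 : 0 ≤ M := (hM 0).1.trans (hM 0).2
  have hB₀0 : 0 ≤ B₀ := (norm_nonneg _).trans (hB₀ 0)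
  have hlow : ∀ t x v, -(|c₀| * M) ≤ L x v (X t) (V t) := by
    intro t x v
    refine le_trans ?_ (hd x v (X t) (V t))
    have h1 : c₀ * moment (X t) (V t) ≤ |c₀| * M := by
      calc c₀ * moment (X t) (V t) ≤ |c₀| * moment (X t) (V t) := by
            gcongr
            · exact (hM t).1
            · exact le_abs_self _
        _ ≤ |c₀| * M := by gcongr; exact (hM t).2
    linarith
  set A : ℝ := |c₀| * M + |c₁| with hA
  have hA0 : 0 ≤ A := by positivity
  have hw : ∀ t x, |L x (v₀ (X t, V t)) (X t) (V t)| ≤ A := by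
    intro t x
    rw [abs_le]
    constructor
    · linarith [hlow t x (v₀ (X t, V t)), abs_nonneg c₁]
    · have : 0 ≤ |c₀| * M := by positivity
      linarith [hcheap x (X t) (V t), le_abs_self c₁]
  have hsm : ∀ t, ContDiff ℝ 2 (fun a : Space d × Space d => L a.1 a.2 (X t) (V t)) := fun t =>
    hf.smooth (X t) (V t)
  have hdv : ∀ t x, ContDiff ℝ 2 (fun v => L x v (X t) (V t)) := fun t x =>
    (hsm t).comp (f := fun v : Space d => (x, v)) (by fun_prop)
  have hdx : ∀ t v, ContDiff ℝ 2 (fun x => L x v (X t) (V t)) := fun t v =>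
    (hsm t).comp (f := fun x : Space d => (x, v)) (by fun_prop)
  have hfac : ∀ R : ℝ, ∃ F : ℝ, 0 ≤ F ∧ ∀ t x v, ‖v‖ ≤ R →
      (c₂ * L x v (X t) (V t) + c₃) * moment (X t) (V t) ≤ F := by
    intro R
    refine ⟨(|c₂| * A + |c₃|) * Real.exp (|c₂| * M * (|R| + B₀)) * M, by positivity,
      fun t x v hv => ?_⟩
    have h1 := abs_affine_le_of_fderiv (c₂ := c₂) (c₃ := c₃) (K := M)
      ((hdv t x).differentiable (by norm_num))
      (fun v => by
        refine (hf.dv x v (X t) (V t)).trans ?_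
        rw [mul_comm]
        calc moment (X t) (V t) * (c₂ * L x v (X t) (V t) + c₃)
            ≤ moment (X t) (V t) * |c₂ * L x v (X t) (V t) + c₃| := by
              gcongr
              · exact (hM t).1
              · exact le_abs_self _
          _ ≤ _ := by gcongr; exact (hM t).2) (v₀ (X t, V t)) v
    have h2 : |c₂ * L x (v₀ (X t, V t)) (X t) (V t) + c₃| ≤ |c₂| * A + |c₃| := by
      refine (abs_add_le _ _).trans ?_
      rw [abs_mul]
      gcongr
      exact hw t x
    have h3 : ‖v - v₀ (X t, V t)‖ ≤ |R| + B₀ :=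
      (norm_sub_le _ _).trans (add_le_add (hv.trans (le_abs_self R)) (hB₀ t))
    calc (c₂ * L x v (X t) (V t) + c₃) * moment (X t) (V t)
        ≤ |c₂ * L x v (X t) (V t) + c₃| * moment (X t) (V t) := by
          gcongr
          · exact (hM t).1
          · exact le_abs_self _
      _ ≤ ((|c₂| * A + |c₃|) * Real.exp (|c₂| * M * (|R| + B₀))) * M := by
          refine mul_le_mul ?_ (hM t).2 (hM t).1 (by positivity)
          refine h1.trans ?_
          gcongr
  refine ⟨?_, ?_, ?_, ?_, ?_⟩
  · exact hL.continuous.comp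
      (f := fun a : ℝ × Space d × Space d => (a.2.1, a.2.2, X a.1, V a.1)) (by fun_prop)
  · obtain ⟨θ, hθ, h⟩ := hc.convex B
    exact ⟨θ, hθ, fun t x => h x (X t) (V t) (hB t).1 (hB t).2⟩
  · intro R
    obtain ⟨F, hF, h⟩ := hfac (max R B₀)
    refine ⟨F * (|R| + B₀) + A, fun t x v hv => ?_⟩
    have h1 := (convex_closedBall (0 : Space d) (max R B₀)).norm_image_sub_le_of_norm_fderiv_le
      (f := fun v => L x v (X t) (V t)) (𝕜 := ℝ) (C := F)
      (fun v _ => (hdv t x).differentiable (by norm_num) v)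
      (fun v hv => (hf.dv x v (X t) (V t)).trans (h t x v (by simpa using hv)))
      (x := v₀ (X t, V t)) (y := v) (by simpa using Or.inr (hB₀ t)) (by simpa using Or.inl hv)
    have h3 : ‖v - v₀ (X t, V t)‖ ≤ |R| + B₀ :=
      (norm_sub_le _ _).trans (add_le_add (hv.trans (le_abs_self R)) (hB₀ t))
    have h4 : F * ‖v - v₀ (X t, V t)‖ ≤ F * (|R| + B₀) := by gcongr
    have h5 := abs_sub_abs_le_abs_sub (L x v (X t) (V t)) (L x (v₀ (X t, V t)) (X t) (V t))
    rw [Real.norm_eq_abs] at h1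
    linarith [hw t x]
  · intro R
    obtain ⟨F, hF, h⟩ := hfac R
    refine ⟨F, hF, fun t x y v w hv hw => ?_⟩
    refine abs_second_difference_le (f := fun v => L x v (X t) (V t))
      (g := fun v => L y v (X t) (V t)) (convex_closedBall (0 : Space d) R)
      ((hdv t x).differentiable (by norm_num)) ((hdv t y).differentiable (by norm_num)) ?_
      (by simpa using hv) (by simpa using hw)
    intro v hv
    have hcd : ContDiff ℝ 1 fun y => fderiv ℝ (fun w => L y w (X t) (V t)) v :=
      ContDiff.fderiv (f := fun y w => L y w (X t) (V t)) (g := fun _ => v) (m := 2) (n := 1)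
        (hsm t) contDiff_const (by norm_num)
    exact convex_univ.norm_image_sub_le_of_norm_fderiv_le (𝕜 := ℝ)
      (f := fun y => fderiv ℝ (fun w => L y w (X t) (V t)) v)
      (fun y _ => hcd.differentiable (by norm_num) y)
      (fun y _ => (hf.dxv y v (X t) (V t)).trans (h t y v (by simpa using hv)))
      (mem_univ y) (mem_univ x)
  · intro R
    obtain ⟨F, hF, h⟩ := hfac R
    refine ⟨F, hF, fun t v x y z hv => ?_⟩
    have hD : Differentiable ℝ fun x => L x v (X t) (V t) := (hdx t v).differentiable (by norm_num)
    refine abs_second_difference_le (f := fun x => L (x + z) v (X t) (V t))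
      (g := fun x => L x v (X t) (V t)) convex_univ
      (hD.comp (f := fun x : Space d => x + z) (by fun_prop)) hD ?_ (mem_univ x) (mem_univ y)
    intro y _
    rw [fderiv_comp_add_right (f := fun x => L x v (X t) (V t))]
    have hcd : ContDiff ℝ 1 fun y => fderiv ℝ (fun x => L x v (X t) (V t)) y :=
      (hdx t v).fderiv_right (by norm_num)
    have := convex_univ.norm_image_sub_le_of_norm_fderiv_le (𝕜 := ℝ)
      (f := fun y => fderiv ℝ (fun x => L x v (X t) (V t)) y)
      (fun y _ => hcd.differentiable (by norm_num) y)
      (fun y _ => (hf.dxx y v (X t) (V t)).trans (h t y v hv))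
      (mem_univ y) (mem_univ (y + z))
    simpa using this

end Tame

/-! ### Solutions of the extended mean-field game -/

/-! ### Stability of laws -/

section Laws

variable {d : ℕ} {q : ℝ≥0∞} {Ω : Type*} [MeasurableSpace Ω] {P : Measure Ω}

lemma law_eq_of_jointLaw_eq {X Z X' Z' : RV d q P} (h : jointLaw X Z = jointLaw X' Z') :
    law X = law X' := by
  have key : ∀ X Z : RV d q P, law X = (jointLaw X Z).map Prod.fst := fun X Z => by
    rw [jointLaw, AEMeasurable.map_map_of_aemeasurable measurable_fst.aemeasurable
      ((Lp.aestronglyMeasurable X).aemeasurable.prodMk (Lp.aestronglyMeasurable Z).aemeasurable)]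
    rfl
  rw [key X Z, key X' Z', h]

/-- Convergence in `L^q` implies convergence in distribution, whose limits are unique. This
transfers equality of laws from interior times to `T`. -/
lemma law_eq_of_tendsto [Fact (1 ≤ q)] [IsProbabilityMeasure P] {ι : Type*} {l : Filter ι}
    [l.IsCountablyGenerated] [l.NeBot] {X X' : ι → RV d q P} {Y Y' : RV d q P}
    (hX : Tendsto X l (𝓝 Y)) (hX' : Tendsto X' l (𝓝 Y')) (h : ∀ᶠ i in l, law (X i) = law (X' i)) :
    law Y = law Y' := by
  have h1 := ((tendstoInMeasure_of_tendsto_Lp hX).tendstoInDistribution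
    (fun i => (Lp.aestronglyMeasurable (X i)).aemeasurable)).tendsto
  have h2 := ((tendstoInMeasure_of_tendsto_Lp hX').tendstoInDistribution
    (fun i => (Lp.aestronglyMeasurable (X' i)).aemeasurable)).tendsto
  have h3 := tendsto_nhds_unique h1 (h2.congr' (h.mono fun i hi => Subtype.ext hi.symm))
  exact congrArg Subtype.val h3

end Laws

/-! ### The game with frozen flow: optimality and monotonicity -/

section Frozen

variable {d : ℕ} {q : ℝ≥0∞} {Ω : Type*} [MeasurableSpace Ω] {P : Measure Ω} [Fact (1 ≤ q)]

lemma IsViscositySolution.congr {T : ℝ} {F G : ℝ → Space d → Space d → ℝ} {u : ℝ → Space d → ℝ}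
    (h : IsViscositySolution T F u) (hFG : ∀ t ∈ Ioo 0 T, F t = G t) :
    IsViscositySolution T G u :=
  ⟨fun φ hφ t ht x hx => by rw [← hFG t ht]; exact h.sub φ hφ t ht x hx,
    fun φ hφ t ht x hx => by rw [← hFG t ht]; exact h.super φ hφ t ht x hx⟩

/-- The Lagrangian along the flow `X`, extended to all times by its values at `0` and `T`. -/
noncomputable def frozen (L : Space d → Space d → RV d q P → RV d q P → ℝ) {T : ℝ} (hT : 0 ≤ T)
    (X : ℝ → RV d q P) (t : ℝ) (x v : Space d) : ℝ :=
  L x v (X (projIcc 0 T hT t)) (velocity T X (projIcc 0 T hT t))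

lemma frozen_eq (L : Space d → Space d → RV d q P → RV d q P → ℝ) {T : ℝ} (hT : 0 ≤ T)
    (X : ℝ → RV d q P) {t : ℝ} (ht : t ∈ Icc 0 T) :
    frozen L hT X t = fun x v => L x v (X t) (velocity T X t) := by
  simp only [frozen, funext_iff]
  intro x v
  rw [projIcc_of_mem hT ht]

variable {T : ℝ} {L : Space d → Space d → RV d q P → RV d q P → ℝ} {ψ : Space d → RV d q P → ℝ}
  {X₀ : RV d q P} {u : ℝ → Space d → ℝ} {X : ℝ → RV d q P}

lemma IsSolution.hasDerivAt (h : IsSolution T L ψ X₀ u X) {t : ℝ} (ht : t ∈ Ioo 0 T) :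
    HasDerivAt X (velocity T X t) t :=
  ((h.X_contDiff.differentiableOn (by norm_num) t
    (Ioo_subset_Icc_self ht)).hasDerivWithinAt).hasDerivAt (Icc_mem_nhds ht.1 ht.2)

lemma IsSolution.lipschitzSolution (h : IsSolution T L ψ X₀ u X) (hT : 0 ≤ T) :
    LipschitzSolution T (frozen L hT X) u := by
  refine ⟨h.hamilton_jacobi.congr fun t ht => ?_, h.u_continuous, ?_⟩
  · rw [frozen_eq L hT X (Ioo_subset_Icc_self ht)]
    rfl
  · obtain ⟨K, hK⟩ := h.u_lipschitz
    refine ⟨K, K.2, fun t ht x y => ?_⟩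
    have := (hK t ht).dist_le_mul x y
    rwa [Real.dist_eq, dist_eq_norm] at this

lemma IsSolution.differentiableAt_slice (h : IsSolution T L ψ X₀ u X) {t : ℝ} (ht : t ∈ Ioo 0 T) :
    ∀ᵐ ω ∂P, DifferentiableAt ℝ (u t) (X t ω) := by
  filter_upwards [h.u_differentiable t ht] with ω hω
  exact hω.comp (f := fun y : Space d => (t, y)) (X t ω) (by fun_prop)

/-- At the initial time, differentiability of the value along the flow comes from Rademacher's
theorem. -/
lemma IsSolution.differentiableAt_initial (h : IsSolution T L ψ X₀ u X) (hT : 0 ≤ T)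
    (ha : InitialAC X₀) : ∀ᵐ ω ∂P, DifferentiableAt ℝ (u 0) (X 0 ω) := by
  obtain ⟨K, hK⟩ := h.u_lipschitz
  have h1 : ∀ᵐ x ∂(volume : Measure (Space d)), DifferentiableAt ℝ (u 0) x :=
    (hK 0 (left_mem_Icc.2 hT)).ae_differentiableAt
  have h2 : ∀ᵐ x ∂(law X₀), DifferentiableAt ℝ (u 0) x := ha.ae_le h1
  rw [h.initial]
  exact ae_of_ae_map (Lp.aestronglyMeasurable X₀).aemeasurable h2

/-- A right slope at `t < T` involves only values of `u` in `[t, T)`, so the data may be exchanged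
within `[0, T]`. This makes the second flow optimal for the first value function. -/
lemma OptimalFlow.congr {R : ℝ} {ℓ ℓ' : ℝ → Space d → Space d → ℝ} {w : ℝ → Space d → ℝ}
    {V : ℝ → RV d q P} (h : OptimalFlow P T R ℓ u X V) (hℓ : ∀ t ∈ Ioo 0 T, ℓ t = ℓ' t)
    (hw : ∀ t ∈ Icc 0 T, ∀ x, u t x = w t x) : OptimalFlow P T R ℓ' w X V := by
  refine ⟨h.cont, h.deriv, h.bdd, fun t ht => ?_⟩
  have h1 := h.slope t ht
  rw [hℓ t ht] at h1
  intro r hr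
  filter_upwards [h1 r hr, Ioo_mem_nhdsGT ht.2] with s hs hst
  have e : ∀ σ ∈ Icc 0 T, ∫ ω, -u σ (X σ ω) ∂P = ∫ ω, -w σ (X σ ω) ∂P := fun σ hσ => by
    simp only [hw σ hσ]
  rwa [← e s ⟨ht.1.le.trans hst.1.le, hst.2.le⟩, ← e t (Ioo_subset_Icc_self ht)]

variable [IsProbabilityMeasure P]

lemma IsSolution.tameLagrangian (hq : q ≠ ∞) {c₀ c₁ c₂ c₃ : ℝ} (hL : IsLagrangian L)
    (hc : ConvexCoercive L) (hd : LowerBound L c₀) (he : CheapVelocity L c₁)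
    (hf : DerivativeBounds L c₂ c₃) (h : IsSolution T L ψ X₀ u X) (hT : 0 < T) :
    TameLagrangian (frozen L hT.le X) := by
  have hXc : ContinuousOn X (Icc 0 T) := h.X_contDiff.continuousOn
  have hVc : ContinuousOn (velocity T X) (Icc 0 T) :=
    h.X_contDiff.continuousOn_derivWithin (uniqueDiffOn_Icc hT) le_rfl
  have hp : Continuous fun t => (projIcc 0 T hT.le t : ℝ) :=
    continuous_subtype_val.comp continuous_projIcc
  refine tameLagrangian_of hq hL hc hd he hf
    (hXc.comp_continuous hp fun t => (projIcc 0 T hT.le t).2)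
    (hVc.comp_continuous hp fun t => (projIcc 0 T hT.le t).2) ?_
  have : (range fun t => (X (projIcc 0 T hT.le t), velocity T X (projIcc 0 T hT.le t)))
      = (fun t => (X t, velocity T X t)) '' Icc 0 T := by
    ext z
    constructor
    · rintro ⟨t, rfl⟩
      exact ⟨projIcc 0 T hT.le t, (projIcc 0 T hT.le t).2, rfl⟩
    · rintro ⟨t, ht, rfl⟩
      refine ⟨t, ?_⟩
      simp only [projIcc_of_mem hT.le ht]
  rw [this]
  exact isCompact_Icc.image_of_continuousOn (hXc.prodMk hVc)

/-- The Lipschitz bound on `u` bounds its gradient, hence the velocities `-D_pH`. Every larger `R'`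
is allowed so that two flows can share one bound. -/
lemma IsSolution.optimalFlow (h : IsSolution T L ψ X₀ u X) (hT : 0 ≤ T)
    (hℓ : TameLagrangian (frozen L hT X)) :
    ∃ R : ℝ, 0 ≤ R ∧ ∀ R' ≥ R, OptimalFlow P T R' (frozen L hT X) u X (velocity T X) := by
  have hu := h.lipschitzSolution hT
  obtain ⟨K, -, hK⟩ := hu.norm_gradient_le
  obtain ⟨R, hR, hgr⟩ := hℓ.norm_gradient_conj_le K
  have hdyn : ∀ t ∈ Ioo 0 T, ∀ᵐ ω ∂P, velocity T X t ω =
      -gradient (conj (frozen L hT X t (X t ω))) (gradient (u t) (X t ω)) := by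
    intro t ht
    rw [frozen_eq L hT X (Ioo_subset_Icc_self ht)]
    exact h.dynamics t ht
  have hbdd : ∀ t ∈ Ioo 0 T, ∀ᵐ ω ∂P, ‖velocity T X t ω‖ ≤ R := by
    intro t ht
    filter_upwards [hdyn t ht] with ω hω
    rw [hω, norm_neg]
    exact hgr t _ _ (hK t (Ioo_subset_Icc_self ht) _)
  exact ⟨R, hR, fun R' hR' => ⟨h.X_contDiff.continuousOn, fun t ht => h.hasDerivAt ht,
    fun t ht => (hbdd t ht).mono fun ω hω => hω.trans hR',
    fun t ht => hu.lowerSlope_neg_value hℓ ht (h.hasDerivAt ht) (hbdd t ht)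
      (h.u_differentiable t ht) (hdyn t ht)⟩⟩

/-- By monotonicity, the states and velocities of two solutions have the same joint laws. -/
lemma IsSolution.jointLaw_eq {u' : ℝ → Space d → ℝ} {X' : ℝ → RV d q P} {R : ℝ} (hT : 0 < T)
    (hL : IsLagrangian L) (hb : TerminalRegular ψ) (hψmon : TerminalMonotone ψ)
    (hLmon : LagrangianMonotone L) (h : IsSolution T L ψ X₀ u X) (h' : IsSolution T L ψ X₀ u' X')
    (hℓ : TameLagrangian (frozen L hT.le X)) (hℓ' : TameLagrangian (frozen L hT.le X'))
    (hX : OptimalFlow P T R (frozen L hT.le X) u X (velocity T X))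
    (hX' : OptimalFlow P T R (frozen L hT.le X') u' X' (velocity T X')) {t : ℝ}
    (ht : t ∈ Ioo 0 T) :
    jointLaw (X t) (velocity T X t) = jointLaw (X' t) (velocity T X' t) := by
  have hu := h.lipschitzSolution hT.le
  have hu' := h'.lipschitzSolution hT.le
  have hTm : T ∈ Icc 0 T := right_mem_Icc.2 hT.le
  have m : ∀ U : RV d q P, AEStronglyMeasurable (fun ω => U ω) P := fun U =>
    Lp.aestronglyMeasurable U
  set G : ℝ → ℝ := fun s => ((∫ ω, u s (X' s ω) ∂P + ∫ ω, u' s (X s ω) ∂P)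
    + ∫ ω, -u s (X s ω) ∂P) + ∫ ω, -u' s (X' s ω) ∂P with hG
  have hGc : ContinuousOn G (Icc 0 T) := by
    refine (((hu.continuousOn_value hℓ hX'.cont).add (hu'.continuousOn_value hℓ' hX.cont)).add
      ?_).add ?_
    · simp only [integral_neg]; exact (hu.continuousOn_value hℓ hX.cont).neg
    · simp only [integral_neg]; exact (hu'.continuousOn_value hℓ' hX'.cont).neg
  set E : ℝ → ℝ := fun s => ∫ ω, lagrangianGap L (X s) (velocity T X s) (X' s) (velocity T X' s) ω ∂P
    with hE
  have hgap : ∀ s ∈ Ioo 0 T,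
      Integrable (lagrangianGap L (X s) (velocity T X s) (X' s) (velocity T X' s)) P ∧
      E s = -∫ ω, frozen L hT.le X s (X' s ω) (velocity T X' s ω) ∂P
        + -∫ ω, frozen L hT.le X' s (X s ω) (velocity T X s ω) ∂P
        + ∫ ω, frozen L hT.le X s (X s ω) (velocity T X s ω) ∂P
        + ∫ ω, frozen L hT.le X' s (X' s ω) (velocity T X' s ω) ∂P := by
    intro s hs
    have i1 := hℓ.integrable s (m (X s)) (m (velocity T X s)) (hX.bdd s hs)
    have i2 := hℓ'.integrable s (m (X' s)) (m (velocity T X' s)) (hX'.bdd s hs)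
    have i3 := hℓ.integrable s (m (X' s)) (m (velocity T X' s)) (hX'.bdd s hs)
    have i4 := hℓ'.integrable s (m (X s)) (m (velocity T X s)) (hX.bdd s hs)
    have e : lagrangianGap L (X s) (velocity T X s) (X' s) (velocity T X' s) = fun ω =>
        frozen L hT.le X s (X s ω) (velocity T X s ω)
        + frozen L hT.le X' s (X' s ω) (velocity T X' s ω)
        - frozen L hT.le X s (X' s ω) (velocity T X' s ω)
        - frozen L hT.le X' s (X s ω) (velocity T X s ω) := by
      funext ω
      rw [frozen_eq L hT.le X (Ioo_subset_Icc_self hs),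
        frozen_eq L hT.le X' (Ioo_subset_Icc_self hs), lagrangianGap]
      ring
    refine ⟨by rw [e]; exact ((i1.add i2).sub i3).sub i4, ?_⟩
    simp only [hE]
    rw [e, integral_add_sub_sub i1 i2 i3 i4]
    ring
  -- Each value function is tested on the other flow by the subsolution estimate and on its own flow
  -- by optimality; the four rates add up to the Lagrangian gap.
  have hGs : ∀ s ∈ Ioo 0 T, LowerSlope G s (E s) := by
    intro s hs
    rw [(hgap s hs).2]
    exact (((hu.lowerSlope_value hℓ hs (hX'.deriv s hs) (hX'.bdd s hs)).add
      (hu'.lowerSlope_value hℓ' hs (hX.deriv s hs) (hX.bdd s hs))).add (hX.slope s hs)).add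
      (hX'.slope s hs)
  have hEnn : ∀ s ∈ Ioo 0 T, 0 ≤ E s := by
    intro s hs
    by_cases hlaw : jointLaw (X s) (velocity T X s) = jointLaw (X' s) (velocity T X' s)
    · refine le_of_eq (integral_eq_zero_of_ae (Eventually.of_forall fun ω => ?_)).symm
      simp only [lagrangianGap, Pi.zero_apply]
      rw [hL.law_only _ _ _ _ _ _ hlaw, hL.law_only _ _ _ _ _ _ hlaw]
      ring
    · exact (hLmon _ _ _ _ hlaw (hgap s hs).1).le
  have hG0 : G 0 = 0 := by
    simp only [hG, h.initial, h'.initial, integral_neg]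
    ring
  have hGT : G T ≤ 0 := by
    have iψ : ∀ Y Z : RV d q P, Integrable (fun ω => ψ (Y ω) Z) P := by
      intro Y Z
      obtain ⟨K, hK⟩ := hb.lipschitz Z
      refine integrable_comp_lip (f := fun x => ψ x Z) (K := K) (fun x y => ?_) Y
      have := hK.dist_le_mul x y
      rwa [Real.dist_eq, dist_eq_norm] at this
    have h1 := hψmon (X T) (X' T)
    have e := integral_add_sub_sub (iψ (X T) (X T)) (iψ (X' T) (X' T)) (iψ (X T) (X' T))
      (iψ (X' T) (X T))
    have e2 : ∫ ω, (ψ (X T ω) (X T) - ψ (X T ω) (X' T) + ψ (X' T ω) (X' T) - ψ (X' T ω) (X T)) ∂P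
        = ∫ ω, (ψ (X T ω) (X T) + ψ (X' T ω) (X' T) - ψ (X T ω) (X' T) - ψ (X' T ω) (X T)) ∂P := by
      congr 1; funext ω; ring
    rw [e2, e] at h1
    simp only [hG, h.terminal, h'.terminal, integral_neg]
    linarith
  have hmono : ∀ a ∈ Icc 0 T, ∀ b ∈ Icc 0 T, a ≤ b → G a ≤ G b := by
    intro a ha b hb hab
    have := LowerSlope.le_sub (m := 0) hab (hGc.mono (Icc_subset_Icc ha.1 hb.2)) fun s hs =>
      (hGs s (Ioo_subset_Ioo ha.1 hb.2 hs)).mono (hEnn s (Ioo_subset_Ioo ha.1 hb.2 hs))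
    linarith
  have hzero : ∀ s ∈ Icc 0 T, G s = 0 := fun s hs =>
    le_antisymm ((hmono s hs T hTm hs.2).trans hGT)
      (hG0 ▸ hmono 0 (left_mem_Icc.2 hT.le) s hs hs.1)
  -- `G` is constant, so no positive number is a lower slope of it.
  have hEt : E t ≤ 0 := LowerSlope.nonpos_of_eq ht.2 (hGs t ht) fun s hs => by
    rw [hzero s ⟨ht.1.le.trans hs.1.le, hs.2.le⟩, hzero t (Ioo_subset_Icc_self ht)]
  by_contra hlaw
  exact absurd (hLmon _ _ _ _ hlaw (hgap t ht).1) (not_lt.2 hEt)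

end Frozen

end EMFG

theorem mainTheorem3 {d : ℕ} {q : ℝ≥0∞} [Fact (1 ≤ q)] (hq : q ≠ ∞)
    {Ω : Type*} [MeasurableSpace Ω] (P : Measure Ω) [IsProbabilityMeasure P]
    (T : ℝ) (hT : 0 < T)
    (L : EMFG.Space d → EMFG.Space d → EMFG.RV d q P → EMFG.RV d q P → ℝ)
    (ψ : EMFG.Space d → EMFG.RV d q P → ℝ) (X₀ : EMFG.RV d q P) (c₀ c₁ c₂ c₃ : ℝ)
    (hL : EMFG.IsLagrangian L) (hψ : EMFG.TerminalLawOnly ψ)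
    (ha : EMFG.InitialAC X₀)
    (hb : EMFG.TerminalRegular ψ)
    (hc : EMFG.ConvexCoercive L)
    (hd : EMFG.LowerBound L c₀)
    (he : EMFG.CheapVelocity L c₁)
    (hf : EMFG.DerivativeBounds L c₂ c₃)
    (hψmon : EMFG.TerminalMonotone ψ)
    (hLmon : EMFG.LagrangianMonotone L)
    (u u' : ℝ → EMFG.Space d → ℝ) (X X' : ℝ → EMFG.RV d q P)
    (hsol : EMFG.IsSolution T L ψ X₀ u X) (hsol' : EMFG.IsSolution T L ψ X₀ u' X') :
    (∀ t ∈ Icc 0 T, ∀ x : EMFG.Space d, u t x = u' t x) ∧ (∀ t ∈ Icc 0 T, X t = X' t) := by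
  obtain ⟨M, hM⟩ := hb.bounded
  have hℓ := hsol.tameLagrangian hq hL hc hd he hf hT
  have hℓ' := hsol'.tameLagrangian hq hL hc hd he hf hT
  obtain ⟨R, hR, hX⟩ := hsol.optimalFlow hT.le hℓ
  obtain ⟨R', hR', hX'⟩ := hsol'.optimalFlow hT.le hℓ'
  have hX := hX (max R R') (le_max_left _ _)
  have hX' := hX' (max R R') (le_max_right _ _)
  have hlaw : ∀ t ∈ Ioo 0 T, EMFG.jointLaw (X t) (EMFG.velocity T X t)
      = EMFG.jointLaw (X' t) (EMFG.velocity T X' t) := fun t ht =>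
    EMFG.IsSolution.jointLaw_eq hT hL hb hψmon hLmon hsol hsol' hℓ hℓ' hX hX' ht
  have hfr : ∀ t ∈ Ioo 0 T, EMFG.frozen L hT.le X' t = EMFG.frozen L hT.le X t := by
    intro t ht
    rw [EMFG.frozen_eq L hT.le X (Ioo_subset_Icc_self ht),
      EMFG.frozen_eq L hT.le X' (Ioo_subset_Icc_self ht)]
    funext x v
    exact (hL.law_only x v _ _ _ _ (hlaw t ht)).symm
  have hlawT : EMFG.law (X T) = EMFG.law (X' T) := by
    have htend : ∀ Y : ℝ → EMFG.RV d q P, ContinuousOn Y (Icc 0 T) →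
        Tendsto Y (nhdsWithin T (Ioo 0 T)) (nhds (Y T)) := fun Y hY =>
      (hY T (right_mem_Icc.2 hT.le)).mono Ioo_subset_Icc_self
    have : (nhdsWithin T (Ioo 0 T)).NeBot := by
      rw [nhdsWithin_Ioo_eq_nhdsLT hT]; infer_instance
    refine EMFG.law_eq_of_tendsto (htend X hX.cont) (htend X' hX'.cont) ?_
    filter_upwards [self_mem_nhdsWithin] with t ht
    exact EMFG.law_eq_of_jointLaw_eq (hlaw t ht)
  have hu := hsol.lipschitzSolution hT.le
  have hu' : EMFG.LipschitzSolution T (EMFG.frozen L hT.le X) u' := by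
    have h := hsol'.lipschitzSolution hT.le
    refine ⟨h.visc.congr fun t ht => ?_, h.cont, h.lip⟩
    rw [hfr t ht]
  have huu : ∀ t ∈ Icc 0 T, ∀ x, u t x = u' t x :=
    hu.eqOn hℓ hu' (fun x => by rw [hsol.terminal, hsol'.terminal, hψ x _ _ hlawT])
      ⟨M, fun x => by rw [hsol.terminal]; exact hM _ _⟩
  refine ⟨huu, ?_⟩
  have hX'' := hX'.congr hfr fun t ht x => (huu t ht x).symm
  refine hX.eqOn (hR.trans (le_max_left _ _)) hℓ hu hX'' (by rw [hsol.initial, hsol'.initial]) ?_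
  -- Differentiability at time `0` is obtained from the initial law; at later times it is part of
  -- the notion of solution.
  intro t ht
  rcases ht.1.eq_or_lt with rfl | h0
  · exact hsol.differentiableAt_initial hT.le ha
  · exact hsol.differentiableAt_slice ⟨h0, ht.2⟩
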